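/- Let $\mathfrak h$ be a finite-dimensional complex vector space. For a finite complex reflection group $G\le GL(\mathfrak h)$ (non-trivial, finite, generated by its set $\mathrm{Ref}(G)$ of elements $s$ with $\mathrm{Ker}(\mathrm{id}-s)$ of codimension one), a $G$-conjugation-invariant function $\mathbf c:\mathrm{Ref}(G)\to\mathbb C$ and a parameter $t$ (a complex number or an indeterminate $\mathbf t$), the rational Cherednik algebra $H_{t,\mathbf c}(G)$ is the quotient of the skew group algebra $T(\mathfrak h\oplus\mathfrak h^*)\rtimes G$ (tensored with $\mathbb C[\mathbf t]$ if $t=\mathbf t$) by the relations $[y,y']=[x,x']=0$ and $$[y,x]=t\,x(y)-\sum_{s\in\mathrm{Ref}(G)}\mathbf c(s)\,\alpha_s(y)\,x(\alpha_s^\vee)\,s\qquad(y,y'\in\mathfrak h,\ x,x'\in\mathfrak h^*),$$ where $\alpha_s$ and $\alpha_s^\vee$ span the images of $s-1$ on $\mathfrak h^*$ and on $\mathfrak h$, and $\alpha_s(\alpha_s^\vee)=2$. Let $Z_{\mathbf c}(G)$ be the centre of $H_{\mathbf c}(G):=H_{0,\mathbf c}(G)$ and $\mathcal X_{\mathbf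 c}(G)=\mathrm{Spec}\,Z_{\mathbf c}(G)$ the Calogero–Moser space. For $z_1,z_2\in Z_{\mathbf c}(G)$ with lifts $\hat z_1,\hat z_2\in H_{\mathbf t,\mathbf c}(G)$, put $\{z_1,z_2\}=\big(\tfrac1{\mathbf t}[\hat z_1,\hat z_2]\big)\big|_{\mathbf t=0}$. Let $(\mathfrak h,W)$ be an irreducible finite complex reflection group and $K\lhd W$ a normal subgroup which is itself a complex reflection group on $\mathfrak h$. Let $\mathbf c:\mathrm{Ref}(K)\to\mathbb C$ be invariant under conjugation by $W$, extended by zero to $\mathrm{Ref}(W)$, and let $\Gamma=W/K$. The group $W$ acts on $H_{\mathbf c}(K)$ by the automorphisms $y\mapsto w(y)$, $x\mapsto w(x)$, $k\mapsto wkw^{-1}$, and this induces an action of $\Gamma$ on $Z_{\mathbf c}(K)$. Then the brackets above are well defined and make $Z_{\mathbf c}(K)$ and $Z_{\mathbf c}(W)$ Poisson algebras; the homomorphism $H_{\mathbf c}(K)\to H_{\mathbf c}(W)$ extending $K\hookrightarrow W$ and the identity of $\mathfrak h$ and $\mathfrak h^*$ is injective; and, as subalgebras of $H_{\mathbf c}(W)$,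 $$Z_{\mathbf c}(W)=Z_{\mathbf c}(K)^{\Gamma}.$$ The embedding $Z_{\mathbf c}(W)\hookrightarrow Z_{\mathbf c}(K)$ is a homomorphism of Poisson algebras, and the induced morphism $\eta:\mathcal X_{\mathbf c}(K)\to\mathcal X_{\mathbf c}(W)$ identifies $\mathcal X_{\mathbf c}(W)$ with the quotient $\mathcal X_{\mathbf c}(K)/\Gamma$: $\eta$ is $\Gamma$-invariant, it is a topological quotient map whose fibres are the $\Gamma$-orbits, and for every open $U\subseteq\mathcal X_{\mathbf c}(W)$ the functions on $U$ are the $\Gamma$-invariant functions on $\eta^{-1}(U)$. -/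

import Mathlib

open CategoryTheory AlgebraicGeometry

noncomputable section

namespace CalogeroMoser

universe u

section Groups

variable {V : Type u} [AddCommGroup V] [Module ℂ V]

/-- The set `Ref(G)` of reflections of `G ≤ GL(V)`: the elements `s` of `G` such that
`Ker(id - s)` has codimension one. -/
def Ref (G : Subgroup (V ≃ₗ[ℂ] V)) : Set (V ≃ₗ[ℂ] V) :=
  {s | s ∈ G ∧
    Module.finrank ℂ (V ⧸ LinearMap.ker (LinearMap.id - (s : V →ₗ[ℂ] V))) = 1}

/-- `G ≤ GL(V)` is a (finite) complex reflection group: it is non-trivial, finite and generated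
by its reflections. -/
structure IsComplexReflectionGroup (G : Subgroup (V ≃ₗ[ℂ] V)) : Prop where
  finite : Finite G
  ne_bot : G ≠ ⊥
  generated : Subgroup.closure (Ref G) = G

/-- `V` is an irreducible representation of `G ≤ GL(V)`. -/
structure IsIrreducibleGroup (G : Subgroup (V ≃ₗ[ℂ] V)) : Prop where
  nontrivial : Nontrivial V
  eq_bot_or_eq_top : ∀ p : Submodule ℂ V, (∀ g ∈ G, ∀ v ∈ p, g v ∈ p) → p = ⊥ ∨ p = ⊤

/-- The contragredient action of `GL(V)` on `V*`: `(g x)(y) = x (g⁻¹ y)`. -/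
def dualAct (g : V ≃ₗ[ℂ] V) : Module.Dual ℂ V ≃ₗ[ℂ] Module.Dual ℂ V :=
  g.symm.dualMap

@[simp] theorem dualAct_apply (g : V ≃ₗ[ℂ] V) (x : Module.Dual ℂ V) (y : V) :
    dualAct g x y = x (g.symm y) := rfl

/-- `(α, αv)` is a normalised pair of a root `α ∈ Im (s - 1)|_{V*}` and a coroot
`αv ∈ Im (s - 1)|_V` of the reflection `s`: `α(αv) = 2`. -/
structure IsRootPair (s : V ≃ₗ[ℂ] V) (α : Module.Dual ℂ V) (αv : V) : Prop where
  root_mem : ∃ x : Module.Dual ℂ V, dualAct s x - x = α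
  coroot_mem : ∃ y : V, s y - y = αv
  pairing : α αv = 2

/-- The number `(y, α_s) (α_s^∨, x) = α_s(y) x(α_s^∨)` for a reflection `s` with normalised root
`α_s` and coroot `α_s^∨`. It does not depend on their choice, and is written here without one:
see `rootForm_eq` and `exists_isRootPair` below. -/
def rootForm (s : V ≃ₗ[ℂ] V) (y : V) (x : Module.Dual ℂ V) : ℂ :=
  2 * (LinearMap.trace ℂ V ((s : V →ₗ[ℂ] V) - LinearMap.id))⁻¹ * x (s y - y)


theorem exists_rank_one {G : Subgroup (V ≃ₗ[ℂ] V)} {s : V ≃ₗ[ℂ] V} (hs : s ∈ Ref G) :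
    ∃ (f : Module.Dual ℂ V) (v : V), f ≠ 0 ∧ v ≠ 0 ∧ ∀ y, s y - y = f y • v := by
  obtain ⟨-, h⟩ := hs
  rw [LinearEquiv.finrank_eq (LinearMap.quotKerEquivRange _)] at h
  obtain ⟨⟨v, hv⟩, hv0, hspan⟩ := finrank_eq_one_iff'.mp h
  have key : ∀ y, ∃ c : ℂ, s y - y = c • v := by
    intro y
    obtain ⟨c, hc⟩ := hspan ⟨_, LinearMap.mem_range_self _ y⟩
    refine ⟨-c, ?_⟩
    have := congrArg Subtype.val hc
    simp at this
    rw [neg_smul, this]; abel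
  have hv0' : v ≠ 0 := fun h => hv0 (Subtype.ext h)
  obtain ⟨φ, hφ⟩ := Module.Projective.exists_dual_ne_zero ℂ hv0'
  refine ⟨(φ v)⁻¹ • (φ ∘ₗ ((s : V →ₗ[ℂ] V) - LinearMap.id)), v, ?_, hv0', ?_⟩
  · obtain ⟨w, hw⟩ := hv
    intro h0
    have := congrArg (fun f : Module.Dual ℂ V => f w) h0
    simp at this hw
    rcases this with h1 | h1
    · exact hφ h1
    · apply hφ
      rw [← hw, map_sub]
      rw [sub_eq_zero] at h1
      rw [h1, sub_self]
  · intro y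
    obtain ⟨c, hc⟩ := key y
    have : ((φ v)⁻¹ • (φ ∘ₗ ((s : V →ₗ[ℂ] V) - LinearMap.id))) y = c := by
      simp only [LinearMap.smul_apply, LinearMap.comp_apply, LinearMap.sub_apply,
        LinearEquiv.coe_coe, LinearMap.id_apply, hc, map_smul, smul_eq_mul]
      field_simp
    rw [this, hc]

theorem trace_sub_id [FiniteDimensional ℂ V] {s : V ≃ₗ[ℂ] V} {f : Module.Dual ℂ V} {v : V}
    (h : ∀ y, s y - y = f y • v) :
    LinearMap.trace ℂ V ((s : V →ₗ[ℂ] V) - LinearMap.id) = f v := by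
  have : (s : V →ₗ[ℂ] V) - LinearMap.id = LinearMap.smulRight f v := by
    ext y; simpa using h y
  rw [this, LinearMap.trace_smulRight]

theorem exists_isRootPair {G : Subgroup (V ≃ₗ[ℂ] V)} [Finite G] {s : V ≃ₗ[ℂ] V}
    (hs : s ∈ Ref G) : ∃ α αv, IsRootPair s α αv := by
  obtain ⟨f, v, hf, hv, h⟩ := exists_rank_one hs
  have hfv : f v ≠ 0 := by
    intro h0
    have hpow : ∀ (n : ℕ) y, (s ^ n) y = y + (n : ℂ) • f y • v := by
      intro n
      induction n with
      | zero => intro y; simp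
      | succ n ih =>
        intro y
        have h1 : s y = y + f y • v := by rw [← h y]; abel
        rw [pow_succ, LinearEquiv.mul_apply, ih, h1]
        simp only [map_add, map_smul, h0, smul_eq_mul, mul_zero, add_zero, Nat.cast_add,
          Nat.cast_one]
        module
    obtain ⟨n, hn, hs1⟩ := isOfFinOrder_iff_pow_eq_one.mp
      (isOfFinOrder_of_finite (⟨s, hs.1⟩ : G))
    have hs2 : s ^ n = 1 := congrArg Subtype.val hs1
    apply hf
    ext y
    have h2 := hpow n y
    rw [hs2] at h2
    have h3 : ((n : ℂ) * f y) • v = 0 := by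
      rw [mul_smul]
      simpa using h2
    rcases smul_eq_zero.mp h3 with h4 | h4
    · simpa [hn.ne'] using h4
    · exact absurd h4 hv
  have h1 : s v = (1 + f v) • v := by
    rw [add_smul, one_smul, ← h v]; abel
  have h1' : (1 + f v) ≠ 0 := by
    intro h0
    rw [h0, zero_smul] at h1
    exact hv (s.map_eq_zero_iff.mp h1)
  have hsymm : ∀ y, f (s.symm y) * (1 + f v) = f y := by
    intro y
    have h2 := congrArg f (h (s.symm y))
    simp only [LinearEquiv.apply_symm_apply, map_sub, map_smul, smul_eq_mul] at h2
    linear_combination -h2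
  have hgen : ∀ (x : Module.Dual ℂ V), dualAct s x - x = (-(x v) / (1 + f v)) • f := by
    intro x
    ext y
    have h2 := congrArg x (h (s.symm y))
    simp only [LinearEquiv.apply_symm_apply, map_sub, map_smul, smul_eq_mul] at h2
    simp only [LinearMap.sub_apply, dualAct_apply, LinearMap.smul_apply, smul_eq_mul]
    have h3 := hsymm y
    field_simp
    linear_combination -(1 + f v) * h2 - x v * h3
  refine ⟨f, (2 / f v) • v, ⟨(-(1 + f v) / f v) • f, ?_⟩, ⟨(2 / (f v) ^ 2) • v, ?_⟩, ?_⟩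
  · rw [hgen]
    ext y
    simp only [LinearMap.smul_apply, smul_eq_mul]
    field_simp
  · rw [h, map_smul, smul_eq_mul]
    congr 1
    field_simp
  · simp only [map_smul, smul_eq_mul]
    field_simp

theorem rootForm_eq [FiniteDimensional ℂ V] {G : Subgroup (V ≃ₗ[ℂ] V)} {s : V ≃ₗ[ℂ] V}
    (hs : s ∈ Ref G) {α : Module.Dual ℂ V} {αv : V} (hα : IsRootPair s α αv)
    (y : V) (x : Module.Dual ℂ V) : rootForm s y x = α y * x αv := by
  obtain ⟨f, v, hf, hv, h⟩ := exists_rank_one hs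
  obtain ⟨⟨x₀, hx₀⟩, ⟨y₀, hy₀⟩, h2⟩ := hα
  have h1 : s v = (1 + f v) • v := by
    rw [add_smul, one_smul, ← h v]; abel
  have h1' : (1 + f v) ≠ 0 := by
    intro h0
    rw [h0, zero_smul] at h1
    exact hv (s.map_eq_zero_iff.mp h1)
  have hα' : ∀ y, α y = (-(x₀ v) / (1 + f v)) * f y := by
    intro y
    have h2 := congrArg x₀ (h (s.symm y))
    have h3 := congrArg f (h (s.symm y))
    simp only [LinearEquiv.apply_symm_apply, map_sub, map_smul, smul_eq_mul] at h2 h3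
    rw [← hx₀]
    simp only [LinearMap.sub_apply, dualAct_apply]
    field_simp
    linear_combination -(1 + f v) * h2 + x₀ v * h3
  rw [← hy₀, h, map_smul, smul_eq_mul, hα'] at h2
  have hfv : f v ≠ 0 := by
    intro h0
    rw [h0] at h2
    norm_num at h2
  rw [rootForm, trace_sub_id h, hα', ← hy₀, h, h, map_smul, map_smul, smul_eq_mul, smul_eq_mul,
    ← h2]
  field_simp

theorem mem_of_mem_ref {G : Subgroup (V ≃ₗ[ℂ] V)} {s : V ≃ₗ[ℂ] V} (hs : s ∈ Ref G) : s ∈ G :=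
  hs.1

theorem ref_conj_mem {G G' : Subgroup (V ≃ₗ[ℂ] V)} {g s : V ≃ₗ[ℂ] V} (hs : s ∈ Ref G)
    (h : g * s * g⁻¹ ∈ G') : g * s * g⁻¹ ∈ Ref G' := by
  refine ⟨h, ?_⟩
  rw [← hs.2]
  symm
  refine LinearEquiv.finrank_eq (Submodule.Quotient.equiv _ _ g ?_)
  ext y
  simp only [Submodule.mem_map, LinearMap.mem_ker, LinearMap.sub_apply, LinearMap.id_apply,
    LinearEquiv.coe_coe, LinearEquiv.mul_apply, sub_eq_zero]
  constructor
  · rintro ⟨z, hz, rfl⟩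
    show g z = g (s (g.symm (g z)))
    rw [LinearEquiv.symm_apply_apply, ← hz]
  · intro hy
    refine ⟨g.symm y, ?_, LinearEquiv.apply_symm_apply _ _⟩
    apply g.injective
    rw [LinearEquiv.apply_symm_apply]
    exact hy

theorem rootForm_conj (g s : V ≃ₗ[ℂ] V) (y : V) (x : Module.Dual ℂ V) :
    rootForm (g * s * g⁻¹) (g y) (dualAct g x) = rootForm s y x := by
  have h : (((g * s * g⁻¹ : V ≃ₗ[ℂ] V) : V →ₗ[ℂ] V) - LinearMap.id)
      = g.conj ((s : V →ₗ[ℂ] V) - LinearMap.id) := by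
    ext y
    simp only [LinearMap.sub_apply, LinearEquiv.coe_coe, LinearEquiv.conj_apply_apply,
      LinearMap.id_apply, map_sub, LinearEquiv.apply_symm_apply]
    rfl
  have h2 : (g * s * g⁻¹) (g y) = g (s y) := by
    show g (s (g.symm (g y))) = _
    rw [LinearEquiv.symm_apply_apply]
  rw [rootForm, rootForm, h, LinearMap.trace_conj', h2, ← map_sub, dualAct_apply,
    LinearEquiv.symm_apply_apply]

end Groups

section Algebras

variable {V : Type u} [AddCommGroup V] [Module ℂ V]

variable (V) in
/-- The tensor algebra `T(V ⊕ V*)`. -/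
abbrev TensorVV : Type u := TensorAlgebra ℂ (V × Module.Dual ℂ V)

/-- The action of `g ∈ GL(V)` on `T(V ⊕ V*)`. -/
def tensorAct (g : V ≃ₗ[ℂ] V) : TensorVV V →ₐ[ℂ] TensorVV V :=
  TensorAlgebra.lift ℂ
    (TensorAlgebra.ι ℂ ∘ₗ (g.prodCongr (dualAct g) : (V × Module.Dual ℂ V) →ₗ[ℂ] _))

@[simp] theorem tensorAct_ι (g : V ≃ₗ[ℂ] V) (p : V × Module.Dual ℂ V) :
    tensorAct g (TensorAlgebra.ι ℂ p) = TensorAlgebra.ι ℂ (g p.1, dualAct g p.2) := by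
  simp [tensorAct]

theorem tensorAct_one : tensorAct (1 : V ≃ₗ[ℂ] V) = AlgHom.id ℂ _ := by
  apply TensorAlgebra.hom_ext
  apply LinearMap.ext
  intro p
  simp only [LinearMap.comp_apply, AlgHom.toLinearMap_apply, tensorAct_ι]
  rfl

theorem tensorAct_mul (g h : V ≃ₗ[ℂ] V) :
    tensorAct (g * h) = (tensorAct g).comp (tensorAct h) := by
  apply TensorAlgebra.hom_ext
  apply LinearMap.ext
  intro p
  simp only [LinearMap.comp_apply, AlgHom.toLinearMap_apply, tensorAct_ι, AlgHom.comp_apply]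
  rfl

/-- `GL(V)` acts on `T(V ⊕ V*)` by algebra automorphisms. -/
instance tensorAction : MulSemiringAction (V ≃ₗ[ℂ] V) (TensorVV V) where
  smul g a := tensorAct g a
  one_smul a := by
    show tensorAct 1 a = a
    rw [tensorAct_one]; rfl
  mul_smul g h a := by
    show tensorAct (g * h) a = tensorAct g (tensorAct h a)
    rw [tensorAct_mul]; rfl
  smul_zero g := map_zero (tensorAct g)
  smul_add g := map_add (tensorAct g)
  smul_one g := map_one (tensorAct g)
  smul_mul g := map_mul (tensorAct g)

theorem smul_tensor_def (g : V ≃ₗ[ℂ] V) (a : TensorVV V) : g • a = tensorAct g a := rfl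

instance tensorAction_comm : SMulCommClass (V ≃ₗ[ℂ] V) ℂ (TensorVV V) where
  smul_comm g r a := map_smul (tensorAct g) r a

instance tensorAction_comm' (G : Subgroup (V ≃ₗ[ℂ] V)) : SMulCommClass G ℂ (TensorVV V) where
  smul_comm g r a := map_smul (tensorAct (g : V ≃ₗ[ℂ] V)) r a

/-- The skew group algebra `T(V ⊕ V*) ⋊ G`. -/
def SkewGroupAlgebra (G : Subgroup (V ≃ₗ[ℂ] V)) : Type u :=
  SkewMonoidAlgebra (TensorVV V) G

instance (G : Subgroup (V ≃ₗ[ℂ] V)) : Ring (SkewGroupAlgebra G) :=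
  inferInstanceAs (Ring (SkewMonoidAlgebra (TensorVV V) G))

instance (G : Subgroup (V ≃ₗ[ℂ] V)) : Algebra ℂ (SkewGroupAlgebra G) :=
  inferInstanceAs (Algebra ℂ (SkewMonoidAlgebra (TensorVV V) G))

/-- The element `y ∈ V` of the skew group algebra. -/
def vec (G : Subgroup (V ≃ₗ[ℂ] V)) (y : V) : SkewGroupAlgebra G :=
  SkewMonoidAlgebra.single 1 (TensorAlgebra.ι ℂ (y, 0))

/-- The element `x ∈ V*` of the skew group algebra. -/
def covec (G : Subgroup (V ≃ₗ[ℂ] V)) (x : Module.Dual ℂ V) : SkewGroupAlgebra G :=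
  SkewMonoidAlgebra.single 1 (TensorAlgebra.ι ℂ (0, x))

/-- The element `g ∈ G` of the skew group algebra. -/
def grp {G : Subgroup (V ≃ₗ[ℂ] V)} (g : G) : SkewGroupAlgebra G :=
  SkewMonoidAlgebra.single g 1

/-- The element `∑_{s ∈ Ref(G)} c(s) (y, α_s) (α_s^∨, x) s`. -/
def reflectionSum (G : Subgroup (V ≃ₗ[ℂ] V)) (c : (V ≃ₗ[ℂ] V) → ℂ) (y : V)
    (x : Module.Dual ℂ V) : SkewGroupAlgebra G :=
  ∑ᶠ s : Ref G, (c s * rootForm (s : V ≃ₗ[ℂ] V) y x) • grp (⟨s, mem_of_mem_ref s.2⟩ : G)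

/-- The defining relations of the rational Cherednik algebra, imposed on an algebra `B` that
receives `T(V ⊕ V*) ⋊ G` by `j` and contains the (central) parameter `t`. -/
inductive CherednikRel (G : Subgroup (V ≃ₗ[ℂ] V)) (c : (V ≃ₗ[ℂ] V) → ℂ)
    {B : Type u} [Ring B] [Algebra ℂ B] (j : SkewGroupAlgebra G →ₐ[ℂ] B) (t : B) : B → B → Prop
  | vec_vec (y y' : V) :
      CherednikRel G c j t (j (vec G y * vec G y' - vec G y' * vec G y)) 0
  | covec_covec (x x' : Module.Dual ℂ V) :
      CherednikRel G c j t (j (covec G x * covec G x' - covec G x' * covec G x)) 0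
  | vec_covec (y : V) (x : Module.Dual ℂ V) :
      CherednikRel G c j t (j (vec G y * covec G x - covec G x * vec G y))
        (x y • t - j (reflectionSum G c y x))

/-- The rational Cherednik algebra `H_{t,c}(G)` at a complex number `t`. Only the values of `c` on
`Ref(G)` are used. -/
def Cherednik (G : Subgroup (V ≃ₗ[ℂ] V)) (t : ℂ) (c : (V ≃ₗ[ℂ] V) → ℂ) : Type u :=
  RingQuot (CherednikRel G c (AlgHom.id ℂ (SkewGroupAlgebra G)) (algebraMap ℂ _ t))

/-- The rational Cherednik algebra `H_{𝐭,c}(G)` with `𝐭` an indeterminate: a quotient of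
`ℂ[𝐭] ⊗ (T(V ⊕ V*) ⋊ G) = (T(V ⊕ V*) ⋊ G)[𝐭]`. -/
def GenericCherednik (G : Subgroup (V ≃ₗ[ℂ] V)) (c : (V ≃ₗ[ℂ] V) → ℂ) : Type u :=
  RingQuot (CherednikRel (B := Polynomial (SkewGroupAlgebra G)) G c Polynomial.CAlgHom
    Polynomial.X)

instance (G : Subgroup (V ≃ₗ[ℂ] V)) (t : ℂ) (c : (V ≃ₗ[ℂ] V) → ℂ) : Ring (Cherednik G t c) :=
  inferInstanceAs (Ring (RingQuot _))

instance (G : Subgroup (V ≃ₗ[ℂ] V)) (t : ℂ) (c : (V ≃ₗ[ℂ] V) → ℂ) :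
    Algebra ℂ (Cherednik G t c) :=
  inferInstanceAs (Algebra ℂ (RingQuot _))

instance (G : Subgroup (V ≃ₗ[ℂ] V)) (c : (V ≃ₗ[ℂ] V) → ℂ) : Ring (GenericCherednik G c) :=
  inferInstanceAs (Ring (RingQuot _))

instance (G : Subgroup (V ≃ₗ[ℂ] V)) (c : (V ≃ₗ[ℂ] V) → ℂ) : Algebra ℂ (GenericCherednik G c) :=
  inferInstanceAs (Algebra ℂ (RingQuot _))

/-- The projection `T(V ⊕ V*) ⋊ G → H_{t,c}(G)`. -/
def Cherednik.mk (G : Subgroup (V ≃ₗ[ℂ] V)) (t : ℂ) (c : (V ≃ₗ[ℂ] V) → ℂ) :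
    SkewGroupAlgebra G →ₐ[ℂ] Cherednik G t c :=
  RingQuot.mkAlgHom ℂ _

/-- The projection `(T(V ⊕ V*) ⋊ G)[𝐭] → H_{𝐭,c}(G)`. -/
def GenericCherednik.mk (G : Subgroup (V ≃ₗ[ℂ] V)) (c : (V ≃ₗ[ℂ] V) → ℂ) :
    Polynomial (SkewGroupAlgebra G) →ₐ[ℂ] GenericCherednik G c :=
  RingQuot.mkAlgHom ℂ _

/-- The indeterminate `𝐭` of `H_{𝐭,c}(G)`. -/
def tVar (G : Subgroup (V ≃ₗ[ℂ] V)) (c : (V ≃ₗ[ℂ] V) → ℂ) : GenericCherednik G c :=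
  GenericCherednik.mk G c Polynomial.X

theorem Cherednik.mk_vec_vec (G : Subgroup (V ≃ₗ[ℂ] V)) (t : ℂ) (c : (V ≃ₗ[ℂ] V) → ℂ)
    (y y' : V) : Cherednik.mk G t c (vec G y * vec G y' - vec G y' * vec G y) = 0 := by
  have := RingQuot.mkAlgHom_rel ℂ (CherednikRel.vec_vec (c := c)
    (j := AlgHom.id ℂ (SkewGroupAlgebra G)) (t := algebraMap ℂ _ t) y y')
  exact this.trans (map_zero _)

theorem Cherednik.mk_covec_covec (G : Subgroup (V ≃ₗ[ℂ] V)) (t : ℂ) (c : (V ≃ₗ[ℂ] V) → ℂ)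
    (x x' : Module.Dual ℂ V) :
    Cherednik.mk G t c (covec G x * covec G x' - covec G x' * covec G x) = 0 := by
  have := RingQuot.mkAlgHom_rel ℂ (CherednikRel.covec_covec (c := c)
    (j := AlgHom.id ℂ (SkewGroupAlgebra G)) (t := algebraMap ℂ _ t) x x')
  exact this.trans (map_zero _)

theorem Cherednik.mk_vec_covec (G : Subgroup (V ≃ₗ[ℂ] V)) (t : ℂ) (c : (V ≃ₗ[ℂ] V) → ℂ)
    (y : V) (x : Module.Dual ℂ V) :
    Cherednik.mk G t c (vec G y * covec G x - covec G x * vec G y) =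
      Cherednik.mk G t c (x y • algebraMap ℂ _ t - reflectionSum G c y x) :=
  RingQuot.mkAlgHom_rel ℂ (CherednikRel.vec_covec (c := c)
    (j := AlgHom.id ℂ (SkewGroupAlgebra G)) (t := algebraMap ℂ _ t) y x)

/-- The projection `H_{𝐭,c}(G) → H_{𝐭,c}(G) / 𝐭 H_{𝐭,c}(G) = H_{0,c}(G)`. -/
def specialize (G : Subgroup (V ≃ₗ[ℂ] V)) (c : (V ≃ₗ[ℂ] V) → ℂ) :
    GenericCherednik G c →+* Cherednik G 0 c :=
  RingQuot.lift ⟨((Cherednik.mk G 0 c : _ →ₐ[ℂ] _) : _ →+* _).comp Polynomial.constantCoeff, by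
    rintro _ _ (⟨y, y'⟩ | ⟨x, x'⟩ | ⟨y, x⟩)
    · simpa [Polynomial.CAlgHom] using Cherednik.mk_vec_vec G 0 c y y'
    · simpa [Polynomial.CAlgHom] using Cherednik.mk_covec_covec G 0 c x x'
    · simpa [Polynomial.CAlgHom] using Cherednik.mk_vec_covec G 0 c y x⟩

theorem specialize_mk (G : Subgroup (V ≃ₗ[ℂ] V)) (c : (V ≃ₗ[ℂ] V) → ℂ)
    (p : Polynomial (SkewGroupAlgebra G)) :
    specialize G c (GenericCherednik.mk G c p) = Cherednik.mk G 0 c (p.coeff 0) := by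
  have h := RingQuot.mkAlgHom_coe ℂ (CherednikRel
    (B := Polynomial (SkewGroupAlgebra G)) G c Polynomial.CAlgHom Polynomial.X)
  have h2 : GenericCherednik.mk G c p = RingQuot.mkRingHom _ p := congrArg (fun f => f p) h
  rw [h2]
  exact RingQuot.lift_mkRingHom_apply _ _ _

/-- For `g ∈ GL(V)` and a group homomorphism `φ : G → G'` of the form `φ(k) = g k g⁻¹`, the algebra
homomorphism `T(V ⊕ V*) ⋊ G → T(V ⊕ V*) ⋊ G'` given by `y ↦ g y`, `x ↦ g x`, `k ↦ g k g⁻¹`. -/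
def skewMap {G G' : Subgroup (V ≃ₗ[ℂ] V)} (g : V ≃ₗ[ℂ] V) (φ : G →* G')
    (hφ : ∀ k : G, (φ k : V ≃ₗ[ℂ] V) = g * k * g⁻¹) :
    SkewGroupAlgebra G →ₐ[ℂ] SkewGroupAlgebra G' :=
  SkewMonoidAlgebra.liftNCAlgHom (k := ℂ) (A := TensorVV V) (G := G)
    (B := SkewMonoidAlgebra (TensorVV V) G')
    (AlgHom.comp
      { SkewMonoidAlgebra.singleOneRingHom with
        commutes' := fun _ => rfl : TensorVV V →ₐ[ℂ] SkewMonoidAlgebra (TensorVV V) G' }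
      (tensorAct g))
    ((SkewMonoidAlgebra.of (TensorVV V) G').comp φ) (by
      intro a k
      have h : tensorAct g (k • a) = (φ k) • (tensorAct g a) := by
        show tensorAct g (tensorAct (k : V ≃ₗ[ℂ] V) a) =
          tensorAct ((φ k : G') : V ≃ₗ[ℂ] V) (tensorAct g a)
        rw [← AlgHom.comp_apply, ← AlgHom.comp_apply, ← tensorAct_mul, ← tensorAct_mul, hφ]
        simp
      show SkewMonoidAlgebra.single 1 (tensorAct g (k • a)) * SkewMonoidAlgebra.single (φ k) 1 =
        SkewMonoidAlgebra.single (φ k) 1 * SkewMonoidAlgebra.single 1 (tensorAct g a)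
      rw [SkewMonoidAlgebra.single_mul_single, SkewMonoidAlgebra.single_mul_single, h]
      simp)

section skewMap

variable {G G' : Subgroup (V ≃ₗ[ℂ] V)} (g : V ≃ₗ[ℂ] V) (φ : G →* G')
    (hφ : ∀ k : G, (φ k : V ≃ₗ[ℂ] V) = g * k * g⁻¹)

theorem skewMap_single (k : G) (a : TensorVV V) :
    skewMap g φ hφ (SkewMonoidAlgebra.single k a : SkewMonoidAlgebra (TensorVV V) G) =
      (SkewMonoidAlgebra.single (φ k) (tensorAct g a) : SkewMonoidAlgebra (TensorVV V) G') := by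
  have h : skewMap g φ hφ (SkewMonoidAlgebra.single k a : SkewMonoidAlgebra (TensorVV V) G) =
    (SkewMonoidAlgebra.single 1 (tensorAct g a) * SkewMonoidAlgebra.single (φ k) 1 :
      SkewMonoidAlgebra (TensorVV V) G') := SkewMonoidAlgebra.liftNC_single _ _ _ _
  rw [h, SkewMonoidAlgebra.single_mul_single]
  simp
  rfl

@[simp] theorem skewMap_vec (y : V) : skewMap g φ hφ (vec G y) = vec G' (g y) := by
  refine (skewMap_single g φ hφ 1 _).trans ?_
  simp [vec]
  rfl

@[simp] theorem skewMap_covec (x : Module.Dual ℂ V) :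
    skewMap g φ hφ (covec G x) = covec G' (dualAct g x) := by
  refine (skewMap_single g φ hφ 1 _).trans ?_
  simp [covec]
  rfl

@[simp] theorem skewMap_grp (k : G) : skewMap g φ hφ (grp k) = grp (φ k) := by
  refine (skewMap_single g φ hφ k _).trans ?_
  simp [grp]
  rfl

end skewMap

/-- Algebra homomorphisms out of the skew group algebra agree if they agree on `V`, `V*`, `G`. -/
theorem skew_hom_ext {G : Subgroup (V ≃ₗ[ℂ] V)} {B : Type*} [Ring B] [Algebra ℂ B]
    {f f' : SkewGroupAlgebra G →ₐ[ℂ] B} (h1 : ∀ y, f (vec G y) = f' (vec G y))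
    (h2 : ∀ x, f (covec G x) = f' (covec G x)) (h3 : ∀ k : G, f (grp k) = f' (grp k)) :
    f = f' := by
  let i : TensorVV V →ₐ[ℂ] SkewGroupAlgebra G :=
    { (SkewMonoidAlgebra.singleOneRingHom :
        TensorVV V →+* SkewMonoidAlgebra (TensorVV V) G) with
      commutes' := fun _ => rfl }
  have hi : f.comp i = f'.comp i := by
    apply TensorAlgebra.hom_ext
    apply LinearMap.ext
    rintro ⟨y, x⟩
    have : i (TensorAlgebra.ι ℂ (y, x)) = vec G y + covec G x := by
      have h0 : ((y, x) : V × Module.Dual ℂ V) = (y, 0) + (0, x) := by simp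
      rw [h0, map_add, map_add]
      rfl
    show f (i (TensorAlgebra.ι ℂ (y, x))) = f' (i (TensorAlgebra.ι ℂ (y, x)))
    rw [this, map_add, map_add, h1, h2]
  apply AlgHom.ext
  intro a
  refine SkewMonoidAlgebra.induction_on (k := TensorVV V) (G := G) (p := fun a => f a = f' a)
    a ?_ ?_ ?_
  · exact (map_zero f).trans (map_zero f').symm
  · intro k a
    have : (SkewMonoidAlgebra.single k a : SkewMonoidAlgebra (TensorVV V) G) =
        (i a * grp k : SkewGroupAlgebra G) := by
      refine Eq.symm ((SkewMonoidAlgebra.single_mul_single ..).trans ?_)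
      simp
    show f _ = f' _
    rw [this, map_mul, map_mul, h3]
    congr 1
    exact congrArg (fun h => h a) hi
  · intro a b ha hb
    exact (map_add f a b).trans ((congrArg₂ (· + ·) ha hb).trans (map_add f' a b).symm)

/-- The homomorphism `H_{t,c}(G) → H_{t,c'}(G')` induced by `skewMap`, when this carries the
reflection sums to each other. -/
def cherednikMap {G G' : Subgroup (V ≃ₗ[ℂ] V)} (t : ℂ) {c c' : (V ≃ₗ[ℂ] V) → ℂ}
    (g : V ≃ₗ[ℂ] V) (φ : G →* G') (hφ : ∀ k : G, (φ k : V ≃ₗ[ℂ] V) = g * k * g⁻¹)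
    (hc : ∀ y x, skewMap g φ hφ (reflectionSum G c y x) =
      reflectionSum G' c' (g y) (dualAct g x)) :
    Cherednik G t c →ₐ[ℂ] Cherednik G' t c' :=
  RingQuot.liftAlgHom ℂ ⟨(Cherednik.mk G' t c').comp (skewMap g φ hφ), by
    rintro _ _ (⟨y, y'⟩ | ⟨x, x'⟩ | ⟨y, x⟩)
    · simpa using Cherednik.mk_vec_vec G' t c' (g y) (g y')
    · simpa using Cherednik.mk_covec_covec G' t c' (dualAct g x) (dualAct g x')
    · have := Cherednik.mk_vec_covec G' t c' (g y) (dualAct g x)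
      simpa [hc] using this⟩

theorem cherednikMap_mk {G G' : Subgroup (V ≃ₗ[ℂ] V)} (t : ℂ) {c c' : (V ≃ₗ[ℂ] V) → ℂ}
    (g : V ≃ₗ[ℂ] V) (φ : G →* G') (hφ : ∀ k : G, (φ k : V ≃ₗ[ℂ] V) = g * k * g⁻¹)
    (hc : ∀ y x, skewMap g φ hφ (reflectionSum G c y x) =
      reflectionSum G' c' (g y) (dualAct g x)) (a : SkewGroupAlgebra G) :
    cherednikMap t g φ hφ hc (Cherednik.mk G t c a) = Cherednik.mk G' t c' (skewMap g φ hφ a) :=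
  RingQuot.liftAlgHom_mkAlgHom_apply _ _ _ _

theorem Cherednik.mk_surjective (G : Subgroup (V ≃ₗ[ℂ] V)) (t : ℂ) (c : (V ≃ₗ[ℂ] V) → ℂ) :
    Function.Surjective (Cherednik.mk G t c) :=
  RingQuot.mkAlgHom_surjective ℂ _

/-- Algebra homomorphisms out of `H_{t,c}(G)` agree if they agree on `V`, `V*`, `G`. -/
theorem cherednik_hom_ext {G : Subgroup (V ≃ₗ[ℂ] V)} {t : ℂ} {c : (V ≃ₗ[ℂ] V) → ℂ}
    {B : Type*} [Ring B] [Algebra ℂ B] {f f' : Cherednik G t c →ₐ[ℂ] B}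
    (h1 : ∀ y, f (Cherednik.mk G t c (vec G y)) = f' (Cherednik.mk G t c (vec G y)))
    (h2 : ∀ x, f (Cherednik.mk G t c (covec G x)) = f' (Cherednik.mk G t c (covec G x)))
    (h3 : ∀ k : G, f (Cherednik.mk G t c (grp k)) = f' (Cherednik.mk G t c (grp k))) :
    f = f' := by
  have h := skew_hom_ext (f := f.comp (Cherednik.mk G t c)) (f' := f'.comp (Cherednik.mk G t c))
    h1 h2 h3
  apply AlgHom.ext
  intro a
  obtain ⟨a, rfl⟩ := Cherednik.mk_surjective G t c a
  exact congrArg (fun k => k a) h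

end Algebras

section Center

variable {V : Type u} [AddCommGroup V] [Module ℂ V]

/-- The centre `Z_c(G)` of `H_c(G) = H_{0,c}(G)`. -/
abbrev centre (G : Subgroup (V ≃ₗ[ℂ] V)) (c : (V ≃ₗ[ℂ] V) → ℂ) : Subalgebra ℂ (Cherednik G 0 c) :=
  Subalgebra.center ℂ (Cherednik G 0 c)

/-- `u ∈ H_c(G)` is a value of the bracket of `z₁, z₂ ∈ Z_c(G)`: for some lifts `a₁, a₂` of
`z₁, z₂` to `H_{𝐭,c}(G)` one has `[a₁, a₂] = 𝐭 h` with `u` the image of `h`. -/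
def IsBracketValue {G : Subgroup (V ≃ₗ[ℂ] V)} {c : (V ≃ₗ[ℂ] V) → ℂ} (z₁ z₂ : centre G c)
    (u : Cherednik G 0 c) : Prop :=
  ∃ a₁ a₂ h : GenericCherednik G c, specialize G c a₁ = z₁ ∧ specialize G c a₂ = z₂ ∧
    a₁ * a₂ - a₂ * a₁ = tVar G c * h ∧ specialize G c h = u

open Classical in
/-- The bracket `{z₁, z₂} = (𝐭⁻¹ [a₁, a₂])|_{𝐭 = 0}` on `Z_c(G)`. -/
def bracket {G : Subgroup (V ≃ₗ[ℂ] V)} {c : (V ≃ₗ[ℂ] V) → ℂ} (z₁ z₂ : centre G c) :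
    centre G c :=
  if h : ∃ u : centre G c, IsBracketValue z₁ z₂ u then h.choose else 0

/-- `b` is a Poisson bracket on the commutative `ℂ`-algebra `A`. -/
structure IsPoissonBracket {A : Type*} [CommRing A] [Algebra ℂ A] (b : A → A → A) : Prop where
  add_left : ∀ x y z, b (x + y) z = b x z + b y z
  smul_left : ∀ (r : ℂ) x y, b (r • x) y = r • b x y
  self : ∀ x, b x x = 0
  antisymm : ∀ x y, b x y = -b y x
  jacobi : ∀ x y z, b x (b y z) + b y (b z x) + b z (b x y) = 0
  leibniz : ∀ x y z, b x (y * z) = b x y * z + y * b x z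

/-- The bracket of `Z_c(G)` is well defined (it exists, is central and is independent of the
lifts) and makes `Z_c(G)` a Poisson algebra. -/
def HasPoissonStructure (G : Subgroup (V ≃ₗ[ℂ] V)) (c : (V ≃ₗ[ℂ] V) → ℂ) : Prop :=
  (∀ (z₁ z₂ : centre G c) (u : Cherednik G 0 c),
    IsBracketValue z₁ z₂ u ↔ u = (bracket z₁ z₂ : centre G c)) ∧
  IsPoissonBracket (bracket (G := G) (c := c))

/-- The Calogero–Moser space `X_c(G) = Spec Z_c(G)`. -/
def cmSpace (G : Subgroup (V ≃ₗ[ℂ] V)) (c : (V ≃ₗ[ℂ] V) → ℂ) : Scheme.{u} :=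
  Spec (CommRingCat.of (centre G c))

/-- The morphism of Calogero–Moser spaces given by a homomorphism of centres. -/
def cmMap {G G' : Subgroup (V ≃ₗ[ℂ] V)} {c c' : (V ≃ₗ[ℂ] V) → ℂ}
    (j : centre G' c' →ₐ[ℂ] centre G c) : cmSpace G c ⟶ cmSpace G' c' :=
  Spec.map (CommRingCat.ofHom (j : centre G' c' →+* centre G c))

end Center

section NormalSubgroup

variable {V : Type u} [AddCommGroup V] [Module ℂ V] (W K : Subgroup (V ≃ₗ[ℂ] V))

/-- `c : Ref(K) → ℂ`, extended by zero to `Ref(W)`. -/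
def extendByZero (c : (V ≃ₗ[ℂ] V) → ℂ) : (V ≃ₗ[ℂ] V) → ℂ :=
  (Ref K).indicator c

/-- `c : Ref(K) → ℂ` is invariant under conjugation by `W`. -/
def IsEquivariant (c : (V ≃ₗ[ℂ] V) → ℂ) : Prop :=
  ∀ w ∈ W, ∀ s ∈ Ref K, c (w * s * w⁻¹) = c s

instance [Finite K] : Finite (Ref K) :=
  Finite.of_injective (fun s : Ref K => (⟨s, mem_of_mem_ref s.2⟩ : K)) (by
    intro s s' h
    exact Subtype.ext (congrArg (fun k : K => (k : V ≃ₗ[ℂ] V)) h))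

variable {W K}

theorem skewMap_inclusion_reflectionSum [Finite K] (hKW : K ≤ W)
    (c : (V ≃ₗ[ℂ] V) → ℂ) (y : V) (x : Module.Dual ℂ V) :
    skewMap 1 (Subgroup.inclusion hKW) (fun k => by simp) (reflectionSum K c y x) =
      reflectionSum W (extendByZero K c) ((1 : V ≃ₗ[ℂ] V) y) (dualAct 1 x) := by
  have h1 : (1 : V ≃ₗ[ℂ] V) y = y := rfl
  have h2 : dualAct (1 : V ≃ₗ[ℂ] V) x = x := rfl
  rw [h1, h2, reflectionSum, reflectionSum]
  refine (AddMonoidHom.map_finsum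
    (skewMap (1 : V ≃ₗ[ℂ] V) (Subgroup.inclusion hKW) (fun k => by simp) :
      SkewGroupAlgebra K →+ SkewGroupAlgebra W) (Set.toFinite _)).trans ?_
  let i : Ref K → Ref W := fun s => ⟨s, hKW (mem_of_mem_ref s.2), s.2.2⟩
  have hi : Function.Injective i := by
    intro s s' h
    exact Subtype.ext (congrArg (fun k : Ref W => (k : V ≃ₗ[ℂ] V)) h)
  let F : Ref W → SkewGroupAlgebra W := fun s =>
    (extendByZero K c s * rootForm (s : V ≃ₗ[ℂ] V) y x) • grp (⟨s, mem_of_mem_ref s.2⟩ : W)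
  have hF : ∑ᶠ s, F s = ∑ᶠ s, F (i s) := by
    rw [← finsum_mem_range hi, finsum_mem_def]
    congr 1
    symm
    rw [Set.indicator_eq_self]
    intro s hs
    by_cases h : (s : V ≃ₗ[ℂ] V) ∈ Ref K
    · exact ⟨⟨s, h⟩, rfl⟩
    · exfalso
      apply hs
      show (extendByZero K c s * _) • _ = _
      rw [extendByZero, Set.indicator_of_notMem h, zero_mul, zero_smul]
  refine Eq.trans ?_ hF.symm
  refine finsum_congr fun s => ?_
  show skewMap 1 (Subgroup.inclusion hKW) (fun k => by simp) _ = _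
  rw [map_smul, skewMap_grp]
  show _ = (extendByZero K c s * rootForm (s : V ≃ₗ[ℂ] V) y x) • _
  rw [extendByZero, Set.indicator_of_mem s.2]
  rfl

theorem skewMap_conj_reflectionSum [Finite K] {w : V ≃ₗ[ℂ] V}
    (φ : K →* K) (hφ : ∀ k : K, (φ k : V ≃ₗ[ℂ] V) = w * k * w⁻¹)
    (hw : ∀ k ∈ K, w⁻¹ * k * w ∈ K)
    {c : (V ≃ₗ[ℂ] V) → ℂ} (hc : ∀ s ∈ Ref K, c (w * s * w⁻¹) = c s)
    (y : V) (x : Module.Dual ℂ V) :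
    skewMap w φ hφ (reflectionSum K c y x) = reflectionSum K c (w y) (dualAct w x) := by
  rw [reflectionSum, reflectionSum]
  refine (AddMonoidHom.map_finsum
    (skewMap w φ hφ : SkewGroupAlgebra K →+ SkewGroupAlgebra K) (Set.toFinite _)).trans ?_
  have hm : ∀ s : Ref K, w * (s : V ≃ₗ[ℂ] V) * w⁻¹ ∈ Ref K := fun s =>
    ref_conj_mem s.2 (by rw [← hφ ⟨s, mem_of_mem_ref s.2⟩]; exact (φ _).2)
  have hm' : ∀ s : Ref K, w⁻¹ * (s : V ≃ₗ[ℂ] V) * w ∈ Ref K := fun s => by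
    have h := ref_conj_mem (G' := K) (g := w⁻¹) s.2
      (by rw [inv_inv]; exact hw _ (mem_of_mem_ref s.2))
    simpa using h
  let e : Ref K ≃ Ref K :=
    { toFun := fun s => ⟨_, hm s⟩
      invFun := fun s => ⟨_, hm' s⟩
      left_inv := fun s => Subtype.ext (by simp; group)
      right_inv := fun s => Subtype.ext (by simp; group) }
  refine finsum_eq_of_bijective e e.bijective ?_
  intro s
  show skewMap w φ hφ _ = _
  rw [map_smul, skewMap_grp]
  congr 1
  · show _ = c (w * (s : V ≃ₗ[ℂ] V) * w⁻¹) * rootForm (w * (s : V ≃ₗ[ℂ] V) * w⁻¹) (w y) (dualAct w x)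
    rw [hc s s.2, rootForm_conj]
  · congr 1
    exact Subtype.ext (hφ _)

/-- The homomorphism `H_c(K) → H_c(W)` extending `K ↪ W` and the identity of `V` and `V*`. -/
def inclusionMap [Finite K] (hKW : K ≤ W) (c : (V ≃ₗ[ℂ] V) → ℂ) :
    Cherednik K 0 c →ₐ[ℂ] Cherednik W 0 (extendByZero K c) :=
  cherednikMap 0 1 (Subgroup.inclusion hKW) (fun k => by simp)
    (skewMap_inclusion_reflectionSum hKW c)

/-- Conjugation by `w ∈ W` on the normal subgroup `K`. -/
def conjHom (hKW : K ≤ W) [hn : (K.subgroupOf W).Normal] (w : W) : K →* K where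
  toFun k := ⟨w * k * (w : V ≃ₗ[ℂ] V)⁻¹, hn.conj_mem ⟨k, hKW k.2⟩ k.2 w⟩
  map_one' := Subtype.ext (by simp)
  map_mul' k k' := Subtype.ext (by simp)

@[simp] theorem coe_conjHom (hKW : K ≤ W) [(K.subgroupOf W).Normal] (w : W) (k : K) :
    (conjHom hKW w k : V ≃ₗ[ℂ] V) = w * k * (w : V ≃ₗ[ℂ] V)⁻¹ := rfl

section Action

variable [Finite K] (hKW : K ≤ W) [(K.subgroupOf W).Normal] {c : (V ≃ₗ[ℂ] V) → ℂ}
  (hc : IsEquivariant W K c)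

/-- The action of `w ∈ W` on `H_c(K)`: `y ↦ w y`, `x ↦ w x`, `k ↦ w k w⁻¹`. -/
def actHom (w : W) : Cherednik K 0 c →ₐ[ℂ] Cherednik K 0 c :=
  cherednikMap 0 w (conjHom hKW w) (coe_conjHom hKW w)
    (skewMap_conj_reflectionSum (conjHom hKW w) (coe_conjHom hKW w)
      (fun k hk => by
        have h := (conjHom hKW w⁻¹ ⟨k, hk⟩).2
        simpa using h)
      (fun s hs => hc w w.2 s hs))

theorem actHom_one : actHom hKW hc 1 = AlgHom.id ℂ _ := by
  apply cherednik_hom_ext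
  · intro y
    rw [actHom, cherednikMap_mk, skewMap_vec]; rfl
  · intro x
    rw [actHom, cherednikMap_mk, skewMap_covec]; rfl
  · intro k
    rw [actHom, cherednikMap_mk, skewMap_grp, AlgHom.id_apply]
    congr 2

theorem actHom_mul (w w' : W) :
    actHom hKW hc (w * w') = (actHom hKW hc w).comp (actHom hKW hc w') := by
  apply cherednik_hom_ext
  · intro y
    simp only [actHom, AlgHom.comp_apply, cherednikMap_mk, skewMap_vec]; rfl
  · intro x
    simp only [actHom, AlgHom.comp_apply, cherednikMap_mk, skewMap_covec]; rfl
  · intro k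
    simp only [actHom, AlgHom.comp_apply, cherednikMap_mk, skewMap_grp]
    congr 2

/-- The action of `W` on `H_c(K)` by algebra automorphisms. -/
def act : W →* (Cherednik K 0 c ≃ₐ[ℂ] Cherednik K 0 c) where
  toFun w := AlgEquiv.ofAlgHom (actHom hKW hc w) (actHom hKW hc w⁻¹)
    (by rw [← actHom_mul, mul_inv_cancel, actHom_one])
    (by rw [← actHom_mul, inv_mul_cancel, actHom_one])
  map_one' := by
    apply AlgEquiv.ext
    intro a
    exact congrArg (fun f => f a) (actHom_one hKW hc)
  map_mul' w w' := by
    apply AlgEquiv.ext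
    intro a
    exact congrArg (fun f => f a) (actHom_mul hKW hc w w')

end Action

/-- An automorphism of an algebra restricts to its centre. -/
def centreAut (A : Type*) [Ring A] [Algebra ℂ A] :
    (A ≃ₐ[ℂ] A) →* (Subalgebra.center ℂ A ≃ₐ[ℂ] Subalgebra.center ℂ A) where
  toFun e :=
    { Subring.centerCongr (e : A ≃+* A) with
      commutes' := fun r => Subtype.ext (e.commutes r) }
  map_one' := rfl
  map_mul' _ _ := rfl

@[simp] theorem coe_centreAut {A : Type*} [Ring A] [Algebra ℂ A] (e : A ≃ₐ[ℂ] A)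
    (z : Subalgebra.center ℂ A) : (centreAut A e z : A) = e z := rfl

theorem grp_mul_grp {G : Subgroup (V ≃ₗ[ℂ] V)} (k k' : G) : grp k * grp k' = grp (k * k') := by
  refine (SkewMonoidAlgebra.single_mul_single ..).trans ?_
  rw [smul_one, one_mul]; rfl

theorem grp_one {G : Subgroup (V ≃ₗ[ℂ] V)} : grp (1 : G) = 1 := rfl

theorem grp_mul_vec {G : Subgroup (V ≃ₗ[ℂ] V)} (k : G) (y : V) :
    grp k * vec G y = vec G ((k : V ≃ₗ[ℂ] V) y) * grp k := by
  refine (SkewMonoidAlgebra.single_mul_single ..).trans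
    (Eq.trans ?_ (SkewMonoidAlgebra.single_mul_single ..).symm)
  have h : k • (TensorAlgebra.ι ℂ (y, 0) : TensorVV V) =
      TensorAlgebra.ι ℂ ((k : V ≃ₗ[ℂ] V) y, 0) :=
    (tensorAct_ι (k : V ≃ₗ[ℂ] V) (y, 0)).trans (by simp)
  rw [h, smul_one, one_mul, mul_one, one_mul, mul_one]

theorem grp_mul_covec {G : Subgroup (V ≃ₗ[ℂ] V)} (k : G) (x : Module.Dual ℂ V) :
    grp k * covec G x = covec G (dualAct (k : V ≃ₗ[ℂ] V) x) * grp k := by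
  refine (SkewMonoidAlgebra.single_mul_single ..).trans
    (Eq.trans ?_ (SkewMonoidAlgebra.single_mul_single ..).symm)
  have h : k • (TensorAlgebra.ι ℂ (0, x) : TensorVV V) =
      TensorAlgebra.ι ℂ (0, dualAct (k : V ≃ₗ[ℂ] V) x) :=
    (tensorAct_ι (k : V ≃ₗ[ℂ] V) (0, x)).trans (by simp)
  rw [h, smul_one, one_mul, mul_one, one_mul, mul_one]

section Action

variable [Finite K] (hKW : K ≤ W) [(K.subgroupOf W).Normal] {c : (V ≃ₗ[ℂ] V) → ℂ}
  (hc : IsEquivariant W K c)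

/-- The elements of `K` act on `H_c(K)` by inner automorphisms. -/
theorem act_of_mem (w : W) (hw : (w : V ≃ₗ[ℂ] V) ∈ K) (a : Cherednik K 0 c) :
    act hKW hc w a * Cherednik.mk K 0 c (grp ⟨w, hw⟩) =
      Cherednik.mk K 0 c (grp ⟨w, hw⟩) * a := by
  let k : K := ⟨w, hw⟩
  let g : Cherednik K 0 c := Cherednik.mk K 0 c (grp k)
  let g' : Cherednik K 0 c := Cherednik.mk K 0 c (grp k⁻¹)
  have h1 : g * g' = 1 := by
    show Cherednik.mk K 0 c (grp k) * Cherednik.mk K 0 c (grp k⁻¹) = 1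
    rw [← map_mul, grp_mul_grp, mul_inv_cancel, grp_one, map_one]
  have h2 : g' * g = 1 := by
    show Cherednik.mk K 0 c (grp k⁻¹) * Cherednik.mk K 0 c (grp k) = 1
    rw [← map_mul, grp_mul_grp, inv_mul_cancel, grp_one, map_one]
  let f : Cherednik K 0 c →ₐ[ℂ] Cherednik K 0 c :=
    { toFun := fun a => g * a * g'
      map_one' := by rw [mul_one, h1]
      map_mul' := fun a b => by
        calc g * (a * b) * g' = g * a * 1 * b * g' := by noncomm_ring
          _ = g * a * g' * (g * b * g') := by rw [← h2]; noncomm_ring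
      map_zero' := by simp
      map_add' := fun a b => by noncomm_ring
      commutes' := fun r => by
        rw [← Algebra.commutes, mul_assoc, h1, mul_one] }
  have hf : actHom hKW hc w = f := by
    apply cherednik_hom_ext
    · intro y
      rw [actHom, cherednikMap_mk, skewMap_vec]
      show _ = g * _ * g'
      rw [← map_mul, grp_mul_vec, map_mul, mul_assoc]
      show _ = _ * (g * g')
      rw [h1, mul_one]
    · intro x
      rw [actHom, cherednikMap_mk, skewMap_covec]
      show _ = g * _ * g'
      rw [← map_mul, grp_mul_covec, map_mul, mul_assoc]
      show _ = _ * (g * g')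
      rw [h1, mul_one]
    · intro l
      rw [actHom, cherednikMap_mk, skewMap_grp]
      show _ = g * _ * g'
      rw [← map_mul, ← map_mul, grp_mul_grp, grp_mul_grp]
      rfl
  show actHom hKW hc w a * g = g * a
  rw [hf]
  show g * a * g' * g = g * a
  rw [mul_assoc, h2, mul_one]

/-- The action of `Γ = W / K` on `Z_c(K)` induced by the action of `W` on `H_c(K)`. -/
def gammaAct :
    (W ⧸ K.subgroupOf W) →* (centre K c ≃ₐ[ℂ] centre K c) :=
  QuotientGroup.lift (K.subgroupOf W) ((centreAut (Cherednik K 0 c)).comp (act hKW hc)) (by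
    intro w hw
    apply AlgEquiv.ext
    intro z
    apply Subtype.ext
    have hw' : (w : V ≃ₗ[ℂ] V) ∈ K := hw
    have h := act_of_mem hKW hc w hw' z
    rw [Subalgebra.mem_center_iff.mp z.2 (Cherednik.mk K 0 c (grp ⟨w, hw'⟩))] at h
    have h1 : Cherednik.mk K 0 c (grp ⟨w, hw'⟩) *
        Cherednik.mk K 0 c (grp (⟨w, hw'⟩ : K)⁻¹) = 1 := by
      rw [← map_mul, grp_mul_grp, mul_inv_cancel, grp_one, map_one]
    have h2 := congrArg (· * Cherednik.mk K 0 c (grp (⟨w, hw'⟩ : K)⁻¹)) h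
    simp only [mul_assoc, h1, mul_one] at h2
    exact h2)

@[simp] theorem coe_gammaAct_mk (w : W) (z : centre K c) :
    (gammaAct hKW hc (QuotientGroup.mk w) z : Cherednik K 0 c) = act hKW hc w z := rfl

/-- The algebra of invariants `Z_c(K)^Γ`. -/
def gammaInvariants : Subalgebra ℂ (centre K c) where
  carrier := {z | ∀ γ, gammaAct hKW hc γ z = z}
  mul_mem' ha hb γ := by rw [map_mul, ha γ, hb γ]
  add_mem' ha hb γ := by rw [map_add, ha γ, hb γ]
  algebraMap_mem' r γ := (gammaAct hKW hc γ).commutes r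

/-- The action of `Γ` on the Calogero–Moser space of `K`. -/
def gammaActSpace (γ : W ⧸ K.subgroupOf W) : cmSpace K c ⟶ cmSpace K c :=
  Spec.map (CommRingCat.ofHom (gammaAct hKW hc γ⁻¹ : centre K c →+* centre K c))

end Action

end NormalSubgroup

/-- `π : X ⟶ Y` is a quotient of the scheme `X` by the automorphisms `a g`, `g ∈ G`: it is
invariant, the points of `Y` are the `G`-orbits in `X`, with the quotient topology, and the
functions on an open `U ⊆ Y` are the `G`-invariant functions on `π⁻¹(U)`. -/
structure IsGeometricQuotient {G : Type*} [Group G] {X Y : Scheme.{u}} (a : G → (X ⟶ X))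
    (π : X ⟶ Y) : Prop where
  invariant : ∀ g, a g ≫ π = π
  fibers : ∀ x x' : X, π x = π x' ↔ ∃ g, a g x = x'
  isQuotientMap : Topology.IsQuotientMap (π : X → Y)
  sections_injective : ∀ U : Y.Opens, Function.Injective (π.app U)
  sections : ∀ (U : Y.Opens) (f : Γ(X, π ⁻¹ᵁ U)),
    (∃ h : Γ(Y, U), π.app U h = f) ↔
      ∀ (g : G) (hg : π ⁻¹ᵁ U ≤ a g ⁻¹ᵁ (π ⁻¹ᵁ U)),
        (a g).appLE (π ⁻¹ᵁ U) (π ⁻¹ᵁ U) hg f = f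

end CalogeroMoser

end

open CalogeroMoser

/-!
The argument rests on a Poincaré–Birkhoff–Witt theorem: ordered products `x₁ ⋯ xₘ y₁ ⋯ yₙ g`
identify a Cherednik algebra with `R[V ⊕ V*] ⊗ R[G]`, where `R` is `ℂ`, or `ℂ[t]` if the parameter
is an indeterminate. To prove it, the algebra is made to act on `R[V ⊕ V*] ⊗ R[G]`: each `x`
multiplies, `G` acts diagonally, and each `y` acts by a Dunkl operator, that is, multiplication by
`y` plus `t ∂_y` minus a sum of divided differences along the reflections. These operators satisfy
the defining relations (`dunklRealization`); the only hard one, that Dunkl operators commute,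
follows from the Jacobi identity, which shows that their commutator commutes with the `x`, together
with its vanishing on elements free of `x`. The ordered product map is compatible with this action,
and evaluation at `1` inverts it (`Realization.pbw_bijective`).

In these coordinates `H_c(K) → H_c(W)` is extension by zero from `K` to `W`, hence injective. A
central element `z = ∑ z_g g` of `H_c(W)` commutes with `V`. As `c` is supported on `K`, at `t = 0`
this expresses `(y - g y) z_g` for `g ∉ K` through divided differences of coefficients `z_{s⁻¹ g}`,
again with `s⁻¹ g ∉ K`, and divided differences lower the degree in the `x`. So
`z_g = 0` outside `K` (`eq_zero_of_dunklOp_eq_rightVec`), and `z` comes from `H_c(K)`. An element of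
`H_c(K)` is central in `H_c(W)` exactly when it is central in `H_c(K)` and invariant under
conjugation by `W`, which gives `Z_c(W) = Z_c(K)^Γ` (`centre_eq_map_gammaInvariants`).

For the Poisson structures, Poincaré–Birkhoff–Witt over `ℂ[t]` shows that `t` is not a zero divisor
(`eq_zero_of_tVar_mul`), and the relations show that the kernel of specialization at `t = 0` is
generated by `t` (`specialize_eq_zero_iff`). Hence commutators of lifts of central elements
can be divided by `t` in a unique way, and the Poisson identities are inherited from the commutator
(`hasPoissonStructure`). The inclusion of `H_c(K)` in `H_c(W)` lifts to the generic algebras, so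
it respects the brackets (`bracket_centre_embedding`).

Finally, the spectrum of the ring of invariants of a finite group acting on a commutative ring is
the geometric quotient (`isGeometricQuotient_spec`): the extension is integral and the group is
transitive on the primes above a given prime, and on a basic open subset an invariant fraction
has an invariant numerator after its denominator is enlarged.
-/

open CategoryTheory AlgebraicGeometry

noncomputable section

namespace CalogeroMoser

universe u v w

set_option linter.unusedSectionVars false

/-! ### Roots and coroots -/

section RootData

variable {V : Type u} [AddCommGroup V] [Module ℂ V]

/-- Choices attached to a reflection `s`: a root and a coroot spanning the images of `s - 1` on
`V*` and on `V`, normalised so that `x - s x = ⟨x, coroot⟩ root`, and the multiple `form` of the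
root for which the coefficient `rootForm s y x` of the commutation relation splits as
`form y * x coroot`. Only the properties used below are recorded; `form_smul_sub`
reflects that `s y - y` lies on a fixed line, with coordinate proportional to `form y`. -/
structure RootDatum (s : V ≃ₗ[ℂ] V) where
  root : Module.Dual ℂ V
  coroot : V
  form : Module.Dual ℂ V
  root_ne_zero : root ≠ 0
  sub_dualAct : ∀ x : Module.Dual ℂ V, x - dualAct s x = x coroot • root
  rootForm_eq_mul : ∀ y x, rootForm s y x = form y * x coroot
  form_smul_sub : ∀ y y', form y' • (s y - y) = form y • (s y' - y')

theorem nonempty_rootDatum [FiniteDimensional ℂ V] {G : Subgroup (V ≃ₗ[ℂ] V)} {s : V ≃ₗ[ℂ] V}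
    (hs : s ∈ Ref G) : Nonempty (RootDatum s) := by
  obtain ⟨f, v, hf, hv, h⟩ := exists_rank_one hs
  -- Here `s y - y = f y • v`, and `form` is the multiple of `f` taking the value `2` at `v`.
  refine ⟨⟨dualAct s f, v, (2 * (f v)⁻¹) • f, ?_, ?_, ?_, ?_⟩⟩
  · simpa using hf
  · intro x
    ext y
    have h2 := congrArg x (h (s.symm y))
    simp only [LinearEquiv.apply_symm_apply, map_sub, map_smul, smul_eq_mul] at h2
    simp only [LinearMap.sub_apply, dualAct_apply, LinearMap.smul_apply, smul_eq_mul, h2]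
    ring
  · intro y x
    rw [rootForm, trace_sub_id h, h, map_smul, smul_eq_mul, LinearMap.smul_apply, smul_eq_mul]
    ring
  · intro y y'
    rw [h, h, LinearMap.smul_apply, LinearMap.smul_apply, smul_smul, smul_smul, smul_eq_mul,
      smul_eq_mul]
    congr 1
    ring

/-- A chosen root datum for each reflection in `G`. -/
def rootDatum [FiniteDimensional ℂ V] {G : Subgroup (V ≃ₗ[ℂ] V)} (s : Ref G) :
    RootDatum (s : V ≃ₗ[ℂ] V) :=
  (nonempty_rootDatum s.2).some

end RootData

/-! ### Symmetric algebras as polynomial rings -/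

section SymPoly

variable (R : Type v) [CommRing R] [Algebra ℂ R] {U : Type u} [AddCommGroup U] [Module ℂ U]
  [FiniteDimensional ℂ U]

/-- The symmetric algebra of `U` over `R`, as the polynomial ring in the basis
`Module.finBasis ℂ U`. -/
abbrev SymPoly (R : Type v) [CommRing R] (U : Type u) [AddCommGroup U] [Module ℂ U] :
    Type v :=
  MvPolynomial (Fin (Module.finrank ℂ U)) R

/-- The inclusion of `U` in its symmetric algebra as the linear forms. -/
def lin : U →ₗ[ℂ] SymPoly R U :=
  (Module.finBasis ℂ U).constr ℂ MvPolynomial.X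

theorem lin_finBasis (i : Fin (Module.finrank ℂ U)) :
    lin R (Module.finBasis ℂ U i) = MvPolynomial.X i :=
  Module.Basis.constr_basis _ _ _ _

theorem lin_eq_sum (u : U) :
    lin R u = ∑ i, (Module.finBasis ℂ U).repr u i • (MvPolynomial.X i : SymPoly R U) := by
  rw [lin, Module.Basis.constr_apply_fintype]
  rfl

theorem coeff_lin (u : U) (i : Fin (Module.finrank ℂ U)) :
    (lin R u).coeff (Finsupp.single i 1) = algebraMap ℂ R ((Module.finBasis ℂ U).repr u i) := by
  classical
  rw [lin_eq_sum, MvPolynomial.coeff_sum, Finset.sum_eq_single i]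
  · rw [Algebra.smul_def, IsScalarTower.algebraMap_apply ℂ R, MvPolynomial.algebraMap_eq,
      MvPolynomial.coeff_C_mul, MvPolynomial.coeff_X, if_pos rfl, mul_one]
  · intro j _ hj
    rw [Algebra.smul_def, IsScalarTower.algebraMap_apply ℂ R, MvPolynomial.algebraMap_eq,
      MvPolynomial.coeff_C_mul, MvPolynomial.coeff_X, if_neg, mul_zero]
    intro h
    exact hj (Finsupp.single_left_injective one_ne_zero h)
  · simp

theorem lin_eq_zero_iff [Nontrivial R] {u : U} : lin R u = 0 ↔ u = 0 := by
  refine ⟨fun h => ?_, fun h => by rw [h, map_zero]⟩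
  apply (Module.finBasis ℂ U).repr.map_eq_zero_iff.mp
  ext i
  have h1 := coeff_lin R u i
  rw [h, MvPolynomial.coeff_zero] at h1
  exact (map_eq_zero _).mp h1.symm

theorem totalDegree_lin [Nontrivial R] {u : U} (hu : u ≠ 0) : (lin R u).totalDegree = 1 := by
  apply MvPolynomial.IsHomogeneous.totalDegree _ (fun h => hu ((lin_eq_zero_iff R).mp h))
  rw [lin_eq_sum]
  refine MvPolynomial.IsHomogeneous.sum _ _ _ fun i _ => ?_
  rw [Algebra.smul_def, IsScalarTower.algebraMap_apply ℂ R, MvPolynomial.algebraMap_eq]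
  exact (MvPolynomial.isHomogeneous_X R i).C_mul _

/-- The algebra endomorphism of the symmetric algebra induced by a linear endomorphism of `U`. -/
def symAct (g : U →ₗ[ℂ] U) : SymPoly R U →ₐ[R] SymPoly R U :=
  MvPolynomial.aeval fun i => lin R (g (Module.finBasis ℂ U i))

@[simp] theorem symAct_lin (g : U →ₗ[ℂ] U) (u : U) : symAct R g (lin R u) = lin R (g u) := by
  have : ((symAct R g).restrictScalars ℂ).toLinearMap ∘ₗ lin R = lin R ∘ₗ g := by
    refine (Module.finBasis ℂ U).ext fun i => ?_
    simp only [LinearMap.comp_apply, lin_finBasis, AlgHom.toLinearMap_apply,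
      AlgHom.restrictScalars_apply, symAct, MvPolynomial.aeval_X]
  exact congrArg (fun f => f u) this

variable {R}

theorem symPoly_hom_ext {A : Type*} [CommRing A] [Algebra R A] {f f' : SymPoly R U →ₐ[R] A}
    (h : ∀ u, f (lin R u) = f' (lin R u)) : f = f' :=
  MvPolynomial.algHom_ext fun i => by rw [← lin_finBasis]; exact h _

theorem symPoly_induction {P : SymPoly R U → Prop} (q : SymPoly R U)
    (const : ∀ r, P (MvPolynomial.C r)) (add : ∀ p q, P p → P q → P (p + q))
    (lin_mul : ∀ u p, P p → P (lin R u * p)) : P q := by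
  induction q using MvPolynomial.induction_on with
  | C a => exact const a
  | add p q hp hq => exact add p q hp hq
  | mul_X p i hp => rw [mul_comm, ← lin_finBasis]; exact lin_mul _ _ hp

theorem symAct_comp (g h : U →ₗ[ℂ] U) :
    (symAct R g).comp (symAct R h) = symAct R (g ∘ₗ h) :=
  symPoly_hom_ext fun u => by simp

theorem symAct_id : symAct R (LinearMap.id : U →ₗ[ℂ] U) = AlgHom.id R _ :=
  symPoly_hom_ext fun u => by simp

theorem totalDegree_symAct_le (g : U →ₗ[ℂ] U) (q : SymPoly R U) :
    (symAct R g q).totalDegree ≤ q.totalDegree := by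
  rcases subsingleton_or_nontrivial R with hR | hR
  · have : Subsingleton (SymPoly R U) := inferInstance
    rw [Subsingleton.elim (symAct R g q) q]
  rw [symAct, MvPolynomial.aeval_def, MvPolynomial.eval₂_eq]
  refine MvPolynomial.totalDegree_finsetSum_le fun m hm => ?_
  refine (MvPolynomial.totalDegree_mul _ _).trans ?_
  rw [MvPolynomial.algebraMap_eq, MvPolynomial.totalDegree_C, zero_add]
  refine (MvPolynomial.totalDegree_finsetProd _ _).trans ?_
  refine le_trans ?_ (MvPolynomial.le_totalDegree hm)
  refine Finset.sum_le_sum fun i _ => ?_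
  refine (MvPolynomial.totalDegree_pow _ _).trans ?_
  by_cases h : g (Module.finBasis ℂ U i) = 0
  · simp [h]
  · rw [totalDegree_lin R h, mul_one]

end SymPoly

/-! ### Polynomials on `V ⊕ V*` and divided differences -/

section PhasePoly

variable (R : Type v) [CommRing R] [Algebra ℂ R] (V : Type u) [AddCommGroup V] [Module ℂ V]

/-- The symmetric algebra of `V ⊕ V*` over `R`, as polynomials in the `x ∈ V*` with coefficients
polynomials in the `y ∈ V`. Its `totalDegree` is therefore the degree in the `x` alone. -/
abbrev PhasePoly : Type v := SymPoly (SymPoly R V) (Module.Dual ℂ V)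

variable {V} [FiniteDimensional ℂ V]

/-- The linear form attached to `x ∈ V*`. -/
abbrev xLin : Module.Dual ℂ V →ₗ[ℂ] PhasePoly R V := lin (SymPoly R V)

/-- The linear form attached to `y ∈ V`. -/
abbrev yLin (y : V) : PhasePoly R V := MvPolynomial.C (lin R y)

/-- The action of `g` on the coefficients, that is on the variables `y` only, with the `x`
fixed. -/
def coefAct (g : V ≃ₗ[ℂ] V) : PhasePoly R V →ₐ[R] PhasePoly R V :=
  MvPolynomial.mapAlgHom (symAct R (g : V →ₗ[ℂ] V))

/-- The diagonal action of `g` on the variables `x` and `y`. -/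
def fullAct (g : V ≃ₗ[ℂ] V) : PhasePoly R V →ₐ[R] PhasePoly R V :=
  ((symAct (SymPoly R V)
    (dualAct g : Module.Dual ℂ V →ₗ[ℂ] Module.Dual ℂ V)).restrictScalars R).comp (coefAct R g)

@[simp] theorem coefAct_C (g : V ≃ₗ[ℂ] V) (p : SymPoly R V) :
    coefAct R g (MvPolynomial.C p) = MvPolynomial.C (symAct R (g : V →ₗ[ℂ] V) p) :=
  MvPolynomial.map_C _ _

@[simp] theorem coefAct_xLin (g : V ≃ₗ[ℂ] V) (x : Module.Dual ℂ V) :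
    coefAct R g (xLin R x) = xLin R x := by
  simp only [xLin, lin_eq_sum, map_sum]
  refine Finset.sum_congr rfl fun i _ => ?_
  refine (map_smul ((coefAct R g).restrictScalars ℂ) _ _).trans ?_
  congr 1
  exact MvPolynomial.map_X _ _

@[simp] theorem fullAct_C (g : V ≃ₗ[ℂ] V) (p : SymPoly R V) :
    fullAct R g (MvPolynomial.C p) = MvPolynomial.C (symAct R (g : V →ₗ[ℂ] V) p) := by
  rw [fullAct, AlgHom.comp_apply, coefAct_C]
  exact AlgHom.commutes (symAct (SymPoly R V) _) _

@[simp] theorem fullAct_xLin (g : V ≃ₗ[ℂ] V) (x : Module.Dual ℂ V) :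
    fullAct R g (xLin R x) = xLin R (dualAct g x) := by
  rw [fullAct, AlgHom.comp_apply, coefAct_xLin]
  exact symAct_lin _ _ _

variable {R}

theorem phasePoly_induction {P : PhasePoly R V → Prop} (q : PhasePoly R V)
    (const : ∀ p, P (MvPolynomial.C p)) (add : ∀ p q, P p → P q → P (p + q))
    (xLin_mul : ∀ x p, P p → P (xLin R x * p)) : P q :=
  symPoly_induction q const add xLin_mul

theorem fullAct_mul (g h : V ≃ₗ[ℂ] V) (q : PhasePoly R V) :
    fullAct R (g * h) q = fullAct R g (fullAct R h q) := by
  induction q using phasePoly_induction with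
  | const p =>
    rw [fullAct_C, fullAct_C, fullAct_C, ← AlgHom.comp_apply, symAct_comp]
    rfl
  | add p q hp hq => rw [map_add, map_add, map_add, hp, hq]
  | xLin_mul x p hp =>
    rw [map_mul, map_mul, map_mul, hp, fullAct_xLin, fullAct_xLin, fullAct_xLin]
    rfl

theorem fullAct_one (q : PhasePoly R V) : fullAct R 1 q = q := by
  induction q using phasePoly_induction with
  | const p =>
    rw [fullAct_C]
    congr 1
    exact congrArg (fun f => f p) symAct_id
  | add p q hp hq => rw [map_add, hp, hq]
  | xLin_mul x p hp =>
    rw [map_mul, hp, fullAct_xLin]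
    rfl

theorem totalDegree_coefAct_le (g : V ≃ₗ[ℂ] V) (q : PhasePoly R V) :
    (coefAct R g q).totalDegree ≤ q.totalDegree :=
  Finset.sup_mono (MvPolynomial.support_map_subset _ _)

theorem totalDegree_fullAct_le (g : V ≃ₗ[ℂ] V) (q : PhasePoly R V) :
    (fullAct R g q).totalDegree ≤ q.totalDegree := by
  rw [fullAct, AlgHom.comp_apply]
  exact (totalDegree_symAct_le _ _).trans (totalDegree_coefAct_le g q)

/-- The actions of `s` with and without its effect on the `x` differ by a multiple of the root,
because `x - s x` is one. -/
theorem root_dvd {s : V ≃ₗ[ℂ] V} (d : RootDatum s) (q : PhasePoly R V) :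
    xLin R d.root ∣ coefAct R s q - fullAct R s q := by
  induction q using phasePoly_induction with
  | const p => simp
  | add p q hp hq =>
    rw [map_add, map_add, add_sub_add_comm]
    exact dvd_add hp hq
  | xLin_mul x p hp =>
    rw [map_mul, map_mul, coefAct_xLin, fullAct_xLin]
    have h : xLin R x * coefAct R s p - xLin R (dualAct s x) * fullAct R s p =
        xLin R x * (coefAct R s p - fullAct R s p) +
          xLin R (x - dualAct s x) * fullAct R s p := by
      rw [map_sub]; ring
    rw [h, d.sub_dualAct, map_smul, smul_mul_assoc, ← mul_smul_comm]
    exact dvd_add (hp.mul_left _) (dvd_mul_right _ _)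

variable [IsDomain R]

theorem xLin_root_ne_zero {s : V ≃ₗ[ℂ] V} (d : RootDatum s) : xLin R d.root ≠ 0 :=
  fun h => d.root_ne_zero ((lin_eq_zero_iff _).mp h)

variable (R) in
/-- The divided difference `(coefAct s q - fullAct s q) / root` of a reflection `s`. It lowers
the degree in the `x`, and the terms of the Dunkl operators given by reflections are built
from it. -/
def theta {s : V ≃ₗ[ℂ] V} (d : RootDatum s) : PhasePoly R V →ₗ[R] PhasePoly R V where
  toFun q := (root_dvd d q).choose
  map_add' p q := by
    apply mul_left_cancel₀ (xLin_root_ne_zero (R := R) d)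
    rw [mul_add, ← (root_dvd d _).choose_spec, ← (root_dvd d _).choose_spec,
      ← (root_dvd d _).choose_spec, map_add, map_add]
    ring
  map_smul' r q := by
    apply mul_left_cancel₀ (xLin_root_ne_zero (R := R) d)
    rw [RingHom.id_apply, mul_smul_comm, ← (root_dvd d _).choose_spec,
      ← (root_dvd d _).choose_spec, map_smul, map_smul, smul_sub]

theorem root_mul_theta {s : V ≃ₗ[ℂ] V} (d : RootDatum s) (q : PhasePoly R V) :
    xLin R d.root * theta R d q = coefAct R s q - fullAct R s q :=
  ((root_dvd d q).choose_spec).symm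

theorem theta_C {s : V ≃ₗ[ℂ] V} (d : RootDatum s) (p : SymPoly R V) :
    theta R d (MvPolynomial.C p) = 0 := by
  apply mul_left_cancel₀ (xLin_root_ne_zero (R := R) d)
  rw [root_mul_theta, coefAct_C, fullAct_C, sub_self, mul_zero]

/-- The twisted Leibniz rule, which produces the group elements in the relation between `y` and
`x`. -/
theorem theta_xLin_mul {s : V ≃ₗ[ℂ] V} (d : RootDatum s) (x : Module.Dual ℂ V)
    (q : PhasePoly R V) :
    theta R d (xLin R x * q) = xLin R x * theta R d q + x d.coroot • fullAct R s q := by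
  apply mul_left_cancel₀ (xLin_root_ne_zero (R := R) d)
  have h : xLin R x - xLin R (dualAct s x) = x d.coroot • xLin R d.root := by
    rw [← map_sub, d.sub_dualAct, map_smul]
  rw [root_mul_theta, map_mul, map_mul, coefAct_xLin, fullAct_xLin, mul_add, mul_left_comm,
    root_mul_theta, mul_smul_comm, ← smul_mul_assoc, ← h]
  ring

theorem totalDegree_theta_lt {s : V ≃ₗ[ℂ] V} (d : RootDatum s) {q : PhasePoly R V} {n : ℕ}
    (hq : q.totalDegree ≤ n) : theta R d q = 0 ∨ (theta R d q).totalDegree < n := by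
  by_cases h : theta R d q = 0
  · exact Or.inl h
  right
  have h1 := MvPolynomial.totalDegree_mul_of_isDomain (xLin_root_ne_zero (R := R) d) h
  rw [root_mul_theta, totalDegree_lin _ d.root_ne_zero] at h1
  have h2 := (MvPolynomial.totalDegree_sub (coefAct R s q) (fullAct R s q)).trans
    (max_le (totalDegree_coefAct_le s q) (totalDegree_fullAct_le s q))
  omega

end PhasePoly

/-! ### Realizations of the defining relations -/

section Realization

variable {V : Type u} [AddCommGroup V] [Module ℂ V]

instance fintypeRef (G : Subgroup (V ≃ₗ[ℂ] V)) [Finite G] : Fintype (Ref G) :=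
  Fintype.ofFinite _

/-- A reflection in `G`, as an element of the group `G`. -/
def refElt {G : Subgroup (V ≃ₗ[ℂ] V)} (s : Ref G) : G := ⟨s, mem_of_mem_ref s.2⟩

/-- An `R`-algebra `H` with linear maps from `V` and `V*` and a homomorphism from `G` satisfying
the relations of the rational Cherednik algebra at the parameter `t ∈ R`. Taking `R = ℂ` and
`R = ℂ[X]` covers the algebras at a number and at an indeterminate parameter. -/
structure Realization (G : Subgroup (V ≃ₗ[ℂ] V)) [Finite G] (c : (V ≃ₗ[ℂ] V) → ℂ)
    {R : Type v} [CommRing R] [Algebra ℂ R] (t : R) (H : Type w) [Ring H] [Algebra ℂ H]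
    [Algebra R H] where
  vec : V →ₗ[ℂ] H
  covec : Module.Dual ℂ V →ₗ[ℂ] H
  grp : G →* H
  grp_mul_vec : ∀ g y, grp g * vec y = vec ((g : V ≃ₗ[ℂ] V) y) * grp g
  grp_mul_covec : ∀ g x, grp g * covec x = covec (dualAct (g : V ≃ₗ[ℂ] V) x) * grp g
  vec_mul_vec : ∀ y y', vec y * vec y' = vec y' * vec y
  covec_mul_covec : ∀ x x', covec x * covec x' = covec x' * covec x
  vec_mul_covec : ∀ y x, vec y * covec x = covec x * vec y + algebraMap R H (x y • t) -
    ∑ s : Ref G, (c s * rootForm (s : V ≃ₗ[ℂ] V) y x) • grp (refElt s)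

/-- `c` is constant on the `G`-conjugacy classes of reflections in `G`. -/
def IsConjInvariant (G : Subgroup (V ≃ₗ[ℂ] V)) (c : (V ≃ₗ[ℂ] V) → ℂ) : Prop :=
  ∀ g ∈ G, ∀ s ∈ Ref G, c (g * s * g⁻¹) = c s

/-- Conjugation by `g ∈ G` as a permutation of the reflections in `G`. -/
def conjRef {G : Subgroup (V ≃ₗ[ℂ] V)} (g : G) : Ref G ≃ Ref G where
  toFun s := ⟨g * s * (g : V ≃ₗ[ℂ] V)⁻¹, ref_conj_mem s.2 (g * refElt s * g⁻¹).2⟩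
  invFun s := ⟨(g : V ≃ₗ[ℂ] V)⁻¹ * s * ((g : V ≃ₗ[ℂ] V)⁻¹)⁻¹,
    ref_conj_mem s.2 (g⁻¹ * refElt s * g⁻¹⁻¹).2⟩
  left_inv s := Subtype.ext (by simp only; group)
  right_inv s := Subtype.ext (by simp only; group)

/-- The sum over the reflections in the relation between `y` and `x` is `G`-equivariant. -/
theorem grp_mul_sum_rootForm {G : Subgroup (V ≃ₗ[ℂ] V)} [Finite G] {c : (V ≃ₗ[ℂ] V) → ℂ}
    (hc : IsConjInvariant G c) {H : Type w} [Ring H] [Algebra ℂ H] (f : G →* H) (g : G) (y : V)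
    (x : Module.Dual ℂ V) :
    f g * ∑ s : Ref G, (c s * rootForm (s : V ≃ₗ[ℂ] V) y x) • f (refElt s) =
      (∑ s : Ref G, (c s * rootForm (s : V ≃ₗ[ℂ] V) ((g : V ≃ₗ[ℂ] V) y)
        (dualAct (g : V ≃ₗ[ℂ] V) x)) • f (refElt s)) * f g := by
  rw [Finset.mul_sum, Finset.sum_mul]
  refine Fintype.sum_equiv (conjRef g) _ _ fun s => ?_
  have h1 : refElt (conjRef g s) = g * refElt s * g⁻¹ := rfl
  have h2 : ((conjRef g s : Ref G) : V ≃ₗ[ℂ] V) = g * s * (g : V ≃ₗ[ℂ] V)⁻¹ := rfl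
  rw [h1, h2, hc g g.2 s s.2, rootForm_conj, mul_smul_comm, smul_mul_assoc, ← map_mul, ← map_mul,
    inv_mul_cancel_right]

end Realization

/-! ### The representation by Dunkl operators -/

section Dunkl

variable (R : Type v) [CommRing R] [Algebra ℂ R] {V : Type u} [AddCommGroup V] [Module ℂ V]
  [FiniteDimensional ℂ V]

/-- The derivative along `y` in the variables `x`. -/
def dirDeriv (y : V) : Derivation (SymPoly R V) (PhasePoly R V) (PhasePoly R V) :=
  MvPolynomial.mkDerivation _ fun i =>
    algebraMap ℂ (PhasePoly R V) (Module.finBasis ℂ (Module.Dual ℂ V) i y)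

theorem dirDeriv_add (y y' : V) : dirDeriv R (y + y') = dirDeriv R y + dirDeriv R y' :=
  MvPolynomial.derivation_ext fun i => by
    simp only [dirDeriv, MvPolynomial.mkDerivation_X, Derivation.coe_add, Pi.add_apply, map_add]

theorem dirDeriv_smul_apply (r : ℂ) (y : V) (q : PhasePoly R V) :
    dirDeriv R (r • y) q = r • dirDeriv R y q := by
  have : dirDeriv R (r • y) = r • dirDeriv R y :=
    MvPolynomial.derivation_ext fun i => by
      simp only [dirDeriv, MvPolynomial.mkDerivation_X, Derivation.coe_smul, Pi.smul_apply,
        map_smul, smul_eq_mul, map_mul, Algebra.smul_def]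
  rw [this]
  rfl

theorem dirDeriv_xLin (y : V) (x : Module.Dual ℂ V) :
    dirDeriv R y (xLin R x) = algebraMap ℂ (PhasePoly R V) (x y) := by
  have : ((dirDeriv R y).toLinearMap.restrictScalars ℂ) ∘ₗ xLin R =
      (Algebra.linearMap ℂ (PhasePoly R V)) ∘ₗ (Module.Dual.eval ℂ V y) := by
    refine (Module.finBasis ℂ _).ext fun i => ?_
    simp only [LinearMap.comp_apply, xLin, lin_finBasis]
    exact MvPolynomial.mkDerivation_X _ _ _
  exact congrArg (fun f => f x) this

/-- The space underlying the representation: `R[V ⊕ V*] ⊗ R[G]`, with `Finsupp.single g q`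
standing for the ordered product `q g`. -/
abbrev DunklModule (G : Subgroup (V ≃ₗ[ℂ] V)) : Type (max u v) := G →₀ PhasePoly R V

/-- The `R`-linear endomorphisms of `DunklModule R G`. A type of its own, so that its scalar
actions are exactly the instances below. -/
def DunklEnd (G : Subgroup (V ≃ₗ[ℂ] V)) : Type (max u v) := Module.End R (DunklModule R G)

section DunklEndInstances

variable (G : Subgroup (V ≃ₗ[ℂ] V))

instance : Ring (DunklEnd R G) :=
  inferInstanceAs (Ring (Module.End R (DunklModule R G)))

instance : Algebra ℂ (DunklEnd R G) :=
  inferInstanceAs (Algebra ℂ (Module.End R (DunklModule R G)))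

instance : Algebra R (DunklEnd R G) :=
  inferInstanceAs (Algebra R (Module.End R (DunklModule R G)))

instance : IsScalarTower ℂ R (DunklEnd R G) :=
  inferInstanceAs (IsScalarTower ℂ R (Module.End R (DunklModule R G)))

instance : Module (DunklEnd R G) (DunklModule R G) :=
  inferInstanceAs (Module (Module.End R (DunklModule R G)) (DunklModule R G))

instance : IsScalarTower ℂ (DunklEnd R G) (DunklModule R G) :=
  inferInstanceAs (IsScalarTower ℂ (Module.End R (DunklModule R G)) (DunklModule R G))

instance : IsScalarTower R (DunklEnd R G) (DunklModule R G) :=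
  inferInstanceAs (IsScalarTower R (Module.End R (DunklModule R G)) (DunklModule R G))

end DunklEndInstances

variable {R} {G : Subgroup (V ≃ₗ[ℂ] V)}

theorem dunklEnd_ext {T T' : DunklEnd R G}
    (h : ∀ g q, T • (Finsupp.single g q : DunklModule R G) = T' • Finsupp.single g q) : T = T' :=
  Finsupp.lhom_ext (φ := (T : Module.End R (DunklModule R G)))
    (ψ := (T' : Module.End R (DunklModule R G))) h

/-- The operator `q g ↦ f(q) (k g)`. -/
def shiftOp (k : G) (f : PhasePoly R V →ₗ[R] PhasePoly R V) : DunklEnd R G :=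
  (Finsupp.lsum R fun g => Finsupp.lsingle (k * g) ∘ₗ f : Module.End R (DunklModule R G))

@[simp] theorem shiftOp_single (k : G) (f : PhasePoly R V →ₗ[R] PhasePoly R V) (g : G)
    (q : PhasePoly R V) :
    shiftOp k f • (Finsupp.single g q : DunklModule R G) = Finsupp.single (k * g) (f q) := by
  show (Finsupp.lsum R fun g => Finsupp.lsingle (k * g) ∘ₗ f) (Finsupp.single g q) = _
  simp

variable (R G) in
/-- Multiplication by `x ∈ V*`. -/
def xOp : Module.Dual ℂ V →ₗ[ℂ] DunklEnd R G where
  toFun x := shiftOp 1 (LinearMap.mulLeft R (xLin R x))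
  map_add' x x' := dunklEnd_ext fun g q => by
    rw [add_smul, shiftOp_single, shiftOp_single, shiftOp_single, ← Finsupp.single_add, map_add,
      LinearMap.mulLeft_apply, LinearMap.mulLeft_apply, LinearMap.mulLeft_apply, add_mul]
  map_smul' r x := dunklEnd_ext fun g q => by
    rw [RingHom.id_apply, smul_assoc, shiftOp_single, shiftOp_single, map_smul,
      LinearMap.mulLeft_apply, LinearMap.mulLeft_apply, smul_mul_assoc, Finsupp.smul_single]

@[simp] theorem xOp_single (x : Module.Dual ℂ V) (g : G) (q : PhasePoly R V) :
    xOp R G x • (Finsupp.single g q : DunklModule R G) = Finsupp.single g (xLin R x * q) :=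
  (shiftOp_single _ _ _ _).trans (by rw [one_mul]; rfl)

variable (R G) in
/-- The diagonal action of `G`. -/
def grpOp : G →* DunklEnd R G where
  toFun k := shiftOp k (fullAct R (k : V ≃ₗ[ℂ] V)).toLinearMap
  map_one' := dunklEnd_ext fun g q => by
    rw [shiftOp_single, one_mul, one_smul]
    exact congrArg _ (fullAct_one q)
  map_mul' k l := dunklEnd_ext fun g q => by
    rw [mul_smul, shiftOp_single, shiftOp_single, shiftOp_single, mul_assoc,
      AlgHom.toLinearMap_apply, AlgHom.toLinearMap_apply, AlgHom.toLinearMap_apply,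
      Subgroup.coe_mul, fullAct_mul]

@[simp] theorem grpOp_single (k g : G) (q : PhasePoly R V) :
    grpOp R G k • (Finsupp.single g q : DunklModule R G) =
      Finsupp.single (k * g) (fullAct R (k : V ≃ₗ[ℂ] V) q) :=
  shiftOp_single _ _ _ _

theorem grpOp_mul_xOp (g : G) (x : Module.Dual ℂ V) :
    grpOp R G g * xOp R G x = xOp R G (dualAct (g : V ≃ₗ[ℂ] V) x) * grpOp R G g :=
  dunklEnd_ext fun k q => by
    rw [mul_smul, mul_smul, xOp_single, grpOp_single, grpOp_single, xOp_single, map_mul,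
      fullAct_xLin]

theorem xOp_mul_xOp (x x' : Module.Dual ℂ V) :
    xOp R G x * xOp R G x' = xOp R G x' * xOp R G x :=
  dunklEnd_ext fun k q => by
    rw [mul_smul, mul_smul, xOp_single, xOp_single, xOp_single, xOp_single, mul_left_comm]

/-- An operator vanishes as soon as it kills the elements free of `x` and can be moved past the
multiplications by `x`. The relations of the Dunkl operators with `G` and with each other are
checked in this way. -/
theorem eq_zero_of_mul_xOp {T : DunklEnd R G}
    (hC : ∀ g p, T • (Finsupp.single g (MvPolynomial.C p) : DunklModule R G) = 0)
    (hx : ∀ x, ∃ L : DunklEnd R G, T * xOp R G x = L * T) : T = 0 :=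
  dunklEnd_ext fun g q => by
    rw [zero_smul]
    induction q using phasePoly_induction with
    | const p => exact hC g p
    | add p q hp hq => rw [Finsupp.single_add, smul_add, hp, hq, add_zero]
    | xLin_mul x p hp =>
      obtain ⟨L, hL⟩ := hx x
      rw [← xOp_single, ← mul_smul, hL, mul_smul, hp, smul_zero]

variable (G) in
/-- The operator `q g ↦ (y q + t ∂_y q) g`: the action of `y` when `c = 0`. -/
def weylOp (t : R) : V →ₗ[ℂ] DunklEnd R G where
  toFun y := shiftOp 1 (LinearMap.mulLeft R (yLin R y) +
      t • (dirDeriv R y).toLinearMap.restrictScalars R)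
  map_add' y y' := dunklEnd_ext fun g q => by
    rw [add_smul, shiftOp_single, shiftOp_single, shiftOp_single,
      ← Finsupp.single_add]
    congr 1
    show yLin R (y + y') * q + t • dirDeriv R (y + y') q =
      (yLin R y * q + t • dirDeriv R y q) + (yLin R y' * q + t • dirDeriv R y' q)
    rw [dirDeriv_add, yLin, map_add, MvPolynomial.C_add, Derivation.add_apply, smul_add, add_mul]
    abel
  map_smul' r y := dunklEnd_ext fun g q => by
    rw [RingHom.id_apply, smul_assoc, shiftOp_single, shiftOp_single,
      Finsupp.smul_single]
    congr 1
    show yLin R (r • y) * q + t • dirDeriv R (r • y) q =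
      r • (yLin R y * q + t • dirDeriv R y q)
    have h : yLin R (r • y) = r • yLin R y := by
      rw [yLin, map_smul, ← MvPolynomial.algebraMap_eq]
      exact map_smul (IsScalarTower.toAlgHom ℂ (SymPoly R V) (PhasePoly R V)) r _
    rw [dirDeriv_smul_apply, h, smul_add, smul_mul_assoc, smul_comm t r]

theorem weylOp_single (t : R) (y : V) (g : G) (q : PhasePoly R V) :
    weylOp G t y • (Finsupp.single g q : DunklModule R G) =
      Finsupp.single g (yLin R y * q + t • dirDeriv R y q) :=
  (shiftOp_single _ _ _ _).trans (by rw [one_mul]; rfl)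

variable [IsDomain R] [Finite G] (G)

/-- The Dunkl operator by which `y ∈ V` acts: the operator `weylOp` corrected by the divided
differences of the reflections. -/
def dunklOp (t : R) (c : (V ≃ₗ[ℂ] V) → ℂ) : V →ₗ[ℂ] DunklEnd R G :=
  weylOp G t - ∑ s : Ref G, c s • LinearMap.smulRight (rootDatum s).form
    (shiftOp (refElt s) (theta R (rootDatum s)) : DunklEnd R G)

variable {G} (t : R) (c : (V ≃ₗ[ℂ] V) → ℂ)

theorem dunklOp_single (y : V) (g : G) (q : PhasePoly R V) :
    dunklOp G t c y • (Finsupp.single g q : DunklModule R G) =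
      Finsupp.single g (yLin R y * q + t • dirDeriv R y q) -
        ∑ s : Ref G, (c s * (rootDatum s).form y) •
          Finsupp.single (refElt s * g) (theta R (rootDatum s) q) := by
  rw [dunklOp, LinearMap.sub_apply, LinearMap.sum_apply, sub_smul, weylOp_single, Finset.sum_smul]
  congr 1
  refine Finset.sum_congr rfl fun s _ => ?_
  rw [LinearMap.smul_apply, LinearMap.smulRight_apply, smul_smul, smul_assoc, shiftOp_single]

theorem dunklOp_single_C (y : V) (g : G) (p : SymPoly R V) :
    dunklOp G t c y • (Finsupp.single g (MvPolynomial.C p) : DunklModule R G) =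
      Finsupp.single g (MvPolynomial.C (lin R y * p)) := by
  rw [dunklOp_single, Finset.sum_eq_zero, sub_zero, map_mul]
  · rw [MvPolynomial.derivation_C, smul_zero, add_zero]
  · intro s _
    rw [theta_C, Finsupp.single_zero, smul_zero]

/-- The Dunkl operators satisfy the relation between `y` and `x`. -/
theorem dunklOp_mul_xOp (y : V) (x : Module.Dual ℂ V) :
    dunklOp G t c y * xOp R G x = xOp R G x * dunklOp G t c y +
      algebraMap R (DunklEnd R G) (x y • t) -
      ∑ s : Ref G, (c s * rootForm (s : V ≃ₗ[ℂ] V) y x) • grpOp R G (refElt s) := by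
  refine dunklEnd_ext fun g q => ?_
  rw [sub_smul, add_smul, mul_smul, mul_smul, xOp_single, dunklOp_single, dunklOp_single,
    smul_sub, xOp_single, Finset.sum_smul, Finset.smul_sum, algebraMap_smul, Finsupp.smul_single]
  have h1 : yLin R y * (xLin R x * q) + t • dirDeriv R y (xLin R x * q) =
      xLin R x * (yLin R y * q + t • dirDeriv R y q) + (x y • t) • q := by
    rw [Derivation.leibniz, dirDeriv_xLin, smul_eq_mul, smul_eq_mul, smul_add, mul_add,
      mul_left_comm, mul_smul_comm, smul_assoc (x y) t q, mul_comm q, ← Algebra.smul_def,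
      smul_comm t (x y) q, add_assoc]
  have h2 : ∀ s : Ref G, (c s * (rootDatum s).form y) •
        (Finsupp.single (refElt s * g) (theta R (rootDatum s) (xLin R x * q)) : DunklModule R G) =
      xOp R G x • ((c s * (rootDatum s).form y) •
        (Finsupp.single (refElt s * g) (theta R (rootDatum s) q) : DunklModule R G)) +
      ((c s * rootForm (s : V ≃ₗ[ℂ] V) y x) • grpOp R G (refElt s)) •
        (Finsupp.single g q : DunklModule R G) := by
    intro s
    rw [theta_xLin_mul, Finsupp.single_add, smul_add, smul_comm (xOp R G x), xOp_single,
      smul_assoc, grpOp_single, (rootDatum s).rootForm_eq_mul, ← Finsupp.smul_single, smul_smul,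
      mul_assoc]
    rfl
  rw [h1, Finset.sum_congr rfl fun s _ => h2 s, Finset.sum_add_distrib, Finsupp.single_add]
  abel

variable {c} (hc : IsConjInvariant G c)

include hc
theorem grpOp_mul_dunklOp (g : G) (y : V) :
    grpOp R G g * dunklOp G t c y = dunklOp G t c ((g : V ≃ₗ[ℂ] V) y) * grpOp R G g := by
  rw [← sub_eq_zero]
  refine eq_zero_of_mul_xOp (fun k p => ?_) fun x => ⟨xOp R G (dualAct (g : V ≃ₗ[ℂ] V) x), ?_⟩
  · rw [sub_smul, mul_smul, mul_smul, dunklOp_single_C, grpOp_single, grpOp_single, fullAct_C,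
      fullAct_C, dunklOp_single_C, map_mul, symAct_lin]
    exact sub_self _
  · have h := grp_mul_sum_rootForm hc (grpOp R G) g y x
    have hx : dualAct (g : V ≃ₗ[ℂ] V) x ((g : V ≃ₗ[ℂ] V) y) = x y := by simp
    rw [sub_mul, mul_assoc, dunklOp_mul_xOp, mul_assoc _ (grpOp R G g), grpOp_mul_xOp,
      ← mul_assoc _ _ (grpOp R G g), dunklOp_mul_xOp, mul_sub, mul_add, h, hx,
      ← Algebra.commutes, sub_mul, add_mul, mul_sub, ← mul_assoc (grpOp R G g), grpOp_mul_xOp]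
    simp only [mul_assoc]
    abel

/-- The Jacobi identity for `y, y', x`, which makes the commutator of two Dunkl operators commute
with the multiplications by `x`. It holds one reflection at a time, since `s y - y` runs through
a line. -/
theorem dunklOp_mul_sum (y y' : V) (x : Module.Dual ℂ V) :
    dunklOp G t c y * ∑ s : Ref G, (c s * rootForm (s : V ≃ₗ[ℂ] V) y' x) • grpOp R G (refElt s) -
      (∑ s : Ref G, (c s * rootForm (s : V ≃ₗ[ℂ] V) y' x) • grpOp R G (refElt s)) *
        dunklOp G t c y =
    dunklOp G t c y' * ∑ s : Ref G, (c s * rootForm (s : V ≃ₗ[ℂ] V) y x) • grpOp R G (refElt s) -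
      (∑ s : Ref G, (c s * rootForm (s : V ≃ₗ[ℂ] V) y x) • grpOp R G (refElt s)) *
        dunklOp G t c y' := by
  rw [Finset.mul_sum, Finset.mul_sum, Finset.sum_mul, Finset.sum_mul, ← Finset.sum_sub_distrib,
    ← Finset.sum_sub_distrib]
  refine Finset.sum_congr rfl fun s _ => ?_
  have key : ∀ z z' : V,
      dunklOp G t c z * (c s * rootForm (s : V ≃ₗ[ℂ] V) z' x) • grpOp R G (refElt s) -
        ((c s * rootForm (s : V ≃ₗ[ℂ] V) z' x) • grpOp R G (refElt s)) * dunklOp G t c z =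
      -((c s * x (rootDatum s).coroot) •
        (dunklOp G t c ((rootDatum s).form z' • ((s : V ≃ₗ[ℂ] V) z - z)) *
          grpOp R G (refElt s))) := by
    intro z z'
    have h0 : ((refElt s : G) : V ≃ₗ[ℂ] V) = s := rfl
    rw [mul_smul_comm, smul_mul_assoc, grpOp_mul_dunklOp t hc, h0, (rootDatum s).rootForm_eq_mul,
      map_smul, map_sub, smul_mul_assoc, smul_smul, sub_mul, ← smul_sub, ← smul_neg, neg_sub]
    congr 1
    ring
  rw [key, key, (rootDatum s).form_smul_sub]

/-- Dunkl operators commute: their commutator commutes with every `x` and kills the elements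
free of `x`. -/
theorem dunklOp_mul_dunklOp (y y' : V) :
    dunklOp G t c y * dunklOp G t c y' = dunklOp G t c y' * dunklOp G t c y := by
  rw [← sub_eq_zero]
  refine eq_zero_of_mul_xOp (fun k p => ?_) fun x => ⟨xOp R G x, ?_⟩
  · rw [sub_smul, mul_smul, mul_smul, dunklOp_single_C, dunklOp_single_C, dunklOp_single_C,
      dunklOp_single_C, mul_left_comm, sub_self]
  · have key : ∀ z z' : V, dunklOp G t c z * dunklOp G t c z' * xOp R G x =
        xOp R G x * (dunklOp G t c z * dunklOp G t c z') +
        (algebraMap R (DunklEnd R G) (x z • t) * dunklOp G t c z' +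
          algebraMap R (DunklEnd R G) (x z' • t) * dunklOp G t c z) -
        ((∑ s : Ref G, (c s * rootForm (s : V ≃ₗ[ℂ] V) z x) • grpOp R G (refElt s)) *
            dunklOp G t c z' +
          dunklOp G t c z *
            ∑ s : Ref G, (c s * rootForm (s : V ≃ₗ[ℂ] V) z' x) • grpOp R G (refElt s)) := by
      intro z z'
      rw [mul_assoc, dunklOp_mul_xOp, mul_sub, mul_add, ← mul_assoc (dunklOp G t c z) (xOp R G x),
        dunklOp_mul_xOp, sub_mul, add_mul, ← Algebra.commutes, mul_assoc]
      abel
    have h := dunklOp_mul_sum t hc y y' x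
    rw [sub_mul, key, key, mul_sub]
    rw [sub_eq_iff_eq_add] at h
    rw [h]
    abel

/-- The Dunkl operators, the multiplications by `x` and the action of `G` satisfy the Cherednik
relations. -/
def dunklRealization : Realization G c t (DunklEnd R G) where
  vec := dunklOp G t c
  covec := xOp R G
  grp := grpOp R G
  grp_mul_vec := grpOp_mul_dunklOp t hc
  grp_mul_covec := grpOp_mul_xOp
  vec_mul_vec := dunklOp_mul_dunklOp t hc
  covec_mul_covec := xOp_mul_xOp
  vec_mul_covec := dunklOp_mul_xOp t c

end Dunkl

/-! ### Ordered products and the Poincaré–Birkhoff–Witt theorem -/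

section Ordering

open scoped IsMulCommutative in
/-- Pairwise commuting elements of a possibly noncommutative algebra can be substituted for the
variables of a polynomial: they generate a commutative subalgebra. -/
theorem exists_algHom_of_commute {R E ι κ : Type*} [CommRing R] [Ring E] [Algebra R E]
    (p : ι → E) (q : κ → E) (hp : ∀ i j, p i * p j = p j * p i)
    (hq : ∀ i j, q i * q j = q j * q i) (hpq : ∀ i j, p i * q j = q j * p i) :
    ∃ φ : MvPolynomial κ (MvPolynomial ι R) →ₐ[R] E,
      (∀ k, φ (MvPolynomial.X k) = q k) ∧ ∀ i, φ (MvPolynomial.C (MvPolynomial.X i)) = p i := by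
  have hcomm : ∀ a ∈ Set.range p ∪ Set.range q, ∀ b ∈ Set.range p ∪ Set.range q,
      a * b = b * a := by
    rintro _ (⟨i, rfl⟩ | ⟨i, rfl⟩) _ (⟨j, rfl⟩ | ⟨j, rfl⟩)
    · exact hp i j
    · exact hpq i j
    · exact (hpq j i).symm
    · exact hq i j
  let S : Subalgebra R E := Algebra.adjoin R (Set.range p ∪ Set.range q)
  have : IsMulCommutative S := Algebra.isMulCommutative_adjoin R hcomm
  let p' : ι → S := fun i => ⟨p i, Algebra.subset_adjoin (Or.inl ⟨i, rfl⟩)⟩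
  let q' : κ → S := fun i => ⟨q i, Algebra.subset_adjoin (Or.inr ⟨i, rfl⟩)⟩
  let f : MvPolynomial ι R →ₐ[R] S := MvPolynomial.aeval p'
  refine ⟨S.val.comp (MvPolynomial.aevalTower f q'), fun k => ?_, fun i => ?_⟩
  · rw [AlgHom.comp_apply, MvPolynomial.aevalTower_X]
    rfl
  · rw [AlgHom.comp_apply, MvPolynomial.aevalTower_C, MvPolynomial.aeval_X]
    rfl

namespace Realization

variable {V : Type u} [AddCommGroup V] [Module ℂ V] [FiniteDimensional ℂ V]
  {G : Subgroup (V ≃ₗ[ℂ] V)} [Finite G] {c : (V ≃ₗ[ℂ] V) → ℂ}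
  {R : Type v} [CommRing R] [Algebra ℂ R] {t : R} {H : Type w} [Ring H] [Algebra ℂ H]
  [Algebra R H] [IsScalarTower ℂ R H] (h : Realization G c t H)

/-- The ordered product `x₁ ⋯ xₘ y₁ ⋯ yₙ ↦ x₁ ⋯ xₘ y₁ ⋯ yₙ ∈ H`. Left multiplications by the `x`
and right multiplications by the `y` commute with each other, so that polynomials act on `H`
through them; the ordered product is the result of this action on `1`. -/
theorem exists_order : ∃ o : PhasePoly R V →ₗ[R] H, o 1 = 1 ∧
    (∀ x q, o (xLin R x * q) = h.covec x * o q) ∧ ∀ y q, o (yLin R y * q) = o q * h.vec y := by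
  obtain ⟨φ, hφx, hφy⟩ := exists_algHom_of_commute (R := R) (E := Module.End R H)
    (fun i => LinearMap.mulRight R (h.vec (Module.finBasis ℂ V i)))
    (fun i => LinearMap.mulLeft R (h.covec (Module.finBasis ℂ (Module.Dual ℂ V) i)))
    (fun i j => LinearMap.ext fun a => by
      simp only [Module.End.mul_apply, LinearMap.mulRight_apply, mul_assoc, h.vec_mul_vec])
    (fun i j => LinearMap.ext fun a => by
      simp only [Module.End.mul_apply, LinearMap.mulLeft_apply, ← mul_assoc,
        h.covec_mul_covec (Module.finBasis ℂ (Module.Dual ℂ V) i)])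
    (fun i j => LinearMap.ext fun a => by
      simp only [Module.End.mul_apply, LinearMap.mulLeft_apply, LinearMap.mulRight_apply,
        mul_assoc])
  let o : PhasePoly R V →ₗ[R] H := (LinearMap.applyₗ (1 : H)) ∘ₗ φ.toLinearMap
  have ho : ∀ q, o q = φ q 1 := fun q => rfl
  have hx : ∀ i q, o (MvPolynomial.X i * q) =
      h.covec (Module.finBasis ℂ (Module.Dual ℂ V) i) * o q := fun i q => by
    rw [ho, map_mul, hφx, Module.End.mul_apply, LinearMap.mulLeft_apply, ho]
  have hy : ∀ i q, o (MvPolynomial.C (MvPolynomial.X i) * q) =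
      o q * h.vec (Module.finBasis ℂ V i) := fun i q => by
    rw [ho, map_mul, hφy, Module.End.mul_apply, LinearMap.mulRight_apply, ho]
  refine ⟨o, by rw [ho, map_one φ, Module.End.one_apply], fun x q => ?_, fun y q => ?_⟩
  · have : (o.restrictScalars ℂ) ∘ₗ (LinearMap.mulRight ℂ q) ∘ₗ xLin R =
        (LinearMap.mulRight ℂ (o q)) ∘ₗ h.covec :=
      (Module.finBasis ℂ _).ext fun i => by
        simp only [LinearMap.comp_apply, xLin, lin_finBasis, LinearMap.mulRight_apply]
        exact hx i q
    exact congrArg (fun f => f x) this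
  · have : (o.restrictScalars ℂ) ∘ₗ (LinearMap.mulRight ℂ q) ∘ₗ
        (IsScalarTower.toAlgHom ℂ (SymPoly R V) (PhasePoly R V)).toLinearMap ∘ₗ lin R =
        (LinearMap.mulLeft ℂ (o q)) ∘ₗ h.vec :=
      (Module.finBasis ℂ _).ext fun i => by
        simp only [LinearMap.comp_apply, lin_finBasis, LinearMap.mulRight_apply,
          LinearMap.mulLeft_apply]
        exact hy i q
    exact congrArg (fun f => f y) this

/-- The ordered product of a polynomial in `x` and `y`, with the `x` on the left of the `y`. -/
def order : PhasePoly R V →ₗ[R] H := h.exists_order.choose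

theorem order_one : h.order 1 = 1 := h.exists_order.choose_spec.1

theorem order_xLin_mul (x : Module.Dual ℂ V) (q : PhasePoly R V) :
    h.order (xLin R x * q) = h.covec x * h.order q := h.exists_order.choose_spec.2.1 x q

theorem order_yLin_mul (y : V) (q : PhasePoly R V) :
    h.order (yLin R y * q) = h.order q * h.vec y := h.exists_order.choose_spec.2.2 y q

theorem order_C_C (r : R) : h.order (MvPolynomial.C (MvPolynomial.C r)) = algebraMap R H r := by
  have : (MvPolynomial.C (MvPolynomial.C r) : PhasePoly R V) = r • 1 :=
    (Algebra.algebraMap_eq_smul_one (A := PhasePoly R V) r)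
  rw [this, map_smul, order_one, ← Algebra.algebraMap_eq_smul_one]

theorem vec_mul_order_C (y : V) (p : SymPoly R V) :
    h.vec y * h.order (MvPolynomial.C p) = h.order (MvPolynomial.C p) * h.vec y := by
  induction p using symPoly_induction with
  | const r => rw [order_C_C, Algebra.commutes]
  | add p q hp hq => rw [map_add, map_add, mul_add, add_mul, hp, hq]
  | lin_mul u p hp =>
    rw [map_mul, order_yLin_mul, ← mul_assoc, hp, mul_assoc, mul_assoc, h.vec_mul_vec]

theorem grp_mul_order (g : G) (q : PhasePoly R V) :
    h.grp g * h.order q = h.order (fullAct R (g : V ≃ₗ[ℂ] V) q) * h.grp g := by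
  induction q using phasePoly_induction with
  | const p =>
    rw [fullAct_C]
    induction p using symPoly_induction with
    | const r =>
      have : symAct R ((g : V ≃ₗ[ℂ] V) : V →ₗ[ℂ] V) (MvPolynomial.C r) = MvPolynomial.C r :=
        AlgHom.commutes (symAct R _) r
      rw [this, order_C_C, Algebra.commutes]
    | add p q hp hq => rw [map_add, map_add, map_add, map_add, map_add, mul_add, add_mul, hp, hq]
    | lin_mul u p hp =>
      rw [map_mul (symAct R _), MvPolynomial.C_mul, MvPolynomial.C_mul, symAct_lin,
        order_yLin_mul, ← mul_assoc, hp, mul_assoc,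
        h.grp_mul_vec, ← mul_assoc, order_yLin_mul]
      rfl
  | add p q hp hq => rw [map_add, map_add, map_add, mul_add, add_mul, hp, hq]
  | xLin_mul x p hp =>
    rw [map_mul (fullAct R _), fullAct_xLin, order_xLin_mul, order_xLin_mul, ← mul_assoc,
      h.grp_mul_covec, mul_assoc, hp, mul_assoc]

/-- The Poincaré–Birkhoff–Witt map `q g ↦ (ordered product of q) g`. -/
def pbw : DunklModule R G →ₗ[R] H :=
  Finsupp.lsum R fun g => LinearMap.mulRight R (h.grp g) ∘ₗ h.order

theorem pbw_single (g : G) (q : PhasePoly R V) :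
    h.pbw (Finsupp.single g q) = h.order q * h.grp g := by
  rw [pbw, Finsupp.lsum_single]
  rfl

theorem pbw_smul_of_single {T : DunklEnd R G} {a : H}
    (hT : ∀ g q, h.pbw (T • (Finsupp.single g q : DunklModule R G)) =
      a * h.pbw (Finsupp.single g q)) (m : DunklModule R G) :
    h.pbw (T • m) = a * h.pbw m := by
  induction m using Finsupp.induction_linear with
  | zero => rw [smul_zero, map_zero, mul_zero]
  | add m m' hm hm' => rw [smul_add, map_add, hm, hm', map_add, mul_add]
  | single g q => exact hT g q

theorem pbw_xOp_smul (x : Module.Dual ℂ V) (m : DunklModule R G) :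
    h.pbw (xOp R G x • m) = h.covec x * h.pbw m :=
  h.pbw_smul_of_single (fun g q => by
    rw [xOp_single, pbw_single, pbw_single, order_xLin_mul, mul_assoc]) m

theorem pbw_grpOp_smul (k : G) (m : DunklModule R G) :
    h.pbw (grpOp R G k • m) = h.grp k * h.pbw m :=
  h.pbw_smul_of_single (fun g q => by
    rw [grpOp_single, pbw_single, pbw_single, ← mul_assoc, grp_mul_order, map_mul, mul_assoc]) m

variable [IsDomain R]

/-- The map `pbw` carries the Dunkl operators to the left multiplications by `V`: both move past
the `x` by the same rule and agree on the elements free of `x`. -/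
theorem pbw_dunklOp_smul (y : V) (m : DunklModule R G) :
    h.pbw (dunklOp G t c y • m) = h.vec y * h.pbw m :=
  h.pbw_smul_of_single (fun g q => by
    induction q using phasePoly_induction with
    | const p =>
      rw [dunklOp_single_C, map_mul, pbw_single, order_yLin_mul, pbw_single, ← mul_assoc,
        vec_mul_order_C]
    | add p q hp hq => rw [Finsupp.single_add, smul_add, map_add, map_add, hp, hq, mul_add]
    | xLin_mul x p hp =>
      rw [← xOp_single, ← mul_smul, dunklOp_mul_xOp, sub_smul, add_smul, map_sub, map_add,
        mul_smul, pbw_xOp_smul, pbw_xOp_smul, hp, algebraMap_smul, map_smul, Finset.sum_smul,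
        map_sum, ← mul_assoc (h.vec y), h.vec_mul_covec, sub_mul, add_mul, mul_assoc,
        ← Algebra.smul_def, Finset.sum_mul]
      congr 1
      refine Finset.sum_congr rfl fun s _ => ?_
      rw [smul_assoc, smul_mul_assoc, ← pbw_grpOp_smul]
      exact map_smul (h.pbw.restrictScalars ℂ) _ _) m

variable (ρ : H →ₐ[R] DunklEnd R G) (hv : ∀ y, ρ (h.vec y) = dunklOp G t c y)
  (hx : ∀ x, ρ (h.covec x) = xOp R G x) (hg : ∀ g, ρ (h.grp g) = grpOp R G g)

include hv hx hg

/-- If the Dunkl operators give a representation of `H`, evaluation at `1` is a left inverse of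
`pbw`. -/
theorem smul_one_pbw (m : DunklModule R G) :
    ρ (h.pbw m) • (Finsupp.single 1 1 : DunklModule R G) = m := by
  induction m using Finsupp.induction_linear with
  | zero => rw [map_zero, map_zero, zero_smul]
  | add m m' hm hm' => rw [map_add, map_add, add_smul, hm, hm']
  | single g q =>
    rw [pbw_single, map_mul, mul_smul, hg, grpOp_single, mul_one, map_one]
    induction q using phasePoly_induction with
    | const p =>
      induction p using symPoly_induction with
      | const r =>
        rw [order_C_C, AlgHom.commutes, algebraMap_smul, Finsupp.smul_single]
        congr 1
        exact (Algebra.algebraMap_eq_smul_one (A := PhasePoly R V) r).symm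
      | add p q hp hq => rw [map_add, map_add, map_add, add_smul, hp, hq, Finsupp.single_add]
      | lin_mul u p hp =>
        rw [map_mul, order_yLin_mul, ← vec_mul_order_C, map_mul, mul_smul, hp, hv,
          dunklOp_single_C, map_mul]
    | add p q hp hq => rw [map_add, map_add, add_smul, hp, hq, Finsupp.single_add]
    | xLin_mul x p hp => rw [order_xLin_mul, map_mul, mul_smul, hp, hx, xOp_single]

variable (hgen : Algebra.adjoin R (Set.range h.vec ∪ Set.range h.covec ∪ Set.range h.grp) = ⊤)

include hgen

theorem pbw_smul (a : H) (m : DunklModule R G) : h.pbw (ρ a • m) = a * h.pbw m := by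
  have ha : a ∈ Algebra.adjoin R (Set.range h.vec ∪ Set.range h.covec ∪ Set.range h.grp) := by
    rw [hgen]; exact Algebra.mem_top
  induction ha using Algebra.adjoin_induction generalizing m with
  | mem a ha =>
    rcases ha with (⟨y, rfl⟩ | ⟨x, rfl⟩) | ⟨g, rfl⟩
    · rw [hv, pbw_dunklOp_smul]
    · rw [hx, pbw_xOp_smul]
    · rw [hg, pbw_grpOp_smul]
  | algebraMap r => rw [AlgHom.commutes, algebraMap_smul, map_smul, Algebra.smul_def]
  | add a b _ _ ha hb => rw [map_add, add_smul, map_add, ha, hb, add_mul]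
  | mul a b _ _ ha hb => rw [map_mul, mul_smul, ha, hb, mul_assoc]

/-- The Poincaré–Birkhoff–Witt theorem for a realization generated by `V`, `V*` and `G` that acts
by Dunkl operators. -/
theorem pbw_bijective : Function.Bijective h.pbw := by
  refine ⟨(Function.LeftInverse.injective (g := fun a =>
    ρ a • (Finsupp.single 1 1 : DunklModule R G))) (h.smul_one_pbw ρ hv hx hg), fun a =>
    ⟨ρ a • Finsupp.single 1 1, ?_⟩⟩
  rw [h.pbw_smul ρ hv hx hg hgen, pbw_single, order_one, map_one, mul_one, mul_one]

end Realization

end Ordering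

/-! ### Homomorphisms out of the skew group algebra -/

section Generators

variable {V : Type u} [AddCommGroup V] [Module ℂ V] (G : Subgroup (V ≃ₗ[ℂ] V))

/-- The inclusion of the tensor algebra of `V ⊕ V*` in the skew group algebra. -/
def tensorIncl : TensorVV V →ₐ[ℂ] SkewGroupAlgebra G :=
  { (SkewMonoidAlgebra.singleOneRingHom : TensorVV V →+* SkewMonoidAlgebra (TensorVV V) G) with
    commutes' := fun _ => rfl }

theorem tensorIncl_ι (y : V) (x : Module.Dual ℂ V) :
    tensorIncl G (TensorAlgebra.ι ℂ (y, x)) = vec G y + covec G x := by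
  have h0 : ((y, x) : V × Module.Dual ℂ V) = (y, 0) + (0, x) := by simp
  rw [h0, map_add, map_add]
  rfl

/-- The linear map `vec` from `V` to the skew group algebra. -/
def vecLin : V →ₗ[ℂ] SkewGroupAlgebra G :=
  (tensorIncl G).toLinearMap ∘ₗ TensorAlgebra.ι ℂ ∘ₗ LinearMap.inl ℂ V (Module.Dual ℂ V)

/-- The linear map `covec` from `V*` to the skew group algebra. -/
def covecLin : Module.Dual ℂ V →ₗ[ℂ] SkewGroupAlgebra G :=
  (tensorIncl G).toLinearMap ∘ₗ TensorAlgebra.ι ℂ ∘ₗ LinearMap.inr ℂ V (Module.Dual ℂ V)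

theorem vecLin_apply (y : V) : vecLin G y = vec G y := rfl

theorem covecLin_apply (x : Module.Dual ℂ V) : covecLin G x = covec G x := rfl

/-- The homomorphism `grp` from `G` to the skew group algebra. -/
def grpHom : G →* SkewGroupAlgebra G where
  toFun := grp
  map_one' := grp_one
  map_mul' g g' := (grp_mul_grp g g').symm

theorem single_eq_mul_grp (k : G) (a : TensorVV V) :
    (SkewMonoidAlgebra.single k a : SkewMonoidAlgebra (TensorVV V) G) =
      (tensorIncl G a * grp k : SkewGroupAlgebra G) := by
  refine Eq.symm ((SkewMonoidAlgebra.single_mul_single ..).trans ?_)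
  simp

/-- The skew group algebra is generated by `V`, `V*` and `G`, as an induction principle. -/
theorem skew_mem_of_generators {S : Set (SkewGroupAlgebra G)} (hvec : ∀ y, vec G y ∈ S)
    (hcovec : ∀ x, covec G x ∈ S) (hgrp : ∀ g : G, grp g ∈ S)
    (halg : ∀ r : ℂ, algebraMap ℂ _ r ∈ S) (hadd : ∀ a ∈ S, ∀ b ∈ S, a + b ∈ S)
    (hmul : ∀ a ∈ S, ∀ b ∈ S, a * b ∈ S) (a : SkewGroupAlgebra G) : a ∈ S := by
  have htensor : ∀ a, tensorIncl G a ∈ S := by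
    intro a
    induction a using TensorAlgebra.induction with
    | algebraMap r => rw [AlgHom.commutes]; exact halg r
    | ι p => obtain ⟨y, x⟩ := p; rw [tensorIncl_ι]; exact hadd _ (hvec y) _ (hcovec x)
    | mul a b ha hb => rw [map_mul]; exact hmul _ ha _ hb
    | add a b ha hb => rw [map_add]; exact hadd _ ha _ hb
  refine SkewMonoidAlgebra.induction_on (k := TensorVV V) (G := G) (p := fun a => a ∈ S) a ?_ ?_ ?_
  · have := halg 0
    rw [map_zero] at this
    exact this
  · intro k a
    rw [single_eq_mul_grp]
    exact hmul _ (htensor a) _ (hgrp k)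
  · exact fun a b ha hb => hadd a ha b hb

theorem reflectionSum_eq_sum [Finite G] (c : (V ≃ₗ[ℂ] V) → ℂ) (y : V) (x : Module.Dual ℂ V) :
    reflectionSum G c y x =
      ∑ s : Ref G, (c s * rootForm (s : V ≃ₗ[ℂ] V) y x) • grp (refElt s) :=
  finsum_eq_sum_of_fintype _

end Generators

namespace Realization

variable {V : Type u} [AddCommGroup V] [Module ℂ V]
  {G : Subgroup (V ≃ₗ[ℂ] V)} [Finite G] {c : (V ≃ₗ[ℂ] V) → ℂ}
  {R : Type v} [CommRing R] [Algebra ℂ R] {t : R} {H : Type w} [Ring H] [Algebra ℂ H]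
  [Algebra R H] (h : Realization G c t H)

/-- The homomorphism from the tensor algebra given by a realization. -/
def tensorHom : TensorVV V →ₐ[ℂ] H := TensorAlgebra.lift ℂ (h.vec.coprod h.covec)

theorem tensorHom_ι (p : V × Module.Dual ℂ V) :
    h.tensorHom (TensorAlgebra.ι ℂ p) = h.vec p.1 + h.covec p.2 :=
  TensorAlgebra.lift_ι_apply _ _

theorem grp_mul_tensorHom (g : G) (a : TensorVV V) :
    h.tensorHom (g • a) * h.grp g = h.grp g * h.tensorHom a := by
  show h.tensorHom (tensorAct (g : V ≃ₗ[ℂ] V) a) * h.grp g = h.grp g * h.tensorHom a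
  induction a using TensorAlgebra.induction with
  | algebraMap r => rw [AlgHom.commutes, AlgHom.commutes, Algebra.commutes]
  | ι p =>
    rw [tensorAct_ι, tensorHom_ι, tensorHom_ι, add_mul, mul_add, h.grp_mul_vec, h.grp_mul_covec]
  | mul a b ha hb => rw [map_mul, map_mul, map_mul, mul_assoc, hb, ← mul_assoc, ha, mul_assoc]
  | add a b ha hb => rw [map_add, map_add, map_add, add_mul, mul_add, ha, hb]

/-- The homomorphism from the skew group algebra given by a realization. -/
def skewHom : SkewGroupAlgebra G →ₐ[ℂ] H :=
  SkewMonoidAlgebra.liftNCAlgHom (k := ℂ) (A := TensorVV V) (G := G) (B := H)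
    h.tensorHom h.grp (fun {a} {g} => h.grp_mul_tensorHom g a)

theorem skewHom_single (g : G) (a : TensorVV V) :
    h.skewHom (SkewMonoidAlgebra.single g a : SkewMonoidAlgebra (TensorVV V) G) =
      h.tensorHom a * h.grp g :=
  SkewMonoidAlgebra.liftNC_single _ _ _ _

@[simp] theorem skewHom_vec (y : V) : h.skewHom (CalogeroMoser.vec G y) = h.vec y := by
  refine (h.skewHom_single 1 _).trans ?_
  rw [tensorHom_ι, map_one, mul_one, map_zero, add_zero]

@[simp] theorem skewHom_covec (x : Module.Dual ℂ V) :
    h.skewHom (CalogeroMoser.covec G x) = h.covec x := by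
  refine (h.skewHom_single 1 _).trans ?_
  rw [tensorHom_ι, map_one, mul_one, map_zero, zero_add]

@[simp] theorem skewHom_grp (g : G) : h.skewHom (CalogeroMoser.grp g) = h.grp g := by
  refine (h.skewHom_single g _).trans ?_
  rw [map_one, one_mul]

theorem skewHom_reflectionSum (y : V) (x : Module.Dual ℂ V) :
    h.skewHom (reflectionSum G c y x) =
      ∑ s : Ref G, (c s * rootForm (s : V ≃ₗ[ℂ] V) y x) • h.grp (refElt s) := by
  rw [reflectionSum_eq_sum, map_sum]
  refine Finset.sum_congr rfl fun s _ => ?_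
  rw [map_smul, skewHom_grp]

theorem skewHom_vec_vec (y y' : V) : h.skewHom (CalogeroMoser.vec G y * CalogeroMoser.vec G y' -
    CalogeroMoser.vec G y' * CalogeroMoser.vec G y) = 0 := by
  rw [map_sub, map_mul, map_mul, skewHom_vec, skewHom_vec, h.vec_mul_vec, sub_self]

theorem skewHom_covec_covec (x x' : Module.Dual ℂ V) :
    h.skewHom (CalogeroMoser.covec G x * CalogeroMoser.covec G x' -
      CalogeroMoser.covec G x' * CalogeroMoser.covec G x) = 0 := by
  rw [map_sub, map_mul, map_mul, skewHom_covec, skewHom_covec, h.covec_mul_covec, sub_self]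

theorem skewHom_vec_covec (y : V) (x : Module.Dual ℂ V) :
    h.skewHom (CalogeroMoser.vec G y * CalogeroMoser.covec G x -
      CalogeroMoser.covec G x * CalogeroMoser.vec G y) =
    algebraMap R H (x y • t) - h.skewHom (reflectionSum G c y x) := by
  rw [map_sub, map_mul, map_mul, skewHom_vec, skewHom_covec, h.vec_mul_covec,
    skewHom_reflectionSum]
  abel

end Realization

/-! ### The Cherednik algebra at a number -/

section AtNumber

variable {V : Type u} [AddCommGroup V] [Module ℂ V] (G : Subgroup (V ≃ₗ[ℂ] V)) [Finite G]
  (t : ℂ) (c : (V ≃ₗ[ℂ] V) → ℂ)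

theorem algebraMap_smul_eq {R H : Type*} [CommRing R] [Algebra ℂ R] [Ring H] [Algebra ℂ H]
    [Algebra R H] [IsScalarTower ℂ R H] (z : ℂ) (r : R) :
    algebraMap R H (z • r) = z • algebraMap R H r :=
  map_smul (IsScalarTower.toAlgHom ℂ R H) z r

/-- The tautological realization in the Cherednik algebra at the number `t`. -/
def cherednikRealization : Realization G c t (Cherednik G t c) where
  vec := (Cherednik.mk G t c).toLinearMap ∘ₗ vecLin G
  covec := (Cherednik.mk G t c).toLinearMap ∘ₗ covecLin G
  grp := ((Cherednik.mk G t c : _ →* Cherednik G t c)).comp (grpHom G)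
  grp_mul_vec g y := by
    show Cherednik.mk G t c (grp g) * Cherednik.mk G t c (vec G y) =
      Cherednik.mk G t c (vec G ((g : V ≃ₗ[ℂ] V) y)) * Cherednik.mk G t c (grp g)
    rw [← map_mul, grp_mul_vec, map_mul]
  grp_mul_covec g x := by
    show Cherednik.mk G t c (grp g) * Cherednik.mk G t c (covec G x) =
      Cherednik.mk G t c (covec G (dualAct (g : V ≃ₗ[ℂ] V) x)) * Cherednik.mk G t c (grp g)
    rw [← map_mul, grp_mul_covec, map_mul]
  vec_mul_vec y y' := by
    have := Cherednik.mk_vec_vec G t c y y'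
    rwa [map_sub, map_mul, map_mul, sub_eq_zero] at this
  covec_mul_covec x x' := by
    have := Cherednik.mk_covec_covec G t c x x'
    rwa [map_sub, map_mul, map_mul, sub_eq_zero] at this
  vec_mul_covec y x := by
    have := Cherednik.mk_vec_covec G t c y x
    rw [map_sub, map_sub, map_mul, map_mul, map_smul, AlgHom.commutes, ← algebraMap_smul_eq,
      reflectionSum_eq_sum, map_sum, sub_eq_iff_eq_add, add_comm, ← add_sub_assoc] at this
    simp only [map_smul] at this
    exact this

theorem cherednikRealization_adjoin :
    Algebra.adjoin ℂ (Set.range (cherednikRealization G t c).vec ∪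
      Set.range (cherednikRealization G t c).covec ∪
      Set.range (cherednikRealization G t c).grp) = ⊤ := by
  rw [eq_top_iff]
  rintro a -
  obtain ⟨a, rfl⟩ := Cherednik.mk_surjective G t c a
  set S := Algebra.adjoin ℂ (Set.range (cherednikRealization G t c).vec ∪
      Set.range (cherednikRealization G t c).covec ∪
      Set.range (cherednikRealization G t c).grp)
  exact skew_mem_of_generators G (S := {a | Cherednik.mk G t c a ∈ S})
    (fun y => Algebra.subset_adjoin (Or.inl (Or.inl ⟨y, rfl⟩)))
    (fun x => Algebra.subset_adjoin (Or.inl (Or.inr ⟨x, rfl⟩)))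
    (fun g => Algebra.subset_adjoin (Or.inr ⟨g, rfl⟩))
    (fun r => by
      show Cherednik.mk G t c _ ∈ S
      rw [AlgHom.commutes]; exact S.algebraMap_mem r)
    (fun a ha b hb => by
      show Cherednik.mk G t c _ ∈ S
      rw [map_add]; exact S.add_mem ha hb)
    (fun a ha b hb => by
      show Cherednik.mk G t c _ ∈ S
      rw [map_mul]; exact S.mul_mem ha hb) a

variable {G t c}

/-- The universal property of the Cherednik algebra at the number `t`. -/
def Realization.cherednikHom {H : Type w} [Ring H] [Algebra ℂ H] (h : Realization G c t H) :
    Cherednik G t c →ₐ[ℂ] H :=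
  RingQuot.liftAlgHom ℂ ⟨h.skewHom, by
    rintro _ _ (⟨y, y'⟩ | ⟨x, x'⟩ | ⟨y, x⟩)
    · exact (h.skewHom_vec_vec y y').trans (map_zero _).symm
    · exact (h.skewHom_covec_covec x x').trans (map_zero _).symm
    · refine (h.skewHom_vec_covec y x).trans ?_
      rw [map_sub, map_smul h.skewHom, AlgHom.commutes h.skewHom, algebraMap_smul_eq]
      rfl⟩

theorem Realization.cherednikHom_mk {H : Type w} [Ring H] [Algebra ℂ H]
    (h : Realization G c t H) (a : SkewGroupAlgebra G) :
    h.cherednikHom (Cherednik.mk G t c a) = h.skewHom a :=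
  RingQuot.liftAlgHom_mkAlgHom_apply _ _ _ _

variable [FiniteDimensional ℂ V] (t)

/-- The representation of the Cherednik algebra by Dunkl operators. -/
def cherednikRep (hc : IsConjInvariant G c) : Cherednik G t c →ₐ[ℂ] DunklEnd ℂ G :=
  (dunklRealization t hc).cherednikHom

/-- The Poincaré–Birkhoff–Witt theorem at a number. -/
theorem cherednik_pbw_bijective (hc : IsConjInvariant G c) :
    Function.Bijective ((cherednikRealization G t c).pbw : DunklModule ℂ G →ₗ[ℂ] _) :=
  (cherednikRealization G t c).pbw_bijective (cherednikRep t hc)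
    (fun y => ((dunklRealization t hc).cherednikHom_mk _).trans (Realization.skewHom_vec _ y))
    (fun x => ((dunklRealization t hc).cherednikHom_mk _).trans (Realization.skewHom_covec _ x))
    (fun g => ((dunklRealization t hc).cherednikHom_mk _).trans (Realization.skewHom_grp _ g))
    (cherednikRealization_adjoin G t c)

end AtNumber

/-! ### The Cherednik algebra at an indeterminate parameter -/

section Generic

open Polynomial

variable {V : Type u} [AddCommGroup V] [Module ℂ V] (G : Subgroup (V ≃ₗ[ℂ] V))
  (c : (V ≃ₗ[ℂ] V) → ℂ)

theorem genericCherednik_mk_surjective : Function.Surjective (GenericCherednik.mk G c) :=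
  RingQuot.mkAlgHom_surjective ℂ _

theorem commute_map_algebraMap {A : Type*} [Ring A] [Algebra ℂ A] (f : ℂ[X]) (p : A[X]) :
    f.map (algebraMap ℂ A) * p = p * f.map (algebraMap ℂ A) := by
  induction f using Polynomial.induction_on' with
  | add f g hf hg => rw [Polynomial.map_add, add_mul, mul_add, hf, hg]
  | monomial n r =>
    rw [Polynomial.map_monomial, ← Polynomial.C_mul_X_pow_eq_monomial, mul_assoc,
      Polynomial.X_pow_mul, ← mul_assoc, ← mul_assoc]
    congr 1
    exact Algebra.commutes (A := A[X]) r p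

/-- The generic Cherednik algebra as an algebra over `ℂ[X]`, with `X` acting as `t`. -/
instance genericAlgebra : Algebra ℂ[X] (GenericCherednik G c) :=
  RingHom.toAlgebra' ((GenericCherednik.mk G c : _ →+* GenericCherednik G c).comp
    (Polynomial.mapRingHom (algebraMap ℂ (SkewGroupAlgebra G)))) (by
      intro f a
      obtain ⟨p, rfl⟩ := genericCherednik_mk_surjective G c a
      show GenericCherednik.mk G c (f.map _) * GenericCherednik.mk G c p =
        GenericCherednik.mk G c p * GenericCherednik.mk G c (f.map _)
      rw [← map_mul, ← map_mul, commute_map_algebraMap])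

theorem algebraMap_generic (f : ℂ[X]) : algebraMap ℂ[X] (GenericCherednik G c) f =
    GenericCherednik.mk G c (f.map (algebraMap ℂ (SkewGroupAlgebra G))) := rfl

theorem algebraMap_generic_X : algebraMap ℂ[X] (GenericCherednik G c) X = tVar G c := by
  rw [algebraMap_generic, Polynomial.map_X]
  rfl

instance genericScalarTower : IsScalarTower ℂ ℂ[X] (GenericCherednik G c) :=
  IsScalarTower.of_algebraMap_eq fun r => by
    rw [Polynomial.algebraMap_eq, algebraMap_generic, Polynomial.map_C]
    exact (AlgHom.commutes (GenericCherednik.mk G c) r).symm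

/-- The map from the skew group algebra to the generic Cherednik algebra. -/
def genericIncl : SkewGroupAlgebra G →ₐ[ℂ] GenericCherednik G c :=
  (GenericCherednik.mk G c).comp Polynomial.CAlgHom

theorem genericIncl_vec_vec (y y' : V) :
    genericIncl G c (vec G y * vec G y' - vec G y' * vec G y) = 0 :=
  (RingQuot.mkAlgHom_rel ℂ (CherednikRel.vec_vec (c := c)
    (j := (Polynomial.CAlgHom : SkewGroupAlgebra G →ₐ[ℂ] _)) (t := X) y y')).trans (map_zero _)

theorem genericIncl_covec_covec (x x' : Module.Dual ℂ V) :
    genericIncl G c (covec G x * covec G x' - covec G x' * covec G x) = 0 :=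
  (RingQuot.mkAlgHom_rel ℂ (CherednikRel.covec_covec (c := c)
    (j := (Polynomial.CAlgHom : SkewGroupAlgebra G →ₐ[ℂ] _)) (t := X) x x')).trans (map_zero _)

theorem genericIncl_vec_covec (y : V) (x : Module.Dual ℂ V) :
    genericIncl G c (vec G y * covec G x - covec G x * vec G y) =
      x y • tVar G c - genericIncl G c (reflectionSum G c y x) := by
  refine (RingQuot.mkAlgHom_rel ℂ (CherednikRel.vec_covec (c := c)
    (j := (Polynomial.CAlgHom : SkewGroupAlgebra G →ₐ[ℂ] _)) (t := X) y x)).trans ?_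
  exact (map_sub (GenericCherednik.mk G c) _ _).trans
    (congrArg (· - _) (map_smul (GenericCherednik.mk G c) _ _))

variable [Finite G]

/-- The tautological realization in the generic Cherednik algebra. -/
def genericRealization : Realization G c (X : ℂ[X]) (GenericCherednik G c) where
  vec := (genericIncl G c).toLinearMap ∘ₗ vecLin G
  covec := (genericIncl G c).toLinearMap ∘ₗ covecLin G
  grp := ((genericIncl G c : _ →* GenericCherednik G c)).comp (grpHom G)
  grp_mul_vec g y := by
    show genericIncl G c (grp g) * genericIncl G c (vec G y) =
      genericIncl G c (vec G ((g : V ≃ₗ[ℂ] V) y)) * genericIncl G c (grp g)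
    rw [← map_mul, grp_mul_vec, map_mul]
  grp_mul_covec g x := by
    show genericIncl G c (grp g) * genericIncl G c (covec G x) =
      genericIncl G c (covec G (dualAct (g : V ≃ₗ[ℂ] V) x)) * genericIncl G c (grp g)
    rw [← map_mul, grp_mul_covec, map_mul]
  vec_mul_vec y y' := by
    have := genericIncl_vec_vec G c y y'
    rwa [map_sub, map_mul, map_mul, sub_eq_zero] at this
  covec_mul_covec x x' := by
    have := genericIncl_covec_covec G c x x'
    rwa [map_sub, map_mul, map_mul, sub_eq_zero] at this
  vec_mul_covec y x := by
    have := genericIncl_vec_covec G c y x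
    rw [map_sub, map_mul, map_mul, ← algebraMap_generic_X, ← algebraMap_smul_eq,
      reflectionSum_eq_sum, map_sum, sub_eq_iff_eq_add, add_comm, ← add_sub_assoc] at this
    simp only [map_smul] at this
    exact this

theorem genericRealization_adjoin :
    Algebra.adjoin ℂ[X] (Set.range (genericRealization G c).vec ∪
      Set.range (genericRealization G c).covec ∪
      Set.range (genericRealization G c).grp) = ⊤ := by
  rw [eq_top_iff]
  rintro a -
  obtain ⟨p, rfl⟩ := genericCherednik_mk_surjective G c a
  set S := Algebra.adjoin ℂ[X] (Set.range (genericRealization G c).vec ∪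
      Set.range (genericRealization G c).covec ∪
      Set.range (genericRealization G c).grp)
  have hS : ∀ a, genericIncl G c a ∈ S := fun a =>
    skew_mem_of_generators G (S := {a | genericIncl G c a ∈ S})
      (fun y => Algebra.subset_adjoin (Or.inl (Or.inl ⟨y, rfl⟩)))
      (fun x => Algebra.subset_adjoin (Or.inl (Or.inr ⟨x, rfl⟩)))
      (fun g => Algebra.subset_adjoin (Or.inr ⟨g, rfl⟩))
      (fun r => by
        show genericIncl G c _ ∈ S
        rw [AlgHom.commutes, IsScalarTower.algebraMap_apply ℂ ℂ[X]]
        exact S.algebraMap_mem _)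
      (fun a ha b hb => by
        show genericIncl G c _ ∈ S
        rw [map_add]; exact S.add_mem ha hb)
      (fun a ha b hb => by
        show genericIncl G c _ ∈ S
        rw [map_mul]; exact S.mul_mem ha hb) a
  have hX : GenericCherednik.mk G c X ∈ S := by
    have := S.algebraMap_mem X
    rwa [algebraMap_generic_X] at this
  induction p using Polynomial.induction_on' with
  | add p q hp hq => rw [map_add]; exact S.add_mem hp hq
  | monomial n a =>
    rw [← Polynomial.C_mul_X_pow_eq_monomial, map_mul, map_pow]
    exact S.mul_mem (hS a) (S.pow_mem hX n)

variable {G c}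

/-- The universal property of the generic Cherednik algebra. -/
def Realization.genericHom {H : Type w} [Ring H] [Algebra ℂ H] [Algebra ℂ[X] H]
    [IsScalarTower ℂ ℂ[X] H] (h : Realization G c (X : ℂ[X]) H) :
    GenericCherednik G c →+* H :=
  RingQuot.lift ⟨Polynomial.eval₂RingHom' (h.skewHom : SkewGroupAlgebra G →+* H)
    (algebraMap ℂ[X] H X) (fun a => (Algebra.commutes X (h.skewHom a)).symm), by
    rintro _ _ (⟨y, y'⟩ | ⟨x, x'⟩ | ⟨y, x⟩)
    · show Polynomial.eval₂ _ _ (Polynomial.C _) = Polynomial.eval₂ _ _ 0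
      rw [Polynomial.eval₂_C, Polynomial.eval₂_zero]
      exact h.skewHom_vec_vec y y'
    · show Polynomial.eval₂ _ _ (Polynomial.C _) = Polynomial.eval₂ _ _ 0
      rw [Polynomial.eval₂_C, Polynomial.eval₂_zero]
      exact h.skewHom_covec_covec x x'
    · show Polynomial.eval₂ _ _ (Polynomial.C _) =
        Polynomial.eval₂ _ _ (x y • X - Polynomial.C _)
      rw [Polynomial.eval₂_C, Polynomial.eval₂_sub, Polynomial.eval₂_C]
      refine (h.skewHom_vec_covec y x).trans ?_
      congr 1
      have : (x y • X : (SkewGroupAlgebra G)[X]) = Polynomial.C (algebraMap ℂ _ (x y)) * X :=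
        Algebra.smul_def (A := (SkewGroupAlgebra G)[X]) (x y) X
      rw [this, Polynomial.eval₂_mul_X, Polynomial.eval₂_C, algebraMap_smul_eq]
      refine (Algebra.smul_def _ _).trans ?_
      congr 1
      exact (AlgHom.commutes h.skewHom _).symm⟩

theorem Realization.genericHom_mk {H : Type w} [Ring H] [Algebra ℂ H] [Algebra ℂ[X] H]
    [IsScalarTower ℂ ℂ[X] H] (h : Realization G c (X : ℂ[X]) H) (p : (SkewGroupAlgebra G)[X]) :
    h.genericHom (GenericCherednik.mk G c p) =
      Polynomial.eval₂ (h.skewHom : SkewGroupAlgebra G →+* H) (algebraMap ℂ[X] H X) p := by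
  have h2 : GenericCherednik.mk G c p = RingQuot.mkRingHom _ p :=
    congrArg (fun f => f p) (RingQuot.mkAlgHom_coe ℂ (CherednikRel
      (B := Polynomial (SkewGroupAlgebra G)) G c Polynomial.CAlgHom Polynomial.X))
  rw [h2]
  exact RingQuot.lift_mkRingHom_apply _ _ _

theorem Realization.genericHom_incl {H : Type w} [Ring H] [Algebra ℂ H] [Algebra ℂ[X] H]
    [IsScalarTower ℂ ℂ[X] H] (h : Realization G c (X : ℂ[X]) H) (a : SkewGroupAlgebra G) :
    h.genericHom (genericIncl G c a) = h.skewHom a :=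
  (h.genericHom_mk _).trans (Polynomial.eval₂_C _ _)

theorem Realization.genericHom_tVar {H : Type w} [Ring H] [Algebra ℂ H] [Algebra ℂ[X] H]
    [IsScalarTower ℂ ℂ[X] H] (h : Realization G c (X : ℂ[X]) H) :
    h.genericHom (tVar G c) = algebraMap ℂ[X] H X :=
  (h.genericHom_mk _).trans (Polynomial.eval₂_X _ _)

/-- `Realization.genericHom` as a homomorphism of `ℂ[X]`-algebras. -/
def Realization.genericAlgHom {H : Type w} [Ring H] [Algebra ℂ H] [Algebra ℂ[X] H]
    [IsScalarTower ℂ ℂ[X] H] (h : Realization G c (X : ℂ[X]) H) :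
    GenericCherednik G c →ₐ[ℂ[X]] H :=
  { h.genericHom with
    commutes' := fun f => by
      show h.genericHom (algebraMap ℂ[X] _ f) = algebraMap ℂ[X] H f
      have : (h.genericHom.comp (algebraMap ℂ[X] (GenericCherednik G c))) = algebraMap ℂ[X] H := by
        apply Polynomial.ringHom_ext
        · intro r
          rw [RingHom.comp_apply, algebraMap_generic, Polynomial.map_C]
          refine (h.genericHom_incl (algebraMap ℂ _ r)).trans ?_
          rw [AlgHom.commutes]
          exact IsScalarTower.algebraMap_apply ℂ ℂ[X] H r
        · rw [RingHom.comp_apply, algebraMap_generic_X, genericHom_tVar]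
      exact congrArg (fun k => k f) this }

/-- The Poincaré–Birkhoff–Witt theorem at an indeterminate parameter. -/
theorem generic_pbw_bijective [FiniteDimensional ℂ V] (hc : IsConjInvariant G c) :
    Function.Bijective ((genericRealization G c).pbw : DunklModule ℂ[X] G →ₗ[ℂ[X]] _) :=
  (genericRealization G c).pbw_bijective (dunklRealization X hc).genericAlgHom
    (fun y => ((dunklRealization X hc).genericHom_incl _).trans (Realization.skewHom_vec _ y))
    (fun x => ((dunklRealization X hc).genericHom_incl _).trans (Realization.skewHom_covec _ x))
    (fun g => ((dunklRealization X hc).genericHom_incl _).trans (Realization.skewHom_grp _ g))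
    (genericRealization_adjoin G c)

theorem tVar_mul_eq_smul (a : GenericCherednik G c) : tVar G c * a = (X : ℂ[X]) • a := by
  rw [Algebra.smul_def, algebraMap_generic_X]

/-- The indeterminate `t` is not a zero divisor, since by the Poincaré–Birkhoff–Witt theorem the
generic algebra is free over `ℂ[X]`. -/
theorem eq_zero_of_tVar_mul [FiniteDimensional ℂ V] (hc : IsConjInvariant G c)
    {a : GenericCherednik G c} (ha : tVar G c * a = 0) : a = 0 := by
  obtain ⟨m, rfl⟩ := (generic_pbw_bijective hc).2 a
  rw [tVar_mul_eq_smul, ← map_smul] at ha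
  have hm : (X : ℂ[X]) • m = 0 := (generic_pbw_bijective hc).1 (ha.trans (map_zero _).symm)
  have : m = 0 := by
    ext1 g
    have hg := congrArg (fun f => f g) hm
    simp only [Finsupp.smul_apply, Finsupp.coe_zero, Pi.zero_apply] at hg
    rw [Algebra.smul_def] at hg
    rcases mul_eq_zero.mp hg with h0 | h0
    · exfalso
      exact Polynomial.X_ne_zero (MvPolynomial.C_injective _ _
        ((MvPolynomial.C_injective _ _ (h0.trans (map_zero _).symm)).trans (map_zero _).symm))
    · exact h0
  rw [this, map_zero]

end Generic

/-! ### The support of a central element -/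

section Support

variable {V : Type u} [AddCommGroup V] [Module ℂ V] [FiniteDimensional ℂ V]
  {G : Subgroup (V ≃ₗ[ℂ] V)} [Finite G]

/-- Right multiplication by `y`, transported along the Poincaré–Birkhoff–Witt map. -/
def rightVec {R : Type v} [CommRing R] [Algebra ℂ R] (y : V) :
    DunklModule R G →ₗ[R] DunklModule R G :=
  Finsupp.lsum R fun g => Finsupp.lsingle g ∘ₗ
    LinearMap.mulLeft R (yLin R ((g : V ≃ₗ[ℂ] V) y))

theorem rightVec_single {R : Type v} [CommRing R] [Algebra ℂ R] (y : V) (g : G)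
    (q : PhasePoly R V) : rightVec y (Finsupp.single g q : DunklModule R G) =
      Finsupp.single g (yLin R ((g : V ≃ₗ[ℂ] V) y) * q) := by
  rw [rightVec, Finsupp.lsum_single]
  rfl

theorem rightVec_apply {R : Type v} [CommRing R] [Algebra ℂ R] (y : V) (m : DunklModule R G)
    (g : G) : rightVec y m g = yLin R ((g : V ≃ₗ[ℂ] V) y) * m g := by
  classical
  induction m using Finsupp.induction_linear with
  | zero => rw [map_zero, Finsupp.zero_apply, mul_zero]
  | add m m' hm hm' => rw [map_add, Finsupp.add_apply, Finsupp.add_apply, hm, hm', mul_add]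
  | single h q =>
    rw [rightVec_single, Finsupp.single_apply, Finsupp.single_apply]
    split_ifs with hgh
    · rw [hgh]
    · rw [mul_zero]

theorem Realization.pbw_mul_vec {R : Type v} [CommRing R] [Algebra ℂ R] {t : R} {H : Type w}
    [Ring H] [Algebra ℂ H] [Algebra R H] [IsScalarTower ℂ R H] {c : (V ≃ₗ[ℂ] V) → ℂ}
    (h : Realization G c t H) (y : V) (m : DunklModule R G) :
    h.pbw m * h.vec y = h.pbw (rightVec y m) := by
  induction m using Finsupp.induction_linear with
  | zero => rw [map_zero, map_zero, map_zero, zero_mul]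
  | add m m' hm hm' => rw [map_add, map_add, map_add, add_mul, hm, hm']
  | single g q =>
    rw [rightVec_single, h.pbw_single, h.pbw_single, h.order_yLin_mul, mul_assoc, mul_assoc,
      h.grp_mul_vec]

/-- The coefficient at `g` of the action of `y` at `t = 0`. -/
theorem dunklOp_zero_apply (c : (V ≃ₗ[ℂ] V) → ℂ) (y : V) (m : DunklModule ℂ G) (g : G) :
    (dunklOp G (0 : ℂ) c y • m) g = yLin ℂ y * m g -
      ∑ s : Ref G, (c s * (rootDatum s).form y) • theta ℂ (rootDatum s) (m ((refElt s)⁻¹ * g)) := by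
  classical
  induction m using Finsupp.induction_linear with
  | zero => simp
  | add m m' hm hm' =>
    simp only [smul_add, Finsupp.add_apply, hm, hm', mul_add, map_add, Finset.sum_add_distrib]
    abel
  | single h q =>
    rw [dunklOp_single, zero_smul, add_zero, Finsupp.sub_apply, Finsupp.finsetSum_apply]
    congr 1
    · rw [Finsupp.single_apply, Finsupp.single_apply]
      split_ifs
      · rfl
      · rw [mul_zero]
    · refine Finset.sum_congr rfl fun s _ => ?_
      rw [Finsupp.smul_apply, Finsupp.single_apply, Finsupp.single_apply]
      by_cases hs : refElt s * h = g
      · rw [if_pos hs, if_pos (by rw [← hs, inv_mul_cancel_left])]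
      · rw [if_neg hs, if_neg (fun h0 => hs (by rw [h0, mul_inv_cancel_left])), map_zero]

/-- If `m` commutes with `V` and `c` is supported on `K`, then `m` is supported on `K`. For `g ∉ K`
choose `y` with `g y ≠ y`. Comparing coefficients, `(y - g y) m_g` is a combination of divided
differences of the `m_{s⁻¹ g}` with `s ∈ K`, which have smaller degree in the `x`, and `s⁻¹ g` is
again outside `K`. So a bound on the degrees of the `m_g` with `g ∉ K` can be lowered until
they vanish. -/
theorem eq_zero_of_dunklOp_eq_rightVec {K : Subgroup (V ≃ₗ[ℂ] V)} {c : (V ≃ₗ[ℂ] V) → ℂ}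
    (hcK : ∀ s : Ref G, c s ≠ 0 → (s : V ≃ₗ[ℂ] V) ∈ K) {m : DunklModule ℂ G}
    (hm : ∀ y, dunklOp G (0 : ℂ) c y • m = rightVec y m) (g : G) (hg : (g : V ≃ₗ[ℂ] V) ∉ K) :
    m g = 0 := by
  have key : ∀ (g : G), (g : V ≃ₗ[ℂ] V) ∉ K → ∃ a : SymPoly ℂ V, a ≠ 0 ∧ ∃ y : V,
      MvPolynomial.C a * m g = ∑ s : Ref G, (c s * (rootDatum s).form y) •
        theta ℂ (rootDatum s) (m ((refElt s)⁻¹ * g)) := by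
    intro g hg
    -- `g` is not the identity, as it lies outside `K`.
    obtain ⟨y, hy⟩ : ∃ y, (g : V ≃ₗ[ℂ] V) y ≠ y := by
      by_contra! h
      exact hg (by rw [show (g : V ≃ₗ[ℂ] V) = 1 from LinearEquiv.ext h]; exact K.one_mem)
    refine ⟨lin ℂ (y - (g : V ≃ₗ[ℂ] V) y), fun h => hy ?_, y, ?_⟩
    · exact (sub_eq_zero.mp ((lin_eq_zero_iff ℂ).mp h)).symm
    · have := congrArg (fun f => f g) (hm y)
      simp only [dunklOp_zero_apply, rightVec_apply] at this
      rw [map_sub, map_sub, sub_mul, sub_eq_iff_eq_add]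
      rw [sub_eq_iff_eq_add] at this
      rw [this]
      exact add_comm _ _
  have hmem : ∀ (g : G) (s : Ref G), (g : V ≃ₗ[ℂ] V) ∉ K → c s ≠ 0 →
      (((refElt s)⁻¹ * g : G) : V ≃ₗ[ℂ] V) ∉ K := by
    intro g s hg hs h
    exact hg ((K.mul_mem_cancel_left (K.inv_mem (hcK s hs))).mp h)
  have step : ∀ n, (∀ g : G, (g : V ≃ₗ[ℂ] V) ∉ K → (m g).totalDegree ≤ n) →
      ∀ g : G, (g : V ≃ₗ[ℂ] V) ∉ K → m g = 0 := by
    intro n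
    induction n with
    | zero =>
      intro h g hg
      obtain ⟨a, ha, y, hy⟩ := key g hg
      rw [Finset.sum_eq_zero] at hy
      · exact (mul_eq_zero.mp hy).resolve_left fun h0 =>
          ha (MvPolynomial.C_injective _ _ (h0.trans (map_zero _).symm))
      · intro s _
        by_cases hs : c s = 0
        · rw [hs, zero_mul, zero_smul]
        · rcases totalDegree_theta_lt (rootDatum s) (h _ (hmem g s hg hs)) with h0 | h0
          · rw [h0, smul_zero]
          · exact absurd h0 (Nat.not_lt_zero _)
    | succ n ih =>
      intro h
      refine ih fun g hg => ?_
      obtain ⟨a, ha, y, hy⟩ := key g hg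
      by_cases h0 : m g = 0
      · rw [h0, MvPolynomial.totalDegree_zero]; exact Nat.zero_le _
      have hC : (MvPolynomial.C a : PhasePoly ℂ V) ≠ 0 := fun h0 =>
          ha (MvPolynomial.C_injective _ _ (h0.trans (map_zero _).symm))
      have h1 := MvPolynomial.totalDegree_mul_of_isDomain hC h0
      rw [MvPolynomial.totalDegree_C, zero_add] at h1
      rw [← h1, hy, ← MvPolynomial.mem_restrictTotalDegree]
      refine Submodule.sum_mem _ fun s _ => ?_
      by_cases hs : c s = 0
      · rw [hs, zero_mul, zero_smul]
        exact Submodule.zero_mem _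
      refine Submodule.smul_of_tower_mem _ _ ?_
      rw [MvPolynomial.mem_restrictTotalDegree]
      rcases totalDegree_theta_lt (rootDatum s) (h _ (hmem g s hg hs)) with h1 | h1
      · rw [h1, MvPolynomial.totalDegree_zero]
        exact Nat.zero_le _
      · exact Nat.lt_succ_iff.mp h1
  exact step _ (fun g _ => Finset.le_sup (f := fun g => (m g).totalDegree)
    (s := (Set.toFinite (Set.univ : Set G)).toFinset) (by simp)) g hg

end Support

/-! ### The centre of `H_c(W)` inside `H_c(K)` -/

section Inclusion

variable {V : Type u} [AddCommGroup V] [Module ℂ V] {W K : Subgroup (V ≃ₗ[ℂ] V)}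
  {c : (V ≃ₗ[ℂ] V) → ℂ}

theorem IsEquivariant.isConjInvariant (hKW : K ≤ W) (hc : IsEquivariant W K c) :
    IsConjInvariant K c := fun g hg s hs => hc g (hKW hg) s hs

theorem conj_mem_ref (hKW : K ≤ W) [hn : (K.subgroupOf W).Normal] {g s : V ≃ₗ[ℂ] V} (hg : g ∈ W)
    (hs : s ∈ Ref K) : g * s * g⁻¹ ∈ Ref K :=
  ref_conj_mem hs (hn.conj_mem ⟨s, hKW hs.1⟩ hs.1 ⟨g, hg⟩)

theorem IsEquivariant.extendByZero (hKW : K ≤ W) [(K.subgroupOf W).Normal]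
    (hc : IsEquivariant W K c) : IsConjInvariant W (extendByZero K c) := by
  intro g hg s hs
  by_cases h : s ∈ Ref K
  · rw [CalogeroMoser.extendByZero, Set.indicator_of_mem h,
      Set.indicator_of_mem (conj_mem_ref hKW hg h), hc g hg s h]
  · have h' : g * s * g⁻¹ ∉ Ref K := fun h1 => h (by
      have h2 := conj_mem_ref hKW (W.inv_mem hg) h1
      have h3 : g⁻¹ * (g * s * g⁻¹) * g⁻¹⁻¹ = s := by group
      rwa [h3] at h2)
    rw [CalogeroMoser.extendByZero, Set.indicator_of_notMem h, Set.indicator_of_notMem h']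

variable [FiniteDimensional ℂ V] [Finite K] [Finite W] (hKW : K ≤ W)

theorem inclusionMap_vec (y : V) :
    inclusionMap hKW c ((cherednikRealization K 0 c).vec y) =
      (cherednikRealization W 0 (extendByZero K c)).vec y := by
  refine (cherednikMap_mk _ _ _ _ _ _).trans ?_
  rw [vecLin_apply, skewMap_vec]
  rfl

theorem inclusionMap_covec (x : Module.Dual ℂ V) :
    inclusionMap hKW c ((cherednikRealization K 0 c).covec x) =
      (cherednikRealization W 0 (extendByZero K c)).covec x := by
  refine (cherednikMap_mk _ _ _ _ _ _).trans ?_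
  rw [covecLin_apply, skewMap_covec]
  rfl

theorem inclusionMap_grp (k : K) :
    inclusionMap hKW c ((cherednikRealization K 0 c).grp k) =
      (cherednikRealization W 0 (extendByZero K c)).grp (Subgroup.inclusion hKW k) :=
  (cherednikMap_mk _ _ _ _ _ _).trans (congrArg _ (skewMap_grp _ _ _ k))

theorem inclusionMap_order (q : PhasePoly ℂ V) :
    inclusionMap hKW c ((cherednikRealization K 0 c).order q) =
      (cherednikRealization W 0 (extendByZero K c)).order q := by
  induction q using phasePoly_induction with
  | const p =>
    induction p using symPoly_induction with
    | const r => rw [Realization.order_C_C, Realization.order_C_C, AlgHom.commutes]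
    | add p q hp hq => rw [map_add, map_add, map_add, map_add, hp, hq]
    | lin_mul u p hp =>
      rw [MvPolynomial.C_mul, Realization.order_yLin_mul, Realization.order_yLin_mul, map_mul, hp,
        inclusionMap_vec]
  | add p q hp hq => rw [map_add, map_add, map_add, hp, hq]
  | xLin_mul x p hp =>
    rw [Realization.order_xLin_mul, Realization.order_xLin_mul, map_mul, hp, inclusionMap_covec]

/-- In Poincaré–Birkhoff–Witt coordinates the map `H_c(K) → H_c(W)` extends functions on `K` by
zero to `W`. -/
theorem inclusionMap_pbw (m : DunklModule ℂ K) :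
    inclusionMap hKW c ((cherednikRealization K 0 c).pbw m) =
      (cherednikRealization W 0 (extendByZero K c)).pbw
        (m.mapDomain (Subgroup.inclusion hKW)) := by
  induction m using Finsupp.induction_linear with
  | zero => rw [Finsupp.mapDomain_zero, map_zero, map_zero, map_zero]
  | add m m' hm hm' => rw [Finsupp.mapDomain_add, map_add, map_add, map_add, hm, hm']
  | single g q =>
    rw [Finsupp.mapDomain_single, Realization.pbw_single, Realization.pbw_single, map_mul,
      inclusionMap_order, inclusionMap_grp]

variable [hn : (K.subgroupOf W).Normal] (hc : IsEquivariant W K c)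

include hc

theorem inclusionMap_injective : Function.Injective (inclusionMap hKW c) := by
  intro a b hab
  obtain ⟨m, rfl⟩ := (cherednik_pbw_bijective 0 (hc.isConjInvariant hKW)).2 a
  obtain ⟨m', rfl⟩ := (cherednik_pbw_bijective 0 (hc.isConjInvariant hKW)).2 b
  rw [inclusionMap_pbw, inclusionMap_pbw] at hab
  rw [Finsupp.mapDomain_injective (Subgroup.inclusion_injective hKW)
    ((cherednik_pbw_bijective 0 (hc.extendByZero hKW)).1 hab)]

/-- A central element of `H_c(W)` lies in `H_c(K)`, since its coefficients outside `K` vanish. -/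
theorem exists_inclusionMap_eq_of_mem_centre {z : Cherednik W 0 (extendByZero K c)}
    (hz : z ∈ centre W (extendByZero K c)) : ∃ a, inclusionMap hKW c a = z := by
  have hcW := hc.extendByZero hKW
  obtain ⟨m, rfl⟩ := (cherednik_pbw_bijective 0 hcW).2 z
  have hm : ∀ y, dunklOp W (0 : ℂ) (extendByZero K c) y • m = rightVec y m := by
    intro y
    apply (cherednik_pbw_bijective 0 hcW).1
    rw [Realization.pbw_dunklOp_smul, ← Realization.pbw_mul_vec]
    exact (Subalgebra.mem_center_iff.mp hz _)
  have h0 := eq_zero_of_dunklOp_eq_rightVec (K := K) (fun s hs => by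
    by_contra h
    exact hs (Set.indicator_of_notMem (fun h1 => h (mem_of_mem_ref h1)) _)) hm
  refine ⟨(cherednikRealization K 0 c).pbw
    (m.comapDomain (Subgroup.inclusion hKW) (Subgroup.inclusion_injective hKW).injOn), ?_⟩
  rw [inclusionMap_pbw, Finsupp.mapDomain_comapDomain _ (Subgroup.inclusion_injective hKW)]
  intro g hg
  by_contra h
  exact Finsupp.mem_support_iff.mp hg (h0 g fun hgK => h ⟨⟨g, hgK⟩, rfl⟩)

/-- The action of `W` on `H_c(K)` is conjugation inside `H_c(W)`. -/
theorem grp_mul_inclusionMap (w : W) (a : Cherednik K 0 c) :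
    (cherednikRealization W 0 (extendByZero K c)).grp w * inclusionMap hKW c a =
      inclusionMap hKW c (act hKW hc w a) *
        (cherednikRealization W 0 (extendByZero K c)).grp w := by
  set h := cherednikRealization W 0 (extendByZero K c)
  have ha : a ∈ Algebra.adjoin ℂ (Set.range (cherednikRealization K 0 c).vec ∪
      Set.range (cherednikRealization K 0 c).covec ∪
      Set.range (cherednikRealization K 0 c).grp) := by
    rw [cherednikRealization_adjoin]; exact Algebra.mem_top
  induction ha using Algebra.adjoin_induction with
  | mem a ha =>
    rcases ha with (⟨y, rfl⟩ | ⟨x, rfl⟩) | ⟨k, rfl⟩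
    · have : act hKW hc w ((cherednikRealization K 0 c).vec y) =
          (cherednikRealization K 0 c).vec ((w : V ≃ₗ[ℂ] V) y) :=
        (cherednikMap_mk _ _ _ _ _ _).trans (congrArg _ (skewMap_vec _ _ _ y))
      rw [this, inclusionMap_vec, inclusionMap_vec, h.grp_mul_vec]
    · have : act hKW hc w ((cherednikRealization K 0 c).covec x) =
          (cherednikRealization K 0 c).covec (dualAct (w : V ≃ₗ[ℂ] V) x) :=
        (cherednikMap_mk _ _ _ _ _ _).trans (congrArg _ (skewMap_covec _ _ _ x))
      rw [this, inclusionMap_covec, inclusionMap_covec, h.grp_mul_covec]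
    · have : act hKW hc w ((cherednikRealization K 0 c).grp k) =
          (cherednikRealization K 0 c).grp (conjHom hKW w k) :=
        (cherednikMap_mk _ _ _ _ _ _).trans (congrArg _ (skewMap_grp _ _ _ k))
      rw [this, inclusionMap_grp, inclusionMap_grp, ← map_mul, ← map_mul]
      congr 1
      apply Subtype.ext
      show (w : V ≃ₗ[ℂ] V) * k = w * k * (w : V ≃ₗ[ℂ] V)⁻¹ * w
      rw [inv_mul_cancel_right]
  | algebraMap r => rw [AlgEquiv.commutes, AlgHom.commutes, Algebra.commutes]
  | add a b _ _ ha hb => rw [map_add, map_add, map_add, mul_add, add_mul, ha, hb]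
  | mul a b _ _ ha hb => rw [map_mul, map_mul, map_mul, ← mul_assoc, ha, mul_assoc, hb, mul_assoc]

theorem mem_centre_inclusionMap_iff (a : Cherednik K 0 c) :
    inclusionMap hKW c a ∈ centre W (extendByZero K c) ↔
      a ∈ centre K c ∧ ∀ w, act hKW hc w a = a := by
  set h := cherednikRealization W 0 (extendByZero K c)
  constructor
  · intro ha
    rw [Subalgebra.mem_center_iff] at ha
    refine ⟨Subalgebra.mem_center_iff.mpr fun b => ?_, fun w => ?_⟩
    · apply inclusionMap_injective hKW hc
      rw [map_mul, map_mul, ha]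
    · apply inclusionMap_injective hKW hc
      have h1 := grp_mul_inclusionMap hKW hc w a
      rw [ha] at h1
      have h2 := congrArg (· * h.grp w⁻¹) h1
      simp only [mul_assoc] at h2
      rw [← map_mul, mul_inv_cancel, map_one, mul_one, mul_one] at h2
      exact h2.symm
  · rintro ⟨ha, hw⟩
    rw [Subalgebra.mem_center_iff] at ha
    have hcomm : ∀ b, inclusionMap hKW c b * inclusionMap hKW c a =
        inclusionMap hKW c a * inclusionMap hKW c b := fun b => by
      rw [← map_mul, ← map_mul, ha]
    rw [Subalgebra.mem_center_iff]
    intro b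
    have hb : b ∈ Algebra.adjoin ℂ (Set.range h.vec ∪ Set.range h.covec ∪ Set.range h.grp) := by
      rw [cherednikRealization_adjoin]; exact Algebra.mem_top
    induction hb using Algebra.adjoin_induction with
    | mem b hb =>
      rcases hb with (⟨y, rfl⟩ | ⟨x, rfl⟩) | ⟨w, rfl⟩
      · rw [← inclusionMap_vec hKW, hcomm]
      · rw [← inclusionMap_covec hKW, hcomm]
      · rw [grp_mul_inclusionMap hKW hc, hw]
    | algebraMap r => rw [Algebra.commutes]
    | add b b' _ _ hb hb' => rw [mul_add, add_mul, hb, hb']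
    | mul b b' _ _ hb hb' => rw [mul_assoc, hb', ← mul_assoc, hb, mul_assoc]

theorem mem_gammaInvariants_iff (z : centre K c) :
    z ∈ gammaInvariants hKW hc ↔ ∀ w, act hKW hc w z = z := by
  constructor
  · intro h w
    exact congrArg Subtype.val (h (QuotientGroup.mk w))
  · intro h γ
    obtain ⟨w, rfl⟩ := QuotientGroup.mk_surjective γ
    exact Subtype.ext (h w)

theorem centre_eq_map_gammaInvariants : centre W (extendByZero K c) =
    (gammaInvariants hKW hc).map ((inclusionMap hKW c).comp (centre K c).val) := by
  ext z
  rw [Subalgebra.mem_map]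
  constructor
  · intro hz
    obtain ⟨a, rfl⟩ := exists_inclusionMap_eq_of_mem_centre hKW hc hz
    obtain ⟨ha, hw⟩ := (mem_centre_inclusionMap_iff hKW hc a).mp hz
    exact ⟨⟨a, ha⟩, (mem_gammaInvariants_iff hKW hc _).mpr hw, rfl⟩
  · rintro ⟨a, ha, rfl⟩
    exact (mem_centre_inclusionMap_iff hKW hc a).mpr
      ⟨a.2, (mem_gammaInvariants_iff hKW hc _).mp ha⟩

theorem exists_centre_embedding : ∃ j : centre W (extendByZero K c) →ₐ[ℂ] centre K c,
    (∀ z, inclusionMap hKW c (j z) = z) ∧ j.range = gammaInvariants hKW hc := by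
  have hinj : Function.Injective ((inclusionMap hKW c).comp (centre K c).val) :=
    (inclusionMap_injective hKW hc).comp Subtype.val_injective
  have hex : ∀ z : centre W (extendByZero K c), ∃ a ∈ gammaInvariants hKW hc,
      (inclusionMap hKW c).comp (centre K c).val a = z := fun z =>
    Subalgebra.mem_map.mp ((centre_eq_map_gammaInvariants hKW hc).le z.2)
  choose f hf hfz using hex
  refine ⟨
    { toFun := f
      map_one' := hinj (by rw [hfz, map_one]; rfl)
      map_mul' := fun a b => hinj (by rw [map_mul, hfz, hfz, hfz]; rfl)
      map_zero' := hinj (by rw [hfz, map_zero]; rfl)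
      map_add' := fun a b => hinj (by rw [map_add, hfz, hfz, hfz]; rfl)
      commutes' := fun r => hinj (by rw [hfz, AlgHom.commutes]; rfl) }, hfz, ?_⟩
  ext a
  rw [AlgHom.mem_range]
  constructor
  · rintro ⟨z, rfl⟩
    exact hf z
  · intro ha
    have hz : inclusionMap hKW c a ∈ centre W (extendByZero K c) := by
      rw [centre_eq_map_gammaInvariants hKW hc, Subalgebra.mem_map]
      exact ⟨a, ha, rfl⟩
    exact ⟨⟨_, hz⟩, hinj (hfz ⟨_, hz⟩)⟩

end Inclusion

/-! ### Specialization at `t = 0` -/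

section Specialization

open Polynomial

variable {V : Type u} [AddCommGroup V] [Module ℂ V] {G : Subgroup (V ≃ₗ[ℂ] V)}
  {c : (V ≃ₗ[ℂ] V) → ℂ}

theorem tVar_mul_comm (a : GenericCherednik G c) : a * tVar G c = tVar G c * a := by
  rw [← algebraMap_generic_X, Algebra.commutes]

theorem specialize_genericIncl (a : SkewGroupAlgebra G) :
    specialize G c (genericIncl G c a) = Cherednik.mk G 0 c a :=
  (specialize_mk G c _).trans (congrArg _ Polynomial.coeff_C_zero)

theorem specialize_surjective : Function.Surjective (specialize G c) := fun a => by
  obtain ⟨a, rfl⟩ := Cherednik.mk_surjective G 0 c a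
  exact ⟨_, specialize_genericIncl a⟩

theorem specialize_tVar : specialize G c (tVar G c) = 0 := by
  rw [tVar, specialize_mk, Polynomial.coeff_X_zero, map_zero]

theorem specialize_smul (r : ℂ) (a : GenericCherednik G c) :
    specialize G c (r • a) = r • specialize G c a := by
  have h : algebraMap ℂ (GenericCherednik G c) r = genericIncl G c (algebraMap ℂ _ r) :=
    (AlgHom.commutes _ _).symm
  rw [Algebra.smul_def, map_mul, h, specialize_genericIncl, AlgHom.commutes, ← Algebra.smul_def]

/-- The kernel of specialization is generated by `t`: dividing the generic algebra by `t` yields an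
algebra with the relations at `t = 0`, so that specialization has an inverse on this
quotient. -/
theorem specialize_eq_zero_iff {a : GenericCherednik G c} :
    specialize G c a = 0 ↔ ∃ b, a = tVar G c * b := by
  constructor
  · intro ha
    let I : Ideal (GenericCherednik G c) := Ideal.span {tVar G c}
    have hI : I.IsTwoSided := ⟨fun {a} b ha => by
      obtain ⟨d, rfl⟩ := Ideal.mem_span_singleton'.mp ha
      exact Ideal.mem_span_singleton'.mpr ⟨d * b, by rw [mul_assoc, tVar_mul_comm, mul_assoc]⟩⟩
    have ht : Ideal.Quotient.mk I (tVar G c) = 0 :=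
      Ideal.Quotient.eq_zero_iff_mem.mpr (Ideal.mem_span_singleton_self _)
    let f : SkewGroupAlgebra G →+* GenericCherednik G c ⧸ I :=
      (Ideal.Quotient.mk I).comp (genericIncl G c : _ →+* GenericCherednik G c)
    have hf : ∀ a, f a = Ideal.Quotient.mk I (genericIncl G c a) := fun a => rfl
    -- The inverse of specialization modulo `t`.
    let φ : Cherednik G 0 c →+* GenericCherednik G c ⧸ I := RingQuot.lift ⟨f, by
      rintro _ _ (⟨y, y'⟩ | ⟨x, x'⟩ | ⟨y, x⟩)
      · refine (congrArg (Ideal.Quotient.mk I) (genericIncl_vec_vec G c y y')).trans ?_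
        rw [map_zero, map_zero]
      · refine (congrArg (Ideal.Quotient.mk I) (genericIncl_covec_covec G c x x')).trans ?_
        rw [map_zero, map_zero]
      · refine (congrArg (Ideal.Quotient.mk I) (genericIncl_vec_covec G c y x)).trans ?_
        rw [map_zero, smul_zero, zero_sub, map_neg, map_sub, Algebra.smul_def, map_mul, ht,
          mul_zero, zero_sub]
        rfl⟩
    have hφ : ∀ b, φ (Cherednik.mk G 0 c b) = f b := fun b => by
      have h2 : Cherednik.mk G 0 c b = RingQuot.mkRingHom _ b :=
        congrArg (fun f => f b) (RingQuot.mkAlgHom_coe ℂ (CherednikRel G c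
          (AlgHom.id ℂ (SkewGroupAlgebra G)) (algebraMap ℂ _ 0)))
      rw [h2]
      exact RingQuot.lift_mkRingHom_apply _ _ _
    obtain ⟨p, rfl⟩ := genericCherednik_mk_surjective G c a
    rw [specialize_mk] at ha
    -- Modulo `t` only the constant coefficient of `p` survives.
    have hp : Ideal.Quotient.mk I (GenericCherednik.mk G c p) = f (p.coeff 0) := by
      conv_lhs => rw [← Polynomial.divX_mul_X_add p]
      rw [map_add, map_mul, map_add, map_mul]
      have : Ideal.Quotient.mk I (GenericCherednik.mk G c X) = 0 := ht
      rw [this, mul_zero, zero_add]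
      rfl
    rw [← hφ, ha, map_zero] at hp
    obtain ⟨b, hb⟩ := Ideal.mem_span_singleton'.mp (Ideal.Quotient.eq_zero_iff_mem.mp hp)
    exact ⟨b, by rw [← hb, tVar_mul_comm]⟩
  · rintro ⟨b, rfl⟩
    rw [map_mul, specialize_tVar, zero_mul]

end Specialization

/-! ### The Poisson bracket on the centre -/

section Poisson

variable {V : Type u} [AddCommGroup V] [Module ℂ V] {G : Subgroup (V ≃ₗ[ℂ] V)}
  {c : (V ≃ₗ[ℂ] V) → ℂ}

/-- The commutator with a lift of a central element is divisible by `t`. -/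
theorem exists_commutator_eq {a : GenericCherednik G c} (ha : specialize G c a ∈ centre G c)
    (b : GenericCherednik G c) : ∃ h, a * b - b * a = tVar G c * h := by
  apply specialize_eq_zero_iff.mp
  rw [map_sub, map_mul, map_mul, Subalgebra.mem_center_iff.mp ha, sub_self]

variable [FiniteDimensional ℂ V] [Finite G] (hc : IsConjInvariant G c)

include hc

theorem tVar_mul_cancel {a b : GenericCherednik G c} (h : tVar G c * a = tVar G c * b) :
    a = b := by
  rw [← sub_eq_zero]
  apply eq_zero_of_tVar_mul hc
  rw [mul_sub, h, sub_self]

/-- The bracket of central elements is central: by the Jacobi identity its commutator with `b` is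
a combination of commutators of the lifts with other elements, which vanish at `t = 0`. -/
theorem IsBracketValue.mem_centre {z₁ z₂ : centre G c} {u : Cherednik G 0 c}
    (hu : IsBracketValue z₁ z₂ u) : u ∈ centre G c := by
  obtain ⟨a₁, a₂, h, h₁, h₂, hh, rfl⟩ := hu
  rw [Subalgebra.mem_center_iff]
  intro b
  obtain ⟨b, rfl⟩ := specialize_surjective b
  obtain ⟨r₁, hr₁⟩ := exists_commutator_eq (h₁ ▸ z₁.2) b
  obtain ⟨r₂, hr₂⟩ := exists_commutator_eq (h₂ ▸ z₂.2) b
  have key : b * h - h * b = (a₂ * r₁ - r₁ * a₂) - (a₁ * r₂ - r₂ * a₁) := by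
    apply tVar_mul_cancel hc
    have e1 : tVar G c * (b * h - h * b) = b * (tVar G c * h) - tVar G c * h * b := by
      rw [mul_sub, ← mul_assoc, ← tVar_mul_comm b, mul_assoc, mul_assoc]
    have e2 : ∀ a r : GenericCherednik G c, tVar G c * (a * r - r * a) =
        a * (tVar G c * r) - tVar G c * r * a := fun a r => by
      rw [mul_sub, ← mul_assoc, ← tVar_mul_comm a, mul_assoc, mul_assoc]
    rw [e1, mul_sub, e2, e2, ← hh, ← hr₁, ← hr₂]
    noncomm_ring
  rw [← sub_eq_zero, ← map_mul, ← map_mul, ← map_sub, key]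
  simp only [map_sub, map_mul, h₁, h₂]
  rw [Subalgebra.mem_center_iff.mp z₁.2, Subalgebra.mem_center_iff.mp z₂.2]
  simp

/-- The bracket does not depend on the lifts: changing them by multiples of `t` changes the
quotient of the commutator by commutators with lifts of central elements. -/
theorem IsBracketValue.unique {z₁ z₂ : centre G c} {u u' : Cherednik G 0 c}
    (hu : IsBracketValue z₁ z₂ u) (hu' : IsBracketValue z₁ z₂ u') : u = u' := by
  obtain ⟨a₁, a₂, h, h₁, h₂, hh, rfl⟩ := hu
  obtain ⟨b₁, b₂, k, k₁, k₂, hk, rfl⟩ := hu'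
  obtain ⟨d₁, hd₁⟩ := specialize_eq_zero_iff.mp
    (show specialize G c (a₁ - b₁) = 0 by rw [map_sub, h₁, k₁, sub_self])
  obtain ⟨d₂, hd₂⟩ := specialize_eq_zero_iff.mp
    (show specialize G c (a₂ - b₂) = 0 by rw [map_sub, h₂, k₂, sub_self])
  have key : h - k = (d₁ * a₂ - a₂ * d₁) + (b₁ * d₂ - d₂ * b₁) := by
    apply tVar_mul_cancel hc
    have e1 : tVar G c * (d₁ * a₂ - a₂ * d₁) = tVar G c * d₁ * a₂ - a₂ * (tVar G c * d₁) := by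
      rw [mul_sub, ← mul_assoc, ← mul_assoc, ← tVar_mul_comm a₂, mul_assoc a₂]
    have e2 : tVar G c * (b₁ * d₂ - d₂ * b₁) = b₁ * (tVar G c * d₂) - tVar G c * d₂ * b₁ := by
      rw [mul_sub, ← mul_assoc, ← mul_assoc, ← tVar_mul_comm b₁, mul_assoc b₁]
    rw [mul_add, mul_sub, e1, e2, ← hh, ← hk, ← hd₁, ← hd₂]
    noncomm_ring
  rw [← sub_eq_zero, ← map_sub, key]
  simp only [map_sub, map_add, map_mul, h₂, k₁]
  rw [Subalgebra.mem_center_iff.mp z₁.2, Subalgebra.mem_center_iff.mp z₂.2]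
  simp

omit [FiniteDimensional ℂ V] [Finite G] hc in
theorem exists_isBracketValue (z₁ z₂ : centre G c) : ∃ u, IsBracketValue z₁ z₂ u := by
  obtain ⟨a₁, h₁⟩ := specialize_surjective (z₁ : Cherednik G 0 c)
  obtain ⟨a₂, h₂⟩ := specialize_surjective (z₂ : Cherednik G 0 c)
  obtain ⟨h, hh⟩ := exists_commutator_eq (h₁ ▸ z₁.2) a₂
  exact ⟨_, a₁, a₂, h, h₁, h₂, hh, rfl⟩

theorem isBracketValue_bracket (z₁ z₂ : centre G c) :
    IsBracketValue z₁ z₂ (bracket z₁ z₂ : centre G c) := by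
  have : ∃ u : centre G c, IsBracketValue z₁ z₂ u := by
    obtain ⟨u, hu⟩ := exists_isBracketValue z₁ z₂
    exact ⟨⟨u, hu.mem_centre hc⟩, hu⟩
  rw [bracket, dif_pos this]
  exact this.choose_spec

theorem isBracketValue_iff (z₁ z₂ : centre G c) (u : Cherednik G 0 c) :
    IsBracketValue z₁ z₂ u ↔ u = (bracket z₁ z₂ : centre G c) :=
  ⟨fun h => h.unique hc (isBracketValue_bracket hc z₁ z₂),
    fun h => h ▸ isBracketValue_bracket hc z₁ z₂⟩

theorem coe_bracket_eq {z₁ z₂ : centre G c} {a₁ a₂ h : GenericCherednik G c}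
    (h₁ : specialize G c a₁ = z₁) (h₂ : specialize G c a₂ = z₂)
    (hh : a₁ * a₂ - a₂ * a₁ = tVar G c * h) :
    ((bracket z₁ z₂ : centre G c) : Cherednik G 0 c) = specialize G c h :=
  ((isBracketValue_iff hc z₁ z₂ _).mp ⟨a₁, a₂, h, h₁, h₂, hh, rfl⟩).symm

/-- The identities of a Poisson bracket hold for commutators, and pass to the quotients by `t`
because `t` is not a zero divisor. -/
theorem isPoissonBracket_bracket : IsPoissonBracket (bracket (G := G) (c := c)) := by
  have lift : ∀ z : centre G c, ∃ a, specialize G c a = z := fun z => specialize_surjective _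
  have comm : ∀ (z : centre G c) {a : GenericCherednik G c} (_ : specialize G c a = z)
      (b : GenericCherednik G c), ∃ h, a * b - b * a = tVar G c * h :=
    fun z a ha b => exists_commutator_eq (ha ▸ z.2) b
  have left : ∀ a b : GenericCherednik G c, a * (tVar G c * b) = tVar G c * (a * b) :=
    fun a b => by rw [← mul_assoc, tVar_mul_comm, mul_assoc]
  have self : ∀ x : centre G c, bracket x x = 0 := fun x => by
    obtain ⟨a, ha⟩ := lift x
    apply Subtype.ext
    rw [coe_bracket_eq hc ha ha (h := 0) (by rw [sub_self, mul_zero]), map_zero]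
    rfl
  have antisymm : ∀ x y : centre G c, bracket x y = -bracket y x := fun x y => by
    obtain ⟨a, ha⟩ := lift x
    obtain ⟨b, hb⟩ := lift y
    obtain ⟨h, hh⟩ := comm x ha b
    apply Subtype.ext
    rw [coe_bracket_eq hc ha hb hh]
    show _ = -((bracket y x : centre G c) : Cherednik G 0 c)
    rw [coe_bracket_eq hc hb ha (h := -h) (by rw [mul_neg, ← hh, neg_sub]), map_neg, neg_neg]
  refine ⟨fun x y z => ?_, fun r x y => ?_, self, antisymm, fun x y z => ?_, fun x y z => ?_⟩
  · obtain ⟨a, ha⟩ := lift x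
    obtain ⟨b, hb⟩ := lift y
    obtain ⟨d, hd⟩ := lift z
    obtain ⟨h, hh⟩ := comm x ha d
    obtain ⟨k, hk⟩ := comm y hb d
    apply Subtype.ext
    show _ = ((bracket x z : centre G c) : Cherednik G 0 c) + (bracket y z : centre G c)
    rw [coe_bracket_eq hc (a₁ := a + b) (by rw [map_add, ha, hb]; rfl) hd (h := h + k)
      (by rw [mul_add (tVar G c), ← hh, ← hk]; noncomm_ring), map_add, coe_bracket_eq hc ha hd hh,
      coe_bracket_eq hc hb hd hk]
  · obtain ⟨a, ha⟩ := lift x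
    obtain ⟨b, hb⟩ := lift y
    obtain ⟨h, hh⟩ := comm x ha b
    apply Subtype.ext
    show _ = r • ((bracket x y : centre G c) : Cherednik G 0 c)
    rw [coe_bracket_eq hc (a₁ := r • a) (by rw [specialize_smul, ha]; rfl) hb (h := r • h)
      (by rw [mul_smul_comm r (tVar G c), ← hh, smul_sub, smul_mul_assoc, mul_smul_comm]),
      specialize_smul, coe_bracket_eq hc ha hb hh]
  · obtain ⟨a, ha⟩ := lift x
    obtain ⟨b, hb⟩ := lift y
    obtain ⟨d, hd⟩ := lift z
    obtain ⟨h₁, hh₁⟩ := comm y hb d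
    obtain ⟨h₂, hh₂⟩ := comm z hd a
    obtain ⟨h₃, hh₃⟩ := comm x ha b
    obtain ⟨k₁, hk₁⟩ := comm x ha h₁
    obtain ⟨k₂, hk₂⟩ := comm y hb h₂
    obtain ⟨k₃, hk₃⟩ := comm z hd h₃
    have key : k₁ + k₂ + k₃ = 0 := by
      apply eq_zero_of_tVar_mul hc
      apply eq_zero_of_tVar_mul hc
      have e : ∀ a h : GenericCherednik G c, tVar G c * (a * h - h * a) =
          a * (tVar G c * h) - tVar G c * h * a := fun a h => by
        rw [mul_sub, left, mul_assoc]
      rw [mul_add (tVar G c) (k₁ + k₂), mul_add (tVar G c) k₁, ← hk₁, ← hk₂, ← hk₃,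
        mul_add (tVar G c), mul_add (tVar G c), e, e, e, ← hh₁, ← hh₂, ← hh₃]
      noncomm_ring
    apply Subtype.ext
    show ((bracket x (bracket y z) : centre G c) : Cherednik G 0 c) +
      (bracket y (bracket z x) : centre G c) + (bracket z (bracket x y) : centre G c) = 0
    rw [coe_bracket_eq hc ha (coe_bracket_eq hc hb hd hh₁).symm hk₁,
      coe_bracket_eq hc hb (coe_bracket_eq hc hd ha hh₂).symm hk₂,
      coe_bracket_eq hc hd (coe_bracket_eq hc ha hb hh₃).symm hk₃, ← map_add, ← map_add, key,
      map_zero]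
  · obtain ⟨a, ha⟩ := lift x
    obtain ⟨b, hb⟩ := lift y
    obtain ⟨d, hd⟩ := lift z
    obtain ⟨h, hh⟩ := comm x ha b
    obtain ⟨k, hk⟩ := comm x ha d
    apply Subtype.ext
    show _ = ((bracket x y : centre G c) : Cherednik G 0 c) * z +
      y * ((bracket x z : centre G c) : Cherednik G 0 c)
    rw [coe_bracket_eq hc (a₂ := b * d) ha (by rw [map_mul, hb, hd]; rfl) (h := h * d + b * k)
      (by rw [mul_add (tVar G c), ← mul_assoc (tVar G c), ← left, ← hh, ← hk]; noncomm_ring),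
      map_add, map_mul, map_mul, coe_bracket_eq hc ha hb hh, coe_bracket_eq hc ha hd hk, hb, hd]

theorem hasPoissonStructure : HasPoissonStructure G c :=
  ⟨isBracketValue_iff hc, isPoissonBracket_bracket hc⟩

end Poisson

/-! ### Compatibility of the brackets -/

section GenericInclusion

variable {V : Type u} [AddCommGroup V] [Module ℂ V] {W K : Subgroup (V ≃ₗ[ℂ] V)} [Finite K]
  (hKW : K ≤ W) (c : (V ≃ₗ[ℂ] V) → ℂ)

/-- The inclusion of the skew group algebra of `K` in that of `W`. -/
abbrev skewInclusion : SkewGroupAlgebra K →ₐ[ℂ] SkewGroupAlgebra W :=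
  skewMap 1 (Subgroup.inclusion hKW) (fun k => by simp)

/-- The map `H_c(K) → H_c(W)` at an indeterminate parameter, which lifts `inclusionMap`. -/
def genericInclusion : GenericCherednik K c →+* GenericCherednik W (extendByZero K c) :=
  RingQuot.lift ⟨(GenericCherednik.mk W (extendByZero K c) : _ →+* _).comp
      (Polynomial.mapRingHom (skewInclusion hKW : SkewGroupAlgebra K →+* SkewGroupAlgebra W)), by
    have hC : ∀ a, (GenericCherednik.mk W (extendByZero K c)) (Polynomial.mapRingHom
        (skewInclusion hKW : SkewGroupAlgebra K →+* SkewGroupAlgebra W) (Polynomial.C a)) =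
        genericIncl W (extendByZero K c) (skewInclusion hKW a) := fun a => by
      rw [Polynomial.coe_mapRingHom, Polynomial.map_C]
      rfl
    rintro _ _ (⟨y, y'⟩ | ⟨x, x'⟩ | ⟨y, x⟩)
    · refine (hC _).trans ?_
      rw [map_zero, map_sub, map_mul, map_mul, skewMap_vec, skewMap_vec]
      exact genericIncl_vec_vec _ _ _ _
    · refine (hC _).trans ?_
      rw [map_zero, map_sub, map_mul, map_mul, skewMap_covec, skewMap_covec]
      exact genericIncl_covec_covec _ _ _ _
    · refine (hC _).trans ?_
      rw [map_sub, map_mul, map_mul, skewMap_vec, skewMap_covec]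
      refine (genericIncl_vec_covec _ _ _ _).trans ?_
      rw [map_sub]
      congr 1
      · have h1 : (x y • Polynomial.X : Polynomial (SkewGroupAlgebra K)) =
            Polynomial.C (algebraMap ℂ _ (x y)) * Polynomial.X :=
          Algebra.smul_def (A := Polynomial (SkewGroupAlgebra K)) (x y) Polynomial.X
        rw [RingHom.comp_apply, h1, map_mul, map_mul]
        refine (Algebra.smul_def _ _).trans (congrArg₂ (· * ·) ?_ ?_)
        · refine Eq.trans ?_ (hC _).symm
          rw [AlgHom.commutes, AlgHom.commutes]
          rfl
        · rw [Polynomial.coe_mapRingHom, Polynomial.map_X]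
          rfl
      · rw [← skewMap_inclusion_reflectionSum hKW]
        exact (hC _).symm⟩

theorem genericInclusion_mk (p : Polynomial (SkewGroupAlgebra K)) :
    genericInclusion hKW c (GenericCherednik.mk K c p) =
      GenericCherednik.mk W (extendByZero K c)
        (p.map (skewInclusion hKW : SkewGroupAlgebra K →+* SkewGroupAlgebra W)) := by
  have h2 : GenericCherednik.mk K c p = RingQuot.mkRingHom _ p :=
    congrArg (fun f => f p) (RingQuot.mkAlgHom_coe ℂ (CherednikRel
      (B := Polynomial (SkewGroupAlgebra K)) K c Polynomial.CAlgHom Polynomial.X))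
  rw [h2]
  exact RingQuot.lift_mkRingHom_apply _ _ _

theorem genericInclusion_tVar :
    genericInclusion hKW c (tVar K c) = tVar W (extendByZero K c) := by
  rw [tVar, genericInclusion_mk, Polynomial.map_X]
  rfl

theorem specialize_genericInclusion (a : GenericCherednik K c) :
    specialize W (extendByZero K c) (genericInclusion hKW c a) =
      inclusionMap hKW c (specialize K c a) := by
  obtain ⟨p, rfl⟩ := genericCherednik_mk_surjective K c a
  rw [genericInclusion_mk, specialize_mk, specialize_mk, Polynomial.coeff_map]
  exact (cherednikMap_mk _ _ _ _ _ _).symm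

variable {c} [FiniteDimensional ℂ V] [Finite W] [(K.subgroupOf W).Normal]
  (hc : IsEquivariant W K c)

include hc

/-- Lifts in the generic algebra of `K` are sent by `genericInclusion` to lifts in that of `W`,
with the same quotient by `t` of their commutator. -/
theorem bracket_centre_embedding {j : centre W (extendByZero K c) →ₐ[ℂ] centre K c}
    (hj : ∀ z, inclusionMap hKW c (j z) = z) (z₁ z₂ : centre W (extendByZero K c)) :
    j (bracket z₁ z₂) = bracket (j z₁) (j z₂) := by
  obtain ⟨a₁, h₁⟩ := specialize_surjective (j z₁ : Cherednik K 0 c)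
  obtain ⟨a₂, h₂⟩ := specialize_surjective (j z₂ : Cherednik K 0 c)
  obtain ⟨h, hh⟩ := exists_commutator_eq (h₁ ▸ (j z₁).2) a₂
  apply Subtype.ext
  apply inclusionMap_injective hKW hc
  rw [hj, coe_bracket_eq (hc.isConjInvariant hKW) h₁ h₂ hh, ← specialize_genericInclusion]
  refine coe_bracket_eq (hc.extendByZero hKW) (a₁ := genericInclusion hKW c a₁)
    (a₂ := genericInclusion hKW c a₂) ?_ ?_ ?_
  · rw [specialize_genericInclusion, h₁, hj]
  · rw [specialize_genericInclusion, h₂, hj]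
  · rw [← map_mul, ← map_mul, ← map_sub, hh, map_mul, genericInclusion_tVar]

end GenericInclusion

/-! ### Quotients of affine schemes by finite groups -/

section Quotient

variable {R S : CommRingCat.{u}}

/-- The function on an open subset of `Spec R` given by an element of `R`. -/
def globalSec (R : CommRingCat.{u}) (U : (Spec R).Opens) : R →+* Γ(Spec R, U) :=
  algebraMap R Γ(Spec R, U)

lemma appLE_globalSec (φ : R ⟶ S) (U : (Spec R).Opens) (V : (Spec S).Opens)
    (h : V ≤ Spec.map φ ⁻¹ᵁ U) (r : R) :
    (Spec.map φ).appLE U V h (globalSec R U r) = globalSec S V (φ r) := by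
  simp only [globalSec, IsAffineOpen.algebraMap_Spec_obj, CommRingCat.hom_comp, RingHom.comp_apply]
  rw [← CommRingCat.comp_apply ((Spec R).presheaf.map _), Scheme.Hom.map_appLE,
    ← CommRingCat.comp_apply, ← CommRingCat.comp_apply φ, Scheme.ΓSpecIso_inv_naturality]
  rw [CommRingCat.comp_apply, CommRingCat.comp_apply]
  rfl

lemma isLocalization_globalSec (U : (Spec R).Opens) (r : R)
    (h : U = PrimeSpectrum.basicOpen r) : IsLocalization.Away r Γ(Spec R, U) := by
  subst h; infer_instance

lemma isUnit_globalSec (U : (Spec R).Opens) (r : R)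
    (h : U = PrimeSpectrum.basicOpen r) (n : ℕ) : IsUnit (globalSec R U (r ^ n)) := by
  have := isLocalization_globalSec U r h
  rw [map_pow]
  exact (IsLocalization.Away.algebraMap_isUnit r).pow n

lemma exists_mul_globalSec (U : (Spec R).Opens) (r : R)
    (h : U = PrimeSpectrum.basicOpen r) (z : Γ(Spec R, U)) :
    ∃ (n : ℕ) (b : R), z * globalSec R U (r ^ n) = globalSec R U b := by
  have := isLocalization_globalSec U r h
  obtain ⟨⟨b, ⟨_, n, rfl⟩⟩, hb⟩ := IsLocalization.surj (Submonoid.powers r) z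
  exact ⟨n, b, hb⟩

lemma exists_of_globalSec_eq (U : (Spec R).Opens) (r : R)
    (h : U = PrimeSpectrum.basicOpen r) {b b' : R} (e : globalSec R U b = globalSec R U b') :
    ∃ n : ℕ, r ^ n * b = r ^ n * b' := by
  have := isLocalization_globalSec U r h
  obtain ⟨⟨_, n, rfl⟩, hb⟩ := IsLocalization.exists_of_eq (M := Submonoid.powers r) e
  exact ⟨n, hb⟩

lemma map_appLE_apply {X Y : Scheme.{u}} (p : X ⟶ Y) {U U' : Y.Opens} {V : X.Opens} (i : U ⟶ U')
    (h : V ≤ p ⁻¹ᵁ U) (z : Γ(Y, U')) :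
    p.appLE U V h (Y.presheaf.map i.op z) =
      p.appLE U' V (h.trans (p.preimage_mono i.le)) z := by
  rw [← Scheme.Hom.map_appLE p h i.op, CommRingCat.comp_apply]

lemma appLE_map_apply {X Y : Scheme.{u}} (p : X ⟶ Y) {U : Y.Opens} {V V' : X.Opens} (i : V ⟶ V')
    (h : V' ≤ p ⁻¹ᵁ U) (z : Γ(Y, U)) :
    X.presheaf.map i.op (p.appLE U V' h z) = p.appLE U V (i.le.trans h) z := by
  rw [← Scheme.Hom.appLE_map p h i.op, CommRingCat.comp_apply]

/-- Every open subset of `Spec R` is covered by the basic open subsets it contains. -/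
lemma le_iSup_basicOpen (U : (Spec R).Opens) :
    U ≤ ⨆ a : {a : R // (PrimeSpectrum.basicOpen a : (Spec R).Opens) ≤ U},
      (PrimeSpectrum.basicOpen a.1 : (Spec R).Opens) := by
  intro x hx
  obtain ⟨_, ⟨a, rfl⟩, h1, h2⟩ :=
    PrimeSpectrum.isTopologicalBasis_basic_opens.exists_subset_of_mem_open hx U.2
  exact TopologicalSpace.Opens.mem_iSup.2 ⟨⟨a, h2⟩, h1⟩

variable {A B : CommRingCat.{u}} (f : A ⟶ B)

/-- Injectivity on sections can be checked on basic open subsets, where it is exactness of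
localization. -/
lemma specMap_app_injective (hf : Function.Injective f) (U : (Spec A).Opens) :
    Function.Injective ((Spec.map f).app U) := by
  have key : ∀ (D : (Spec A).Opens) (a : A), D = PrimeSpectrum.basicOpen a →
      ∀ z : Γ(Spec A, D), (Spec.map f).app D z = 0 → z = 0 := by
    intro D a hD z hz
    obtain ⟨n, b, hb⟩ := exists_mul_globalSec D a hD z
    have hfD : Spec.map f ⁻¹ᵁ D = PrimeSpectrum.basicOpen (f a) := by
      rw [hD]; exact SpecMap_preimage_basicOpen f a
    have h1 := congrArg ((Spec.map f).app D) hb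
    rw [map_mul, hz, zero_mul, Scheme.Hom.app_eq_appLE, appLE_globalSec] at h1
    obtain ⟨m, hm⟩ := exists_of_globalSec_eq _ _ hfD (h1.symm.trans (map_zero _).symm)
    have h2 : a ^ m * b = 0 := hf (by simpa using hm)
    have h3 : z * globalSec A D (a ^ n) * globalSec A D (a ^ m) = 0 := by
      rw [hb, ← map_mul, mul_comm, h2, map_zero]
    rwa [(isUnit_globalSec D a hD m).mul_left_eq_zero,
      (isUnit_globalSec D a hD n).mul_left_eq_zero] at h3
  rw [injective_iff_map_eq_zero]
  intro z hz
  have res : ∀ (D : (Spec A).Opens) (hD : D ≤ U),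
      (Spec.map f).app D ((Spec A).presheaf.map (homOfLE hD).op z) = 0 := by
    intro D hD
    rw [Scheme.Hom.app_eq_appLE, map_appLE_apply,
      ← appLE_map_apply (Spec.map f) (homOfLE ((Spec.map f).preimage_mono hD)) le_rfl,
      ← Scheme.Hom.app_eq_appLE, hz, map_zero]
  let ι := {a : A // (PrimeSpectrum.basicOpen a : (Spec A).Opens) ≤ U}
  refine (Spec A).sheaf.eq_of_locally_eq' (ι := ι)
    (fun a => (PrimeSpectrum.basicOpen a.1 : (Spec A).Opens)) U (fun a => homOfLE a.2)
    (le_iSup_basicOpen U) z 0 ?_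
  intro a
  rw [map_zero]
  exact key _ a.1 rfl _ (res _ a.2)

variable {G : Type*} [Group G] [Finite G] (σ : G → (B ⟶ B))

/-- Over a basic open subset an invariant function is a fraction with an invariant numerator:
a power of the denominator, common to all elements of the finite group, makes the numerator
invariant. -/
lemma exists_app_eq_of_basicOpen (hσ : ∀ g, f ≫ σ g = f)
    (hinv : ∀ b : B, (∀ g, σ g b = b) → ∃ a, f a = b) (D : (Spec A).Opens) (a : A)
    (hD : D = PrimeSpectrum.basicOpen a) (z : Γ(Spec B, Spec.map f ⁻¹ᵁ D))
    (hz : ∀ g (hg : Spec.map f ⁻¹ᵁ D ≤ Spec.map (σ g) ⁻¹ᵁ (Spec.map f ⁻¹ᵁ D)),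
      (Spec.map (σ g)).appLE _ _ hg z = z) :
    ∃ h, (Spec.map f).app D h = z := by
  have hfD : Spec.map f ⁻¹ᵁ D = PrimeSpectrum.basicOpen (f a) := by
    rw [hD]; exact SpecMap_preimage_basicOpen f a
  have hfa : ∀ g n, σ g (f a ^ n) = f a ^ n := fun g n => by
    rw [map_pow, ← CommRingCat.comp_apply, hσ]
  obtain ⟨n, b, hb⟩ := exists_mul_globalSec _ _ hfD z
  have hle : ∀ g, Spec.map f ⁻¹ᵁ D ≤ Spec.map (σ g) ⁻¹ᵁ (Spec.map f ⁻¹ᵁ D) := by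
    intro g
    rw [← Scheme.Hom.comp_preimage, ← Spec.map_comp, hσ]
  have h1 : ∀ g, ∃ m : ℕ, f a ^ m * σ g b = f a ^ m * b := by
    intro g
    refine exists_of_globalSec_eq _ _ hfD ?_
    have h2 := congrArg ((Spec.map (σ g)).appLE _ _ (hle g)) hb
    rw [map_mul, hz, appLE_globalSec, appLE_globalSec, hfa, hb] at h2
    exact h2.symm
  choose m hm using h1
  obtain ⟨M, hM⟩ := Finite.exists_le m
  obtain ⟨a', ha'⟩ := hinv (f a ^ M * b) fun g => by
    rw [map_mul, hfa]
    obtain ⟨k, rfl⟩ := Nat.exists_eq_add_of_le' (hM g)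
    rw [pow_add, mul_assoc, hm, mul_assoc]
  obtain ⟨v, hv⟩ := isUnit_globalSec D a hD (M + n)
  refine ⟨globalSec A D a' * ↑v⁻¹, ?_⟩
  rw [← (isUnit_globalSec _ _ hfD (M + n)).mul_left_inj]
  have h3 : (Spec.map f).app D (v : Γ(Spec A, D)) = globalSec B _ (f a ^ (M + n)) := by
    rw [hv, Scheme.Hom.app_eq_appLE, appLE_globalSec, map_pow]
  rw [← h3, ← map_mul, Units.inv_mul_cancel_right, h3, Scheme.Hom.app_eq_appLE, appLE_globalSec,
    ha', map_mul, ← hb, pow_add, map_mul]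
  ring

/-- Invariant functions on the preimage of an open subset `U` come from `U`: they do so over basic
open subsets, and the resulting functions agree on overlaps by injectivity. -/
lemma exists_app_eq (hf : Function.Injective f) (hσ : ∀ g, f ≫ σ g = f)
    (hinv : ∀ b : B, (∀ g, σ g b = b) → ∃ a, f a = b) (U : (Spec A).Opens)
    (z : Γ(Spec B, Spec.map f ⁻¹ᵁ U))
    (hz : ∀ g (hg : Spec.map f ⁻¹ᵁ U ≤ Spec.map (σ g) ⁻¹ᵁ (Spec.map f ⁻¹ᵁ U)),
      (Spec.map (σ g)).appLE _ _ hg z = z) :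
    ∃ h, (Spec.map f).app U h = z := by
  let ι := {a : A // (PrimeSpectrum.basicOpen a : (Spec A).Opens) ≤ U}
  let D : ι → (Spec A).Opens := fun a => PrimeSpectrum.basicOpen a.1
  have hle : ∀ (T : (Spec A).Opens) g,
      Spec.map f ⁻¹ᵁ T ≤ Spec.map (σ g) ⁻¹ᵁ (Spec.map f ⁻¹ᵁ T) := by
    intro T g
    rw [← Scheme.Hom.comp_preimage, ← Spec.map_comp, hσ]
  have hDU : ∀ i, Spec.map f ⁻¹ᵁ D i ≤ Spec.map f ⁻¹ᵁ U := fun i =>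
    (Spec.map f).preimage_mono i.2
  have loc : ∀ i : ι, ∃ h : Γ(Spec A, D i),
      (Spec.map f).app (D i) h = (Spec B).presheaf.map (homOfLE (hDU i)).op z := by
    intro i
    refine exists_app_eq_of_basicOpen f σ hσ hinv (D i) i.1 rfl _ fun g hg => ?_
    rw [map_appLE_apply, ← appLE_map_apply _ (homOfLE (hDU i)) (hle U g), hz]
  choose s hs using loc
  have hs' : ∀ i (T : (Spec A).Opens) (hT : T ≤ D i),
      (Spec.map f).app T ((Spec A).presheaf.map (homOfLE hT).op (s i)) =
        (Spec B).presheaf.map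
          (homOfLE (((Spec.map f).preimage_mono hT).trans (hDU i))).op z := by
    intro i T hT
    rw [Scheme.Hom.app_eq_appLE, map_appLE_apply,
      ← appLE_map_apply _ (homOfLE ((Spec.map f).preimage_mono hT)) le_rfl,
      ← Scheme.Hom.app_eq_appLE, hs, ← CommRingCat.comp_apply, ← Functor.map_comp]
    rfl
  obtain ⟨h, hh, -⟩ : ∃! h : Γ(Spec A, U), ∀ i : ι,
      (Spec A).presheaf.map (homOfLE i.2 : D i ⟶ U).op h = s i :=
    (Spec A).sheaf.existsUnique_gluing' D U (fun i => homOfLE i.2)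
    (le_iSup_basicOpen U) s (by
      intro i j
      apply specMap_app_injective f hf
      exact (hs' i _ inf_le_left).trans (hs' j _ inf_le_right).symm)
  refine ⟨h, ?_⟩
  refine (Spec B).sheaf.eq_of_locally_eq' (fun i => Spec.map f ⁻¹ᵁ D i) _
    (fun i => homOfLE (hDU i)) ?_ _ _ ?_
  · intro x hx
    obtain ⟨i, hi⟩ := TopologicalSpace.Opens.mem_iSup.1 (le_iSup_basicOpen U hx)
    exact TopologicalSpace.Opens.mem_iSup.2 ⟨i, hi⟩
  · intro i
    refine Eq.trans ?_ (hs i)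
    change (Spec B).presheaf.map (homOfLE (hDU i)).op _ = _
    rw [← hh, Scheme.Hom.app_eq_appLE, Scheme.Hom.app_eq_appLE, map_appLE_apply,
      appLE_map_apply]

end Quotient

section Affine

variable {A B : Type u} [CommRing A] [CommRing B] {G : Type*} [Group G] [Finite G]

/-- The spectrum of the ring of invariants of a finite group is the geometric quotient. The fibres
are orbits because the group acts transitively on the primes above a given one, and the map is a
closed surjection because it is integral and injective on rings. -/
lemma isGeometricQuotient_spec (f : A →+* B) (hf : Function.Injective f)
    (σ : G →* (B ≃+* B)) (hinv : ∀ b, (∃ a, f a = b) ↔ ∀ g, σ g b = b) :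
    IsGeometricQuotient
      (fun g => Spec.map (CommRingCat.ofHom ((σ g⁻¹ : B ≃+* B) : B →+* B)))
      (Spec.map (CommRingCat.ofHom f)) := by
  let := f.toAlgebra
  let : MulSemiringAction G B :=
    { smul := fun g b => σ g b
      one_smul := fun b => by change σ 1 b = b; rw [map_one]; rfl
      mul_smul := fun g h b => by change σ (g * h) b = σ g (σ h b); rw [map_mul]; rfl
      smul_zero := fun g => map_zero (σ g)
      smul_add := fun g => map_add (σ g)
      smul_one := fun g => map_one (σ g)
      smul_mul := fun g => map_mul (σ g) }
  have hσf : ∀ g a, σ g (f a) = f a := fun g a => (hinv _).1 ⟨a, rfl⟩ g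
  have : SMulCommClass G A B := ⟨fun g a b => by
    rw [Algebra.smul_def, Algebra.smul_def]
    change σ g (f a * b) = f a * σ g b
    rw [map_mul, hσf]⟩
  have : Algebra.IsInvariant A B G := ⟨fun b hb => (hinv b).2 hb⟩
  have hint : f.IsIntegral := (Algebra.IsInvariant.isIntegral A B G).isIntegral
  have hcomp : ∀ g : G, CommRingCat.ofHom f ≫
      CommRingCat.ofHom ((σ g⁻¹ : B ≃+* B) : B →+* B) = CommRingCat.ofHom f := by
    intro g
    ext a
    exact hσf _ _
  have hπ : ∀ g : G, Spec.map (CommRingCat.ofHom ((σ g⁻¹ : B ≃+* B) : B →+* B)) ≫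
      Spec.map (CommRingCat.ofHom f) = Spec.map (CommRingCat.ofHom f) := by
    intro g
    rw [← Spec.map_comp, hcomp]
  refine ⟨hπ, ?_, ?_, specMap_app_injective _ hf, ?_⟩
  · intro x x'
    constructor
    · intro h
      have := x.isPrime
      have := x'.isPrime
      obtain ⟨g, hg⟩ := Algebra.IsInvariant.exists_smul_of_under_eq A B G
        (PrimeSpectrum.asIdeal x) (PrimeSpectrum.asIdeal x')
        (congrArg PrimeSpectrum.asIdeal h)
      refine ⟨g, PrimeSpectrum.ext ?_⟩
      rw [hg]
      ext b
      exact (Ideal.mem_pointwise_smul_iff_inv_smul_mem (a := g) (S := x.asIdeal) (x := b)).symm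
    · rintro ⟨g, rfl⟩
      rw [← Scheme.Hom.comp_apply, hπ]
  · exact (PrimeSpectrum.isClosedMap_comap_of_isIntegral f hint).isQuotientMap
      (PrimeSpectrum.continuous_comap f) (hint.comap_surjective hf)
  · intro U z
    constructor
    · rintro ⟨h, rfl⟩ g hg
      rw [Scheme.Hom.app_eq_appLE, ← CommRingCat.comp_apply, Scheme.Hom.appLE_comp_appLE]
      simp only [hπ]
    · intro hz
      exact exists_app_eq _ (fun g : G => CommRingCat.ofHom ((σ g⁻¹ : B ≃+* B) : B →+* B)) hf
        hcomp (fun b hb => (hinv b).2 fun g => by simpa using hb g⁻¹) U z hz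

end Affine

end CalogeroMoser

end

open CalogeroMoser

theorem mainTheorem10 {V : Type*} [AddCommGroup V] [Module ℂ V] [FiniteDimensional ℂ V]
    (W K : Subgroup (V ≃ₗ[ℂ] V)) [Finite K]
    (hW : IsComplexReflectionGroup W) (hirr : IsIrreducibleGroup W)
    (hK : IsComplexReflectionGroup K) (hKW : K ≤ W) [(K.subgroupOf W).Normal]
    (c : (V ≃ₗ[ℂ] V) → ℂ) (hc : IsEquivariant W K c) :
    -- the Poisson brackets on the two centres are well defined
    HasPoissonStructure K c ∧ HasPoissonStructure W (extendByZero K c) ∧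
    -- `H_c(K) → H_c(W)` is an embedding, and `Z_c(W) = Z_c(K)^Γ` as subalgebras of `H_c(W)`
    Function.Injective (inclusionMap hKW c) ∧
    centre W (extendByZero K c) =
      (gammaInvariants hKW hc).map ((inclusionMap hKW c).comp (centre K c).val) ∧
    -- the resulting inclusion `Z_c(W) ⊆ Z_c(K)` is a morphism of Poisson algebras, and induces
    -- an identification of the Calogero–Moser space of `W` with the quotient of that of `K` by `Γ`
    ∃ j : centre W (extendByZero K c) →ₐ[ℂ] centre K c,
      (∀ z, inclusionMap hKW c (j z) = z) ∧
      j.range = gammaInvariants hKW hc ∧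
      (∀ z₁ z₂, j (bracket z₁ z₂) = bracket (j z₁) (j z₂)) ∧
      IsGeometricQuotient (gammaActSpace hKW hc) (cmMap j) := by
  have := hW.finite
  obtain ⟨j, hj, hrange⟩ := exists_centre_embedding hKW hc
  refine ⟨hasPoissonStructure (hc.isConjInvariant hKW), hasPoissonStructure (hc.extendByZero hKW),
    inclusionMap_injective hKW hc, centre_eq_map_gammaInvariants hKW hc, j, hj, hrange,
    bracket_centre_embedding hKW hc hj, ?_⟩
  have hinj : Function.Injective j := fun z₁ z₂ h => by
    apply Subtype.ext
    rw [← hj, ← hj, h]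
  refine isGeometricQuotient_spec (j : centre W (extendByZero K c) →+* centre K c) hinj
    ((MulSemiringAction.toRingEquiv _ _).comp (gammaAct hKW hc)) fun z => ?_
  exact SetLike.ext_iff.mp hrange z
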